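/- Let $k$ be an algebraically closed field of characteristic $0$. A finite-dimensional representation $\rho:\mathfrak g\to\operatorname{End}_k(V)$ of a semisimple Lie algebra $\mathfrak g$ over $k$ is called *asymmetrical* if for every non-inner automorphism $\alpha$ of $\mathfrak g$ there is a sub-representation $\sigma$ of $\rho$ that is not equivalent to $\sigma\circ\alpha$. Let $G_0$ be a (connected) semisimple algebraic group over $k$ with Lie algebra $\mathfrak g_0$, let $\rho_0:G_0\to\operatorname{GL}(U_0/k)$ be a finite-dimensional linear representation, and let $\rho_0'=\rho_0\oplus\operatorname{Ad}$ on $U_0'=U_0\oplus\mathfrak g_0$. Assume that $\rho_0'$ is faithful and that its derived representation $\rho_0'^{\mathrm{der}}:\mathfrak g_0\to\operatorname{End}_k(U_0')$ is asymmetrical. Let $U$ be the trivial one-dimensional representation of $G_0$, let $0\neq e\in U$, and put $U'=U\oplus\mathfrak g_0$. Define endomorphisms $a$ of $U\otimes_kU'\otimes_kU_0'$ and $a'$ of $U'$ by $$a\bigl(x_1\otimes(x+x')\otimes(x_0+x_0')\bigr)=x_1\otimes\bigl(x_0'\otimes x'+e\otimes\rho_0'^{\mathrm{der}}(x')(x_0+x_0')\bigr),\qquad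 a'(x+x')=x,$$ for $x_0\in U_0$, $x,x_1\in U$, $x',x_0'\in\mathfrak g_0$ (in the term $x_0'\otimes x'$ one regards $x_0'\in\mathfrak g_0\subset U'$ and $x'\in\mathfrak g_0\subset U_0'$). Let $G^0$ be the pointwise stabilizer of $k[a]$, $k[a']$ and $\operatorname{End}_{G_0}(U_0')$ in $\operatorname{GL}(U/k)\times\operatorname{GL}(U'/k)\times\operatorname{GL}(U_0'/k)$, i.e. the group of all triples $(g,g',g_0')$ such that $g\otimes g'\otimes g_0'$ commutes with $k[a]$, $g'$ commutes with $k[a']$, and $g_0'$ commutes with $\operatorname{End}_{G_0}(U_0')$. Let $T^0$ be the center of $G^0$, let $T_0'$ be the center of $\operatorname{End}_{G_0}(U_0')^\times$, and let $T'\subset T_0'$ be the subgroup of the elements that act on $\mathfrak g_0$ by a scalar. Regard $G_0$ as a subgroup of $\operatorname{GL}(U/k)\times\operatorname{GL}(U'/k)\times\operatorname{GL}(U_0'/k)$ through its actions on $U$, $U'$ and $U_0'$. Then $T^0G_0=G^0$. The group $T'$ is a torus, and $T^0=\mathbb G_m\times\mathbb G_m\times T'$, where the two copies of $\mathbb G_m$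 act as scalars on $U$ and on $U'$, respectively, and $T'$ acts on $U_0'$. In particular $T^0$ is a torus and is connected. If moreover $G_0\neq1$, then the rank of $T^0$ is $$3+\#\{\text{isotypic components of }U_0'\}-\#\{\text{simple factors of }\mathfrak g_0\}.$$ -/

import Mathlib

open scoped TensorProduct Pointwise

namespace AlgGrp

noncomputable section

attribute [local instance 100] LieRing.ofAssociativeRing

/-! ### Algebras of regular functions

Throughout, `k` is a field (algebraically closed of characteristic zero in the application). A
variety is a set `X` (of `k`-points) together with its algebra of regular functions, a subalgebra
of the algebra of all functions `X → k`. -/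

section Coord

variable {k : Type*} [Field k] {X Y : Type*}

/-- Regular functions on `X × Y`: the algebra generated by the regular functions of either factor. -/
def prodCoord (A : Subalgebra k (X → k)) (B : Subalgebra k (Y → k)) : Subalgebra k (X × Y → k) :=
  Algebra.adjoin k
    ({F | ∃ f ∈ A, F = fun p => f p.1} ∪ {F | ∃ f ∈ B, F = fun p => f p.2})

/-- Regular functions on a closed subset: restrictions of regular functions. -/
def restrictCoord (A : Subalgebra k (X → k)) (S : Set X) : Subalgebra k (S → k) :=
  A.map (AlgHom.pi fun s : S => Pi.evalAlgHom k (fun _ : X => k) (s : X))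

/-- A map is a morphism of varieties if it pulls back regular functions to regular functions. -/
def IsRegularMap (A : Subalgebra k (X → k)) (B : Subalgebra k (Y → k)) (φ : X → Y) : Prop :=
  ∀ f ∈ B, (fun x => f (φ x)) ∈ A

/-- The Zariski topology, with the basic open sets `{f ≠ 0}`. -/
@[reducible] def zariski (A : Subalgebra k (X → k)) : TopologicalSpace X :=
  TopologicalSpace.generateFrom {U | ∃ f ∈ A, U = {x | f x ≠ 0}}

/-- Closedness in the Zariski topology. -/
def IsZariskiClosed (A : Subalgebra k (X → k)) (S : Set X) : Prop :=
  @IsClosed X (zariski A) S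

/-- Connectedness in the Zariski topology. -/
def IsZariskiConnected (A : Subalgebra k (X → k)) (S : Set X) : Prop :=
  @IsConnected X (zariski A) S

/-- The regular functions on `GL(V)`: generated by the matrix coefficients of `g` and of `g⁻¹`. -/
def glCoord (k : Type*) [Field k] (V : Type*) [AddCommGroup V] [Module k V] :
    Subalgebra k (LinearMap.GeneralLinearGroup k V → k) :=
  Algebra.adjoin k
    ({F | ∃ (l : Module.Dual k V) (v : V), F = fun g => l (g.1 v)} ∪
     {F | ∃ (l : Module.Dual k V) (v : V), F = fun g => l ((g⁻¹).1 v)})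

/-- The regular functions on the split torus of rank `r`: Laurent polynomials in the coordinates. -/
def torusCoord (k : Type*) [Field k] (r : ℕ) : Subalgebra k ((Fin r → kˣ) → k) :=
  Algebra.adjoin k
    (Set.range (fun (i : Fin r) (t : Fin r → kˣ) => (t i : k)) ∪
     Set.range (fun (i : Fin r) (t : Fin r → kˣ) => (((t i)⁻¹ : kˣ) : k)))

/-- The subgroup `H` of an algebraic group with regular functions `A` is a torus of rank `r`: it is
isomorphic, as an algebraic group, to the `r`-th power of the multiplicative group. -/
def IsTorusOfRank {G : Type*} [Group G] (A : Subalgebra k (G → k)) (H : Subgroup G) (r : ℕ) :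
    Prop :=
  ∃ φ : H ≃* (Fin r → kˣ),
    IsRegularMap (restrictCoord A (H : Set G)) (torusCoord k r) φ ∧
    IsRegularMap (torusCoord k r) (restrictCoord A (H : Set G)) φ.symm

end Coord

/-! ### Affine algebraic groups -/

/-- An affine algebraic group over an algebraically closed field `k`, in the language of varieties:
`G` is the group of `k`-points and `coord` its algebra of regular functions. -/
class AffineAlgGroup (k : Type*) [Field k] (G : Type*) [Group G] where
  /-- the coordinate ring -/
  coord : Subalgebra k (G → k)
  fg : coord.FG
  /-- regular functions separate points -/
  separates : ∀ g h : G, (∀ f ∈ coord, f g = f h) → g = h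
  /-- every `k`-valued character of the coordinate ring is the evaluation at a point -/
  exists_point : ∀ χ : coord →ₐ[k] k, ∃ g : G, ∀ f : coord, χ f = (f : G → k) g
  mul_regular : IsRegularMap (prodCoord coord coord) coord (fun p : G × G => p.1 * p.2)
  inv_regular : IsRegularMap coord coord (fun g : G => g⁻¹)

/-- The coordinate ring of an affine algebraic group. -/
abbrev coordRing (k : Type*) [Field k] (G : Type*) [Group G] [AffineAlgGroup k G] :
    Subalgebra k (G → k) :=
  AffineAlgGroup.coord

/-- A semisimple algebraic group: connected, with trivial radical, that is, without non-trivial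
closed connected solvable normal subgroups. -/
structure IsSemisimple (k : Type*) [Field k] (G : Type*) [Group G] [AffineAlgGroup k G] :
    Prop where
  connected : IsZariskiConnected (coordRing k G) (Set.univ : Set G)
  radical_trivial : ∀ N : Subgroup G, N.Normal → IsZariskiClosed (coordRing k G) (N : Set G) →
    IsZariskiConnected (coordRing k G) (N : Set G) → Group.IsSolvable N → N = ⊥

section Lie

variable {k : Type*} [Field k] {G : Type*} [Group G]

theorem prodCoord_sum {X Y : Type*} {A : Subalgebra k (X → k)} {B : Subalgebra k (Y → k)}
    {F : X × Y → k} (hF : F ∈ prodCoord A B) :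
    ∃ (n : ℕ) (a : Fin n → A) (b : Fin n → B),
      ∀ x y, F (x, y) = ∑ i, (a i : X → k) x * (b i : Y → k) y := by
  rw [prodCoord, ← Subalgebra.mem_toSubmodule, Algebra.adjoin_eq_span] at hF
  obtain ⟨n, c, m, rfl⟩ := Submodule.mem_span_set'.1 hF
  have key : ∀ i, ∃ (a : A) (b : B),
      ∀ x y, (m i : X × Y → k) (x, y) = (a : X → k) x * (b : Y → k) y := by
    intro i
    refine Submonoid.closure_induction
      (motive := fun (M : X × Y → k) _ => ∃ (a : A) (b : B),
        ∀ x y, M (x, y) = (a : X → k) x * (b : Y → k) y) ?_ ?_ ?_ (m i).2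
    · rintro _ (⟨f, hf, rfl⟩ | ⟨f, hf, rfl⟩)
      · exact ⟨⟨f, hf⟩, 1, by simp⟩
      · exact ⟨1, ⟨f, hf⟩, by simp⟩
    · exact ⟨1, 1, by simp⟩
    · rintro M N - - ⟨a, b, h⟩ ⟨a', b', h'⟩
      refine ⟨a * a', b * b', fun x y => ?_⟩
      simp only [Pi.mul_apply, MulMemClass.coe_mul, h, h']
      ring
  choose a b hab using key
  refine ⟨n, fun i => c i • a i, b, fun x y => ?_⟩
  simp [Finset.sum_apply, hab, mul_assoc]

variable [AffineAlgGroup k G]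

theorem mul_sum {f : G → k} (hf : f ∈ coordRing k G) :
    ∃ (n : ℕ) (a b : Fin n → coordRing k G),
      ∀ x y, f (x * y) = ∑ i, (a i : G → k) x * (b i : G → k) y :=
  prodCoord_sum (AffineAlgGroup.mul_regular f hf)

theorem mul_left_mem (h : G) {f : G → k} (hf : f ∈ coordRing k G) :
    (fun x => f (h * x)) ∈ coordRing k G := by
  obtain ⟨n, a, b, hab⟩ := mul_sum hf
  have : (fun x => f (h * x)) = ∑ i, (a i : G → k) h • (b i : G → k) := by
    funext x
    simpa using hab h x
  rw [this]
  exact Subalgebra.sum_mem _ fun i _ => Subalgebra.smul_mem _ (b i).2 _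

theorem mul_right_mem (h : G) {f : G → k} (hf : f ∈ coordRing k G) :
    (fun x => f (x * h)) ∈ coordRing k G := by
  obtain ⟨n, a, b, hab⟩ := mul_sum hf
  have : (fun x => f (x * h)) = ∑ i, (b i : G → k) h • (a i : G → k) := by
    funext x
    simpa [mul_comm] using hab x h
  rw [this]
  exact Subalgebra.sum_mem _ fun i _ => Subalgebra.smul_mem _ (a i).2 _

variable (k)

/-- Left translation on regular functions: `f ↦ (x ↦ f (h x))`. -/
def leftTrans (h : G) : coordRing k G →ₐ[k] coordRing k G where
  toFun f := ⟨fun x => (f : G → k) (h * x), mul_left_mem h f.2⟩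
  map_one' := rfl
  map_mul' _ _ := rfl
  map_zero' := rfl
  map_add' _ _ := rfl
  commutes' _ := rfl

/-- Right translation on regular functions: `f ↦ (x ↦ f (x h))`. -/
def rightTrans (h : G) : coordRing k G →ₐ[k] coordRing k G where
  toFun f := ⟨fun x => (f : G → k) (x * h), mul_right_mem h f.2⟩
  map_one' := rfl
  map_mul' _ _ := rfl
  map_zero' := rfl
  map_add' _ _ := rfl
  commutes' _ := rfl

theorem leftTrans_apply (h : G) (f : coordRing k G) (x : G) :
    (leftTrans k h f : G → k) x = (f : G → k) (h * x) := rfl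

theorem rightTrans_apply (h : G) (f : coordRing k G) (x : G) :
    (rightTrans k h f : G → k) x = (f : G → k) (x * h) := rfl

theorem rightTrans_one (f : coordRing k G) : rightTrans k (1 : G) f = f := by
  ext x; simp [rightTrans_apply]

theorem rightTrans_mul (g h : G) (f : coordRing k G) :
    rightTrans k (g * h) f = rightTrans k g (rightTrans k h f) := by
  ext x; simp [rightTrans_apply, mul_assoc]

theorem rightTrans_inv (g : G) (f : coordRing k G) :
    rightTrans k g (rightTrans k g⁻¹ f) = f := by
  rw [← rightTrans_mul, mul_inv_cancel, rightTrans_one]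

theorem left_right (g h : G) (f : coordRing k G) :
    leftTrans k g (rightTrans k h f) = rightTrans k h (leftTrans k g f) := by
  ext x; simp [rightTrans_apply, leftTrans_apply, mul_assoc]

variable (G)

/-- The Lie subalgebra of those derivations of the coordinate ring that commute with all left
translations. -/
def leftInvDer : LieSubalgebra k (Derivation k (coordRing k G) (coordRing k G)) where
  carrier := {D | ∀ (h : G) (f : coordRing k G), D (leftTrans k h f) = leftTrans k h (D f)}
  add_mem' {D E} hD hE h f := by simp [hD h f, hE h f]
  zero_mem' h f := by simp
  smul_mem' c D hD h f := by simp [hD h f]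
  lie_mem' {D E} hD hE h f := by
    simp [Derivation.commutator_apply, hE h, hD h]

/-- The Lie algebra of `G`: the left-invariant derivations of the coordinate ring. -/
def LieAlg : Type _ := leftInvDer k G

instance : LieRing (LieAlg k G) := inferInstanceAs (LieRing (leftInvDer k G))

instance : LieAlgebra k (LieAlg k G) := inferInstanceAs (LieAlgebra k (leftInvDer k G))

instance : AddCommGroup (LieAlg k G) := LieRing.toAddCommGroup

instance : Module k (LieAlg k G) := LieAlgebra.toModule

/-- The inclusion of the Lie algebra into all derivations. -/
def toDer : LieAlg k G →ₗ⁅k⁆ Derivation k (coordRing k G) (coordRing k G) :=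
  (leftInvDer k G).incl

variable {G}

theorem toDer_left (D : LieAlg k G) (h : G) (f : coordRing k G) :
    toDer k G D (leftTrans k h f) = leftTrans k h (toDer k G D f) :=
  D.2 h f

/-- A left-invariant derivation as an element of the Lie algebra. -/
def ofDer (D : Derivation k (coordRing k G) (coordRing k G))
    (hD : ∀ (h : G) (f : coordRing k G), D (leftTrans k h f) = leftTrans k h (D f)) :
    LieAlg k G :=
  ⟨D, hD⟩

theorem toDer_ofDer (D : Derivation k (coordRing k G) (coordRing k G))
    (hD : ∀ (h : G) (f : coordRing k G), D (leftTrans k h f) = leftTrans k h (D f)) :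
    toDer k G (ofDer k D hD) = D := rfl

theorem lieAlg_ext' {D E : LieAlg k G} (h : ∀ f, toDer k G D f = toDer k G E f) : D = E :=
  Subtype.ext (Derivation.ext h)

/-- The tangent vector at the identity of an element of the Lie algebra: `f ↦ (D f)(1)`. -/
def tangent (D : LieAlg k G) : coordRing k G →ₗ[k] k where
  toFun f := (toDer k G D f : G → k) 1
  map_add' f g := by simp
  map_smul' c f := by simp

theorem tangent_apply (D : LieAlg k G) (f : coordRing k G) :
    tangent k D f = (toDer k G D f : G → k) 1 := rfl

theorem tangent_add (D E : LieAlg k G) (f : coordRing k G) :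
    tangent k (D + E) f = tangent k D f + tangent k E f := by
  simp [tangent_apply]

theorem tangent_smul (c : k) (D : LieAlg k G) (f : coordRing k G) :
    tangent k (c • D) f = c * tangent k D f := by
  simp [tangent_apply]

theorem apply_eq_tangent (D : LieAlg k G) (f : coordRing k G) (g : G) :
    (toDer k G D f : G → k) g = tangent k D (leftTrans k g f) := by
  rw [tangent_apply, toDer_left, leftTrans_apply, mul_one]

theorem lieAlg_ext {D E : LieAlg k G} (h : ∀ f, tangent k D f = tangent k E f) : D = E := by
  apply lieAlg_ext'
  intro f
  ext g
  rw [apply_eq_tangent, apply_eq_tangent, h]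

/-- Finitely many regular functions suffice to distinguish tangent vectors at the identity. -/
theorem exists_coordinates : ∃ (s : Finset (coordRing k G)) (T : LieAlg k G →ₗ[k] (s → k)),
    (∀ D f, T D f = tangent k D f) ∧ Function.Injective T := by
  obtain ⟨t, ht⟩ := (Subalgebra.fg_iff_finiteType _).1 (AffineAlgGroup.fg (k := k) (G := G))
  refine ⟨t, { toFun := fun D f => tangent k D f,
               map_add' := fun D E => funext fun f => tangent_add k D E f,
               map_smul' := fun c D => funext fun f => tangent_smul k c D f },
    fun _ _ => rfl, ?_⟩
  rw [injective_iff_map_eq_zero]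
  intro D hD
  apply lieAlg_ext
  intro f
  have hf : f ∈ Algebra.adjoin k (t : Set (coordRing k G)) := by rw [ht]; trivial
  have h0 : tangent k (0 : LieAlg k G) f = 0 := by simp [tangent_apply]
  rw [h0]
  induction hf using Algebra.adjoin_induction with
  | mem x hx => exact congrFun hD ⟨x, hx⟩
  | algebraMap r => simp [tangent_apply]
  | add x y _ _ hx hy => rw [map_add, hx (by simp [tangent_apply]), hy (by simp [tangent_apply]),
      add_zero]
  | mul x y _ _ hx hy =>
    have hx' : (toDer k G D x : G → k) 1 = 0 := hx (by simp [tangent_apply])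
    have hy' : (toDer k G D y : G → k) 1 = 0 := hy (by simp [tangent_apply])
    simp [tangent_apply, hx', hy']

instance : FiniteDimensional k (LieAlg k G) := by
  obtain ⟨s, T, -, hT⟩ := exists_coordinates k (G := G)
  exact FiniteDimensional.of_injective T hT

/-- The derivation `Ad(g) D = R_g ∘ D ∘ R_g⁻¹`, where `(R_g f)(x) = f (x g)`. -/
def adElem (g : G) (D : LieAlg k G) : LieAlg k G :=
  ofDer k
    (Derivation.mk'
      ((rightTrans k g).toLinearMap ∘ₗ (toDer k G D).toLinearMap ∘ₗ
        (rightTrans k g⁻¹).toLinearMap)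
      (fun a b => by
        change rightTrans k g (toDer k G D (rightTrans k g⁻¹ (a * b))) =
          a * rightTrans k g (toDer k G D (rightTrans k g⁻¹ b)) +
            b * rightTrans k g (toDer k G D (rightTrans k g⁻¹ a))
        rw [map_mul, Derivation.leibniz, map_add, smul_eq_mul, smul_eq_mul, map_mul, map_mul,
          rightTrans_inv, rightTrans_inv]))
    (fun h f => by
      change rightTrans k g (toDer k G D (rightTrans k g⁻¹ (leftTrans k h f))) =
        leftTrans k h (rightTrans k g (toDer k G D (rightTrans k g⁻¹ f)))
      rw [← left_right, toDer_left, ← left_right])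

theorem adElem_apply (g : G) (D : LieAlg k G) (f : coordRing k G) :
    toDer k G (adElem k g D) f = rightTrans k g (toDer k G D (rightTrans k g⁻¹ f)) := rfl

/-- The adjoint representation of `G` on its Lie algebra. -/
def Ad : Representation k G (LieAlg k G) where
  toFun g :=
    { toFun := adElem k g
      map_add' := fun D E => lieAlg_ext' k fun f => by simp [adElem_apply]
      map_smul' := fun c D => lieAlg_ext' k fun f => by simp [adElem_apply] }
  map_one' := LinearMap.ext fun D => lieAlg_ext' k fun f => by
    simp [adElem_apply, rightTrans_one]
  map_mul' g h := LinearMap.ext fun D => lieAlg_ext' k fun f => by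
    simp [adElem_apply, rightTrans_mul]

theorem Ad_apply (g : G) (D : LieAlg k G) (f : coordRing k G) :
    toDer k G (Ad k g D) f = rightTrans k g (toDer k G D (rightTrans k g⁻¹ f)) := rfl

/-- A representation on a finite-dimensional space is regular (a homomorphism of algebraic groups
`G → GL(V)`) if its matrix coefficients are regular functions. -/
def IsRegularRep {V : Type*} [AddCommGroup V] [Module k V] (ρ : Representation k G V) : Prop :=
  ∀ (l : Module.Dual k V) (v : V), (fun g => l (ρ g v)) ∈ coordRing k G

theorem isRegularRep_Ad : IsRegularRep k (Ad k (G := G)) := by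
  classical
  obtain ⟨s, T, hT, hinj⟩ := exists_coordinates k (G := G)
  obtain ⟨S, hS⟩ := LinearMap.exists_leftInverse_of_injective T (LinearMap.ker_eq_bot.2 hinj)
  have hmain : ∀ (f : coordRing k G) (D : LieAlg k G),
      (fun g => tangent k (Ad k g D) f) ∈ coordRing k G := by
    intro f D
    obtain ⟨n, a, b, hab⟩ := mul_sum f.2
    choose m c d hcd using fun i => mul_sum (b i).2
    have h1 : (fun g => tangent k (Ad k g D) f) =
        ∑ i, ∑ j, (tangent k D (c i j)) • ((a i : G → k) * fun g => (d i j : G → k) g⁻¹) := by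
      funext g
      have h2 : tangent k (Ad k g D) f = tangent k D (leftTrans k g (rightTrans k g⁻¹ f)) := by
        rw [← apply_eq_tangent, tangent_apply, Ad_apply, rightTrans_apply, one_mul]
      have h3 : leftTrans k g (rightTrans k g⁻¹ f) =
          ∑ i, ∑ j, ((a i : G → k) g * (d i j : G → k) g⁻¹) • c i j := by
        apply Subtype.ext
        funext x
        rw [leftTrans_apply, rightTrans_apply, mul_assoc, hab]
        simp only [hcd, Finset.mul_sum, AddSubmonoidClass.coe_finsetSum, Finset.sum_apply,
          Subalgebra.coe_smul, Pi.smul_apply, smul_eq_mul]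
        exact Finset.sum_congr rfl fun i _ => Finset.sum_congr rfl fun j _ => by ring
      rw [h2, h3]
      simp only [map_sum, map_smul, Finset.sum_apply, Pi.smul_apply, Pi.mul_apply, smul_eq_mul]
      exact Finset.sum_congr rfl fun i _ => Finset.sum_congr rfl fun j _ => by ring
    rw [h1]
    exact Subalgebra.sum_mem _ fun i _ => Subalgebra.sum_mem _ fun j _ =>
      Subalgebra.smul_mem _ (Subalgebra.mul_mem _ (a i).2
        (AffineAlgGroup.inv_regular _ (d i j).2)) _
  intro l D
  have h1 : (fun g => l (Ad k g D)) =
      ∑ i : s, l (S (Pi.single i 1)) • fun g => tangent k (Ad k g D) (i : coordRing k G) := by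
    funext g
    have h2 : S (T (Ad k g D)) = Ad k g D := LinearMap.congr_fun hS _
    conv_lhs => rw [← h2, ← LinearMap.comp_apply, LinearMap.pi_apply_eq_sum_univ (l ∘ₗ S)]
    simp only [hT, Finset.sum_apply, Pi.smul_apply, smul_eq_mul, LinearMap.comp_apply]
    refine Finset.sum_congr rfl fun i _ => ?_
    rw [mul_comm]
    congr 3
    funext j
    simp [Pi.single_apply, eq_comm]
  rw [h1]
  exact Subalgebra.sum_mem _ fun i _ => Subalgebra.smul_mem _ (hmain _ _) _

theorem IsRegularRep.prod {V W : Type*} [AddCommGroup V] [Module k V] [AddCommGroup W]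
    [Module k W] {ρ : Representation k G V} {σ : Representation k G W}
    (hρ : IsRegularRep k ρ) (hσ : IsRegularRep k σ) : IsRegularRep k (ρ.prod σ) := by
  intro l v
  have : (fun g => l ((ρ.prod σ) g v)) =
      (fun g => (l ∘ₗ LinearMap.inl k V W) (ρ g v.1)) +
        fun g => (l ∘ₗ LinearMap.inr k V W) (σ g v.2) := by
    funext g
    simp [← map_add]
  rw [this]
  exact Subalgebra.add_mem _ (hρ _ _) (hσ _ _)

section Derived

variable {V : Type*} [AddCommGroup V] [Module k V] {ρ : Representation k G V}

/-- The matrix coefficient `g ↦ l (ρ(g) v)`, as a regular function. -/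
def coeff (hρ : IsRegularRep k ρ) (l : Module.Dual k V) (v : V) : coordRing k G :=
  ⟨fun g => l (ρ g v), hρ l v⟩

variable [FiniteDimensional k V]

/-- The underlying linear map of the derived representation; `derivedFun hρ D v` is the vector
with `l (derivedFun hρ D v) = (D c)(1)`, where `c(g) = l (ρ(g) v)`, for all linear forms `l`. -/
def derivedFun (hρ : IsRegularRep k ρ) (D : LieAlg k G) (v : V) : V :=
  (Module.evalEquiv k V).symm
    { toFun := fun l => tangent k D (coeff k hρ l v)
      map_add' := fun l m => by rw [← map_add]; rfl
      map_smul' := fun c l => by rw [RingHom.id_apply, ← map_smul]; rfl }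

theorem dual_derivedFun (hρ : IsRegularRep k ρ) (D : LieAlg k G) (v : V) (l : Module.Dual k V) :
    l (derivedFun k hρ D v) = tangent k D (coeff k hρ l v) := by
  simp [derivedFun]

theorem dual_ext {v w : V} (h : ∀ l : Module.Dual k V, l v = l w) : v = w := by
  rw [← sub_eq_zero, ← Module.forall_dual_apply_eq_zero_iff k]
  intro l; rw [map_sub, h, sub_self]

theorem apply_coeff (hρ : IsRegularRep k ρ) (D : LieAlg k G) (v : V) (l : Module.Dual k V) :
    toDer k G D (coeff k hρ l v) = coeff k hρ l (derivedFun k hρ D v) := by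
  ext g
  have : leftTrans k g (coeff k hρ l v) = coeff k hρ (l ∘ₗ ρ g) v := by
    ext x; simp [leftTrans_apply, coeff]
  rw [apply_eq_tangent, this, ← dual_derivedFun]
  rfl

/-- The derived representation `dρ : Lie(G) → End(V)` of a regular representation `ρ`. -/
def derived (hρ : IsRegularRep k ρ) : LieAlg k G →ₗ⁅k⁆ Module.End k V where
  toFun D :=
    { toFun := derivedFun k hρ D
      map_add' := fun v w => dual_ext k fun l => by
        rw [map_add, dual_derivedFun, dual_derivedFun, dual_derivedFun, ← map_add]
        congr 1
        ext g; simp [coeff]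
      map_smul' := fun c v => dual_ext k fun l => by
        simp only [RingHom.id_apply, map_smul, dual_derivedFun]
        rw [← map_smul]
        congr 1
        ext g; simp [coeff] }
  map_add' D E := LinearMap.ext fun v => dual_ext k fun l => by
    simp only [LinearMap.coe_mk, AddHom.coe_mk, LinearMap.add_apply, map_add, dual_derivedFun,
      tangent_add]
  map_smul' c D := LinearMap.ext fun v => dual_ext k fun l => by
    simp only [LinearMap.coe_mk, AddHom.coe_mk, LinearMap.smul_apply, map_smul, dual_derivedFun,
      tangent_smul, RingHom.id_apply, smul_eq_mul]
  map_lie' {D E} := LinearMap.ext fun v => dual_ext k fun l => by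
    simp only [LinearMap.coe_mk, AddHom.coe_mk, Ring.lie_def, LinearMap.sub_apply,
      Module.End.mul_apply, map_sub, dual_derivedFun]
    rw [← apply_coeff, ← apply_coeff]
    simp only [tangent_apply, LieHom.map_lie,
      Derivation.commutator_apply, AddSubgroupClass.coe_sub, Pi.sub_apply]

end Derived

end Lie

/-! ### Asymmetrical representations of Lie algebras -/

section Asymmetrical

variable {k : Type*} [Field k] {L : Type*} [LieRing L] [LieAlgebra k L]

/-- The exponential of a nilpotent endomorphism (a finite sum). -/
def nilExp {V : Type*} [AddCommGroup V] [Module k V] (f : Module.End k V) : Module.End k V :=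
  ∑ n ∈ Finset.range (nilpotencyClass f), ((n.factorial : k)⁻¹) • f ^ n

/-- An automorphism of a semisimple Lie algebra (over an algebraically closed field of
characteristic zero) is inner if it is a product of exponentials `exp (ad x)` with `ad x`
nilpotent. -/
def IsInnerAut (α : L ≃ₗ⁅k⁆ L) : Prop :=
  (α : L →ₗ[k] L) ∈ Submonoid.closure
    {φ : Module.End k L | ∃ x : L, IsNilpotent (LieAlgebra.ad k L x) ∧
      φ = nilExp (LieAlgebra.ad k L x)}

/-- `ρ` is asymmetrical if for every non-inner automorphism `α` there is a sub-representation `W`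
of `ρ` that is not equivalent to its twist by `α`. -/
def IsAsymmetrical {V : Type*} [AddCommGroup V] [Module k V] (ρ : L →ₗ⁅k⁆ Module.End k V) : Prop :=
  ∀ α : L ≃ₗ⁅k⁆ L, ¬ IsInnerAut α →
    ∃ (W : Submodule k V) (hW : ∀ x, ∀ w ∈ W, ρ x w ∈ W),
      ¬ ∃ φ : W ≃ₗ[k] W, ∀ (x : L) (w : W),
        φ ⟨ρ x w, hW x w w.2⟩ = ⟨ρ (α x) (φ w), hW (α x) (φ w) (φ w).2⟩

end Asymmetrical

/-! ### The stabilizer of the three algebras -/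

section Stabilizer

variable (k : Type*) [Field k] {G₀ : Type*} [Group G₀] [AffineAlgGroup k G₀]
variable (U : Type*) [AddCommGroup U] [Module k U]
variable {U₀ : Type*} [AddCommGroup U₀] [Module k U₀]

/-- The representation `ρ₀' = ρ₀ ⊕ Ad` on `U₀' = U₀ ⊕ 𝔤₀`. -/
def rho0' (ρ₀ : Representation k G₀ U₀) : Representation k G₀ (U₀ × LieAlg k G₀) :=
  ρ₀.prod (Ad k)

/-- The representation on `U' = U ⊕ 𝔤₀`, where `G₀` acts trivially on `U`. -/
def rhoU' : Representation k G₀ (U × LieAlg k G₀) :=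
  (Representation.trivial k G₀ U).prod (Ad k)

/-- The derived representation of `ρ₀'`. -/
def rho0'der [FiniteDimensional k U₀] {ρ₀ : Representation k G₀ U₀} (hρ₀ : IsRegularRep k ρ₀) :
    LieAlg k G₀ →ₗ⁅k⁆ Module.End k (U₀ × LieAlg k G₀) :=
  derived k (ρ := rho0' k ρ₀) (hρ₀.prod k (isRegularRep_Ad k))

/-- The endomorphism `a` of `U ⊗ U' ⊗ U₀'`,
`x₁ ⊗ (x + x') ⊗ (x₀ + x₀') ↦ x₁ ⊗ (x₀' ⊗ x' + e ⊗ dρ₀'(x') (x₀ + x₀'))`. -/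
def endoA [FiniteDimensional k U₀] {ρ₀ : Representation k G₀ U₀} (hρ₀ : IsRegularRep k ρ₀)
    (e : U) :
    Module.End k (U ⊗[k] ((U × LieAlg k G₀) ⊗[k] (U₀ × LieAlg k G₀))) :=
  LinearMap.lTensor U <| TensorProduct.lift <|
    LinearMap.mk₂ k
      (fun (u : U × LieAlg k G₀) (v : U₀ × LieAlg k G₀) =>
        ((0, v.2) : U × LieAlg k G₀) ⊗ₜ[k] ((0, u.2) : U₀ × LieAlg k G₀) +
          ((e, 0) : U × LieAlg k G₀) ⊗ₜ[k] rho0'der k hρ₀ u.2 v)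
      (fun u₁ u₂ v => by
        have : ((0, u₁.2 + u₂.2) : U₀ × LieAlg k G₀) = (0, u₁.2) + (0, u₂.2) := by simp
        simp only [Prod.snd_add, this, map_add, LinearMap.add_apply, TensorProduct.tmul_add]
        abel)
      (fun c u v => by
        have : ((0, c • u.2) : U₀ × LieAlg k G₀) = c • (0, u.2) := by simp
        simp only [Prod.smul_snd, this, map_smul, LinearMap.smul_apply, TensorProduct.tmul_smul,
          smul_add])
      (fun u v₁ v₂ => by
        have : ((0, v₁.2 + v₂.2) : U × LieAlg k G₀) = (0, v₁.2) + (0, v₂.2) := by simp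
        simp only [Prod.snd_add, this, map_add, TensorProduct.tmul_add, TensorProduct.add_tmul]
        abel)
      (fun c u v => by
        have : ((0, c • v.2) : U × LieAlg k G₀) = c • (0, v.2) := by simp
        simp only [Prod.smul_snd, this, map_smul, TensorProduct.tmul_smul, smul_add,
          TensorProduct.smul_tmul'])

/-- The endomorphism `a'` of `U' = U ⊕ 𝔤₀`, `x + x' ↦ x`. -/
def endoA' : Module.End k (U × LieAlg k G₀) :=
  LinearMap.inl k U (LieAlg k G₀) ∘ₗ LinearMap.fst k U (LieAlg k G₀)

/-- The algebra `End_G(V)` of endomorphisms of a representation. -/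
def endAlg {G V : Type*} [Group G] [AddCommGroup V] [Module k V] (ρ : Representation k G V) :
    Subalgebra k (Module.End k V) :=
  Subalgebra.centralizer k (Set.range ρ)

variable (G₀ U₀) in
/-- The ambient group `GL(U) × GL(U') × GL(U₀')`. -/
abbrev Ambient : Type _ :=
  LinearMap.GeneralLinearGroup k U × LinearMap.GeneralLinearGroup k (U × LieAlg k G₀) ×
    LinearMap.GeneralLinearGroup k (U₀ × LieAlg k G₀)

variable (G₀ U₀) in
/-- Regular functions on `GL(U) × GL(U') × GL(U₀')`. -/
def ambientCoord : Subalgebra k (Ambient k G₀ U U₀ → k) :=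
  prodCoord (glCoord k U) (prodCoord (glCoord k (U × LieAlg k G₀)) (glCoord k (U₀ × LieAlg k G₀)))

variable (G₀ U₀) in
/-- The action of `GL(U) × GL(U') × GL(U₀')` on `U ⊗ U' ⊗ U₀'`. -/
def tensorAct (g : Ambient k G₀ U U₀) :
    Module.End k (U ⊗[k] ((U × LieAlg k G₀) ⊗[k] (U₀ × LieAlg k G₀))) :=
  TensorProduct.map g.1.1 (TensorProduct.map g.2.1.1 g.2.2.1)

theorem tensorAct_one : tensorAct k G₀ U U₀ 1 = 1 := by
  simp only [tensorAct, Prod.fst_one, Prod.snd_one, Units.val_one, TensorProduct.map_one]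

theorem tensorAct_mul (g h : Ambient k G₀ U U₀) :
    tensorAct k G₀ U U₀ (g * h) = tensorAct k G₀ U U₀ g * tensorAct k G₀ U U₀ h := by
  simp [tensorAct, TensorProduct.map_mul]

/-- `G⁰`: the (pointwise) stabilizer of `k[a]`, `k[a']` and `End_{G₀}(U₀')`, that is, the group of
all triples `(g, g', g₀')` such that `g ⊗ g' ⊗ g₀'` commutes with `k[a]`, `g'` commutes with
`k[a']`, and `g₀'` commutes with `End_{G₀}(U₀')`. -/
def stab [FiniteDimensional k U₀] {ρ₀ : Representation k G₀ U₀} (hρ₀ : IsRegularRep k ρ₀)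
    (e : U) : Subgroup (Ambient k G₀ U U₀) where
  carrier := {g |
    (∀ b ∈ Algebra.adjoin k {endoA k U hρ₀ e}, Commute (tensorAct k G₀ U U₀ g) b) ∧
    (∀ b ∈ Algebra.adjoin k {endoA' k (G₀ := G₀) U}, Commute g.2.1.1 b) ∧
    (∀ b ∈ endAlg k (rho0' k ρ₀), Commute g.2.2.1 b)}
  one_mem' := by
    refine ⟨fun b _ => ?_, fun b _ => ?_, fun b _ => ?_⟩
    · rw [tensorAct_one]; exact Commute.one_left b
    · exact Commute.one_left b
    · exact Commute.one_left b
  mul_mem' {g h} hg hh := by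
    refine ⟨fun b hb => ?_, fun b hb => ?_, fun b hb => ?_⟩
    · rw [tensorAct_mul]; exact (hg.1 b hb).mul_left (hh.1 b hb)
    · exact (hg.2.1 b hb).mul_left (hh.2.1 b hb)
    · exact (hg.2.2 b hb).mul_left (hh.2.2 b hb)
  inv_mem' {g} hg := by
    refine ⟨fun b hb => ?_, fun b hb => ?_, fun b hb => ?_⟩
    · let u : (Module.End k (U ⊗[k] ((U × LieAlg k G₀) ⊗[k] (U₀ × LieAlg k G₀))))ˣ :=
        ⟨tensorAct k G₀ U U₀ g, tensorAct k G₀ U U₀ g⁻¹,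
          by rw [← tensorAct_mul, mul_inv_cancel, tensorAct_one],
          by rw [← tensorAct_mul, inv_mul_cancel, tensorAct_one]⟩
      have hu : Commute (u : Module.End k _) b := hg.1 b hb
      exact hu.units_inv_left
    · exact (hg.2.1 b hb).units_inv_left
    · exact (hg.2.2 b hb).units_inv_left

/-- The homomorphism `G₀ → GL(U) × GL(U') × GL(U₀')` given by the three representations. -/
def embed (ρ₀ : Representation k G₀ U₀) : G₀ →* Ambient k G₀ U U₀ :=
  (Representation.trivial k G₀ U).toHomUnits.prod
    ((rhoU' k U).toHomUnits.prod (rho0' k ρ₀).toHomUnits)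

/-- `T⁰`: the center of `G⁰`, as a subgroup of the ambient group. -/
def T0 [FiniteDimensional k U₀] {ρ₀ : Representation k G₀ U₀} (hρ₀ : IsRegularRep k ρ₀)
    (e : U) : Subgroup (Ambient k G₀ U U₀) :=
  (Subgroup.center (stab k U hρ₀ e)).map (stab k U hρ₀ e).subtype

/-- `T₀'`: the center of `End_{G₀}(U₀')ˣ`, as a subgroup of `GL(U₀')`. -/
def T0' (ρ₀ : Representation k G₀ U₀) :
    Subgroup (LinearMap.GeneralLinearGroup k (U₀ × LieAlg k G₀)) :=
  (Subgroup.center (endAlg k (rho0' k ρ₀))ˣ).map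
    (Units.map (endAlg k (rho0' k ρ₀)).val.toMonoidHom)

/-- `T'`: the subgroup of those elements of `T₀'` that act on `𝔤₀` by a scalar. -/
def T' (ρ₀ : Representation k G₀ U₀) :
    Subgroup (LinearMap.GeneralLinearGroup k (U₀ × LieAlg k G₀)) :=
  T0' k ρ₀ ⊓
    { carrier := {t | ∃ c : kˣ, ∀ x : LieAlg k G₀, t.1 (0, x) = (c : k) • (0, x)}
      one_mem' := ⟨1, fun x => by simp⟩
      mul_mem' := by
        rintro s t ⟨c, hc⟩ ⟨d, hd⟩
        refine ⟨d * c, fun x => ?_⟩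
        change s.1 (t.1 (0, x)) = _
        rw [hd, map_smul, hc, smul_smul, Units.val_mul]
      inv_mem' := by
        rintro t ⟨c, hc⟩
        refine ⟨c⁻¹, fun x => ?_⟩
        have h : (t⁻¹).1 (t.1 (0, x)) = (0, x) := by
          change ((t⁻¹ * t : LinearMap.GeneralLinearGroup k (U₀ × LieAlg k G₀)).1) (0, x) = (0, x)
          rw [inv_mul_cancel]; rfl
        rw [hc, map_smul] at h
        conv_rhs => rw [← h]
        rw [smul_smul, Units.inv_mul, one_smul] }

/-- The group of scalars `𝔾ₘ` in `GL(V)`. -/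
def scalars (V : Type*) [AddCommGroup V] [Module k V] :
    Subgroup (LinearMap.GeneralLinearGroup k V) :=
  (Units.map (algebraMap k (Module.End k V)).toMonoidHom).range

/-- The number of isotypic components of a representation. -/
def numIsotypic {G V : Type*} [Group G] [AddCommGroup V] [Module k V]
    (ρ : Representation k G V) : ℕ :=
  (isotypicComponents (MonoidAlgebra k G) ρ.asModule).ncard

/-- The number of simple factors (simple ideals) of a semisimple Lie algebra. -/
def numSimpleFactors (L : Type*) [LieRing L] [LieAlgebra k L] : ℕ :=
  {I : LieIdeal k L | LieAlgebra.IsSimple k I}.ncard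

end Stabilizer

end

end AlgGrp

/-! Take `(g, g', g₀')` in `G⁰`. Commuting with `a'` makes `g'` respect `U ⊕ 𝔤₀`: it is a scalar `c`
on the line `U` and some `γ` on `𝔤₀`. Commuting with `a` then splits into two conditions. The part
in `𝔤₀ ⊗ 𝔤₀` forces `g₀'` to act on `𝔤₀` as a multiple `l γ`, and the coefficient of `e` says `c g₀'
dρ₀'(x) = dρ₀'(γ x) g₀'` (`exists_components_of_mem_stab`). Since `dρ₀'` is injective, `α = c⁻¹ γ`
is an automorphism of the Lie algebra `𝔤₀`.

Every subrepresentation of `U₀'` is the image of a projection in `End_{G₀}(U₀')`, and `g₀'` commutes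
with that projection. Hence `g₀'` restricts to an equivalence of each subrepresentation with its
twist by `α`, and asymmetry makes `α` inner (`isInnerAut_of_intertwines`), so `α = Ad h` with `h` in
`G₀`. What remains, `g₀' ρ₀'(h)⁻¹`, commutes with `𝔤₀`, hence with `G₀`, and with `End_{G₀}(U₀')`,
and is the scalar `l c` on `𝔤₀`: it lies in `T'`. This gives `G⁰ = (𝔾ₘ × 𝔾ₘ × T') G₀`
(`exists_eq_mul_embed`); faithfulness of `ρ₀'` then identifies the center (`T0_eq`).

For the rank, `U₀'` is semisimple, so by Schur's lemma the center of `End_{G₀}(U₀')ˣ` is one `𝔾ₘ`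
for each isotypic component. Distinct simple ideals of `𝔤₀` are inequivalent representations, so
each marks its own component, and acting on `𝔤₀` by a scalar identifies exactly these factors
(`isTorusOfRank_T'`).

The Lie theory is built from the definitions. Complete reducibility comes from Casimir operators.
Group and Lie algebra are linked by two devices: an ideal of functions that vanish at `1` and that
is stable under left-invariant derivations vanishes near `1` (`exists_annihilator`), and the formal
one-parameter subgroup `formalExp` lets equations on the group be tested on its Lie algebra. The
first lets stability pass from `𝔤₀` to a connected `G₀`; the second yields `hasTrivialRadical` and
the realization of exponentials by group elements (`exists_exp`). -/

namespace AlgGrp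

/-! ### Semisimple Lie algebras: Casimir operators and complete reducibility -/

section LieReps

open LieModule

variable {k L : Type*} [Field k] [LieRing L] [LieAlgebra k L]

/-- A linear condition that holds on brackets of a Lie algebra with trivial radical holds on all
of it. -/
theorem bracket_induction [CharZero k] [FiniteDimensional k L] [LieAlgebra.HasTrivialRadical k L]
    {p : Submodule k L}
    (h : ∀ x y : L, ⁅x, y⁆ ∈ p) (x : L) : x ∈ p := by
  let I : LieIdeal k L := ⁅(⊤ : LieIdeal k L), (⊤ : LieIdeal k L)⁆
  -- Brackets of elements of the Killing complement of `I = [L, L]` lie both in it and in `I`, which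
  -- meet trivially. So the complement is an abelian ideal, hence zero.
  have hI : I = ⊤ := by
    have hc := LieIdeal.isCompl_killingCompl I
    have : I.killingCompl k L = ⊥ := by
      have : IsLieAbelian (I.killingCompl k L) := by
        constructor
        rintro ⟨x, hx⟩ ⟨y, hy⟩
        have h1 : ⁅x, y⁆ ∈ I.killingCompl k L := lie_mem_right k L _ _ _ hy
        have h2 : ⁅x, y⁆ ∈ I := LieSubmodule.lie_mem_lie (LieSubmodule.mem_top x)
          (LieSubmodule.mem_top y)
        have h3 : ⁅x, y⁆ ∈ I ⊓ I.killingCompl k L := ⟨h2, h1⟩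
        rw [hc.inf_eq_bot, LieSubmodule.mem_bot] at h3
        exact Subtype.ext h3
      exact LieAlgebra.HasTrivialRadical.eq_bot_of_isSolvable _
    have h2 := hc.codisjoint
    rwa [this, codisjoint_bot] at h2
  have hx : x ∈ I := hI ▸ LieSubmodule.mem_top x
  have hle : I.toSubmodule ≤ p := by
    change (⁅(⊤ : LieIdeal k L), (⊤ : LieIdeal k L)⁆ : LieIdeal k L).toSubmodule ≤ p
    rw [LieSubmodule.lieIdeal_oper_eq_linear_span']
    rw [Submodule.span_le]
    rintro _ ⟨x, -, y, -, rfl⟩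
    exact h x y
  exact hle hx

variable {M : Type*} [AddCommGroup M] [Module k M] [LieRingModule L M] [LieModule k L M]

/-- The Casimir operator of a pair of dual bases of an ideal commutes with the action. -/
theorem casimir_commute {J : LieIdeal k L} {ι : Type*} [Fintype ι] [DecidableEq ι]
    {B : LinearMap.BilinForm k L} (hB : ∀ x y z : L, B ⁅x, y⁆ z = - B y ⁅x, z⁆)
    (b b' : Module.Basis ι k J) (hbb : ∀ i j, B (b i) (b' j) = if i = j then 1 else 0)
    (x : L) (m : M) :
    ⁅x, ∑ i, ⁅(b i : L), ⁅(b' i : L), m⁆⁆⁆ = ∑ i, ⁅(b i : L), ⁅(b' i : L), ⁅x, m⁆⁆⁆ := by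
  have e1 : ∀ y : J, (y : L) = ∑ j, B y (b' j) • (b j : L) := by
    intro y
    have hr : ∑ i, b.repr y i • (b i : L) = y := by
      have := congrArg J.toSubmodule.subtype (b.sum_repr y)
      rw [map_sum] at this
      exact this
    have : ∀ j, b.repr y j = B y (b' j) := by
      intro j
      rw [← hr]
      simp [hbb]
    simp_rw [← this]
    exact hr.symm
  have e2 : ∀ y : J, (y : L) = ∑ j, B (b j) y • (b' j : L) := by
    intro y
    have hr : ∑ i, b'.repr y i • (b' i : L) = y := by
      have := congrArg J.toSubmodule.subtype (b'.sum_repr y)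
      rw [map_sum] at this
      exact this
    have : ∀ j, b'.repr y j = B (b j) y := by
      intro j
      rw [← hr]
      simp [hbb]
    simp_rw [← this]
    exact hr.symm
  -- By invariance of `B`, the matrix of `x` in the basis `b'` is the negative transpose of its
  -- matrix in `b`. The two extra sums produced by the Leibniz rule therefore cancel.
  have f1 : ∀ i, ⁅x, (b i : L)⁆ = ∑ j, B ⁅x, (b i : L)⁆ (b' j) • (b j : L) := fun i =>
    e1 ⟨⁅x, (b i : L)⁆, lie_mem_right k L _ _ _ (b i).2⟩
  have f2 : ∀ i, ⁅x, (b' i : L)⁆ = - ∑ j, B ⁅x, (b j : L)⁆ (b' i) • (b' j : L) := fun i => by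
    have := e2 ⟨⁅x, (b' i : L)⁆, lie_mem_right k L _ _ _ (b' i).2⟩
    simp only at this
    rw [this, ← Finset.sum_neg_distrib]
    refine Finset.sum_congr rfl fun j _ => ?_
    rw [hB, neg_smul, neg_neg]
  rw [lie_sum]
  have : ∀ i, ⁅x, ⁅(b i : L), ⁅(b' i : L), m⁆⁆⁆ = ⁅⁅x, (b i : L)⁆, ⁅(b' i : L), m⁆⁆ +
      ⁅(b i : L), ⁅⁅x, (b' i : L)⁆, m⁆⁆ + ⁅(b i : L), ⁅(b' i : L), ⁅x, m⁆⁆⁆ := by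
    intro i
    rw [leibniz_lie x (b i : L), leibniz_lie x (b' i : L), lie_add, add_assoc]
  simp_rw [this]
  rw [Finset.sum_add_distrib, Finset.sum_add_distrib, add_eq_right]
  have g1 : ∀ i, ⁅⁅x, (b i : L)⁆, ⁅(b' i : L), m⁆⁆ =
      ∑ j, B ⁅x, (b i : L)⁆ (b' j) • ⁅(b j : L), ⁅(b' i : L), m⁆⁆ := fun i => by
    conv_lhs => rw [f1 i, sum_lie]
    simp only [smul_lie]
  have g2 : ∀ i, ⁅(b i : L), ⁅⁅x, (b' i : L)⁆, m⁆⁆ =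
      - ∑ j, B ⁅x, (b j : L)⁆ (b' i) • ⁅(b i : L), ⁅(b' j : L), m⁆⁆ := fun i => by
    conv_lhs => rw [f2 i, neg_lie, lie_neg, sum_lie, lie_sum]
    simp only [smul_lie, lie_smul]
  rw [Finset.sum_congr rfl fun i _ => g1 i, Finset.sum_congr rfl fun i _ => g2 i, Finset.sum_comm,
    Finset.sum_neg_distrib, add_neg_cancel]

variable [CharZero k] [FiniteDimensional k L]

/-- If `N` is an irreducible submodule on which `L` acts non-trivially, there is an endomorphism
of `M` that commutes with `L`, maps `m` to `N` as soon as `L m ⊆ N`, and is injective on `N`. -/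
theorem exists_casimir [LieAlgebra.HasTrivialRadical k L] [FiniteDimensional k M]
    (N : LieSubmodule k L M) (hN : IsAtom N) (hne : ∃ x : L, ∃ n ∈ N, ⁅x, n⁆ ≠ 0) :
    ∃ c : Module.End k M, (∀ (x : L) (m : M), ⁅x, c m⁆ = c ⁅x, m⁆) ∧
      (∀ m, (∀ x : L, ⁅x, m⁆ ∈ N) → c m ∈ N) ∧ ∀ n ∈ N, c n = 0 → n = 0 := by
  classical
  -- a simple ideal acting non-trivially
  obtain ⟨J, hJ, x₀, hx₀, n₀, hn₀, hxn⟩ :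
      ∃ J : LieIdeal k L, IsAtom J ∧ ∃ x ∈ J, ∃ n ∈ N, ⁅x, n⁆ ≠ 0 := by
    by_contra! hcon
    obtain ⟨x, n, hn, hxn⟩ := hne
    let A : LieIdeal k L := LieModule.ker k L N
    have : (⊤ : LieIdeal k L) ≤ A := by
      rw [← LieAlgebra.IsSemisimple.sSup_atoms_eq_top (R := k) (L := L)]
      refine sSup_le fun J hJ x hx => ?_
      rw [LieModule.mem_ker]
      rintro ⟨n, hn⟩
      exact Subtype.ext (hcon J hJ x hx n hn)
    have hx : x ∈ A := this (LieSubmodule.mem_top x)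
    rw [LieModule.mem_ker] at hx
    exact hxn (congrArg Subtype.val (hx ⟨n, hn⟩))
  have hsimple : LieAlgebra.IsSimple k J := LieAlgebra.IsSemisimple.isSimple_of_isAtom J hJ
  let B : LinearMap.BilinForm k L := traceForm k L N
  let BJ : LinearMap.BilinForm k J := B.restrict J.toSubmodule
  -- the kernel of the trace form
  have hdegen : ¬ ∀ x ∈ J, ∀ y ∈ J, B x y = 0 := by
    -- Otherwise Cartan's criterion makes the derived algebra of `J`, which is `J` itself, act
    -- nilpotently on `N`, so `J` kills a nonzero vector of `N`.
    intro h0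
    have htf : traceForm k J N = 0 := by
      ext ⟨x, hx⟩ ⟨y, hy⟩
      exact h0 x hx y hy
    have hnil := LieModule.isNilpotent_derivedSeries_of_traceForm_eq_zero htf
    have hder : LieAlgebra.derivedSeries k J 1 = ⊤ := by
      rcases hsimple.eq_bot_or_eq_top (LieAlgebra.derivedSeries k J 1) with h | h
      · exact absurd ((lie_abelian_iff_equiv_lie_abelian (LieIdeal.topEquiv (R := k) (L := J))).1
          ((LieAlgebra.abelian_iff_derived_one_eq_bot (⊤ : LieIdeal k J)).2 h))
          hsimple.non_abelian
      · exact h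
    have hnil' : LieModule.IsNilpotent J N := by
      rw [LieModule.isNilpotent_iff_forall' (R := k)] at hnil ⊢
      intro x
      exact hnil ⟨x, by rw [hder]; trivial⟩
    have hnt : Nontrivial N := (LieSubmodule.nontrivial_iff_ne_bot k L M).2 hN.1
    have hmax := LieModule.nontrivial_max_triv_of_isNilpotent k J N
    obtain ⟨⟨⟨v, hvN⟩, hv⟩, hv0⟩ := exists_ne (0 : maxTrivSubmodule k J N)
    rw [mem_maxTrivSubmodule] at hv
    -- As `J` is an ideal, its invariants in `N` are stable under all of `L`; by irreducibility they
    -- fill `N`, although `J` acts non-trivially.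
    let K : LieSubmodule k L M :=
      { carrier := {m | m ∈ N ∧ ∀ x ∈ J, ⁅x, m⁆ = 0}
        add_mem' := fun {a b} ha hb => ⟨N.add_mem ha.1 hb.1, fun x hx => by
          rw [lie_add, ha.2 x hx, hb.2 x hx, add_zero]⟩
        zero_mem' := ⟨N.zero_mem, fun x _ => lie_zero x⟩
        smul_mem' := fun c m hm => ⟨N.smul_mem c hm.1, fun x hx => by
          rw [lie_smul, hm.2 x hx, smul_zero]⟩
        lie_mem := fun {y m} hm => ⟨N.lie_mem hm.1, fun x hx => by
          rw [leibniz_lie, hm.2 x hx, lie_zero, add_zero]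
          exact hm.2 _ (lie_mem_left k L J x y hx)⟩ }
    have hKN : K ≤ N := fun m hm => hm.1
    have hvK : v ∈ K := ⟨hvN, fun x hx => congrArg Subtype.val (hv ⟨x, hx⟩)⟩
    rcases hN.le_iff.1 hKN with h | h
    · rw [h, LieSubmodule.mem_bot] at hvK
      exact hv0 (Subtype.ext (Subtype.ext hvK))
    · exact hxn ((h ▸ hn₀ : n₀ ∈ K).2 x₀ hx₀)
  have hinv : ∀ x y z, B ⁅x, y⁆ z = - B y ⁅x, z⁆ := traceForm_apply_lie_apply' k L N
  have hnd : BJ.Nondegenerate := by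
    -- The radical of the form on `J` is an ideal of `L` inside the minimal ideal `J`; it is not
    -- `J`, since the form is nonzero there.
    let K : LieIdeal k L :=
      { carrier := {x | x ∈ J ∧ ∀ y ∈ J, B x y = 0}
        add_mem' := fun {a b} ha hb => ⟨J.add_mem ha.1 hb.1, fun x hx => by
          rw [map_add, LinearMap.add_apply, ha.2 x hx, hb.2 x hx, add_zero]⟩
        zero_mem' := ⟨J.zero_mem, fun x _ => by simp⟩
        smul_mem' := fun c m hm => ⟨J.smul_mem c hm.1, fun x hx => by
          rw [map_smul, LinearMap.smul_apply, hm.2 x hx, smul_zero]⟩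
        lie_mem := fun {y m} hm => ⟨J.lie_mem hm.1, fun x hx => by
          rw [hinv, hm.2 _ (J.lie_mem hx), neg_zero]⟩ }
    have hKJ : K ≤ J := fun m hm => hm.1
    have hK : K = ⊥ := by
      rcases hJ.le_iff.1 hKJ with h | h
      · exact h
      · exact absurd (fun x hx y hy => (h ▸ hx : x ∈ K).2 y hy) hdegen
    have hsymm : BJ.IsSymm := ⟨fun x y => traceForm_comm k L N x y⟩
    refine hsymm.isRefl.nondegenerate_iff_separatingLeft.2 ?_
    rintro ⟨x, hx⟩ h
    have : x ∈ K := ⟨hx, fun y hy => h ⟨y, hy⟩⟩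
    rw [hK, LieSubmodule.mem_bot] at this
    exact Subtype.ext this
  let b' := Module.finBasis k J
  let b := BJ.dualBasis hnd b'
  have hbb : ∀ i j, B (b i) (b' j) = if i = j then 1 else 0 := by
    intro i j
    have := BJ.apply_dualBasis_left hnd b' i j
    simp only [eq_comm (a := j)] at this
    exact this
  let c : Module.End k M := ∑ i, toEnd k L M (b i) * toEnd k L M (b' i)
  have hc : ∀ m, c m = ∑ i, ⁅(b i : L), ⁅(b' i : L), m⁆⁆ := by
    intro m; simp [c, LinearMap.sum_apply]
  have hcN : ∀ m ∈ N, c m ∈ N := fun m hm => by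
    rw [hc]; exact Submodule.sum_mem _ fun i _ => N.lie_mem (N.lie_mem hm)
  have hcomm : ∀ (x : L) (m : M), ⁅x, c m⁆ = c ⁅x, m⁆ := fun x m => by
    rw [hc, hc]; exact casimir_commute hinv b b' hbb x m
  refine ⟨c, hcomm, fun m hm => ?_, ?_⟩
  · rw [hc]; exact Submodule.sum_mem _ fun i _ => N.lie_mem (hm _)
  · let K : LieSubmodule k L M :=
      { carrier := {m | m ∈ N ∧ c m = 0}
        add_mem' := fun {a b} ha hb => ⟨N.add_mem ha.1 hb.1, by rw [map_add, ha.2, hb.2, add_zero]⟩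
        zero_mem' := ⟨N.zero_mem, map_zero c⟩
        smul_mem' := fun r m hm => ⟨N.smul_mem r hm.1, by rw [map_smul, hm.2, smul_zero]⟩
        lie_mem := fun {y m} hm => ⟨N.lie_mem hm.1, by rw [← hcomm, hm.2, lie_zero]⟩ }
    have hKN : K ≤ N := fun m hm => hm.1
    rcases hN.le_iff.1 hKN with h | h
    · intro n hn hcn
      have hnK : n ∈ K := ⟨hn, hcn⟩
      rwa [h, LieSubmodule.mem_bot] at hnK
    · exfalso
      -- If the Casimir operator vanished on `N`, its trace there would be zero. But each dual pair
      -- contributes `B (b i) (b' i) = 1`, so the trace is `dim J`, which is nonzero in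
      -- characteristic zero.
      have h0 : ∑ i, toEnd k L N (b i) * toEnd k L N (b' i) = 0 := by
        ext ⟨n, hn⟩
        have h1 := (h ▸ hn : n ∈ K).2
        rw [hc] at h1
        simpa [LinearMap.sum_apply] using h1
      have h2 := congrArg (LinearMap.trace k N) h0
      rw [map_sum, map_zero] at h2
      have h3 : ∀ i, LinearMap.trace k N (toEnd k L N (b i) * toEnd k L N (b' i)) = 1 := by
        intro i
        have := hbb i i
        rwa [if_pos rfl] at this
      simp only [h3, Finset.sum_const, Finset.card_univ, Fintype.card_fin, nsmul_eq_mul, mul_one,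
        Nat.cast_eq_zero] at h2
      have hnt : Nontrivial J := (LieSubmodule.nontrivial_iff_ne_bot k L L).2 hJ.1
      exact (Module.finrank_pos (R := k) (M := J)).ne' h2

/-- Vanishing of the first cohomology: an element that is invariant modulo a submodule can be made
invariant by an element of the submodule. -/
theorem exists_sub_invariant [LieAlgebra.HasTrivialRadical k L] [FiniteDimensional k M]
    (N : LieSubmodule k L M) (m : M) (hm : ∀ x : L, ⁅x, m⁆ ∈ N) :
    ∃ n ∈ N, ∀ x : L, ⁅x, m - n⁆ = 0 := by
  induction hd : Module.finrank k N using Nat.strong_induction_on generalizing M with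
  | _ d ih =>
    subst hd
    by_cases hbot : N = ⊥
    · subst hbot
      exact ⟨0, LieSubmodule.zero_mem _, fun x => by
        rw [sub_zero]; exact (LieSubmodule.mem_bot _).1 (hm x)⟩
    by_cases hatom : IsAtom N
    · by_cases hne : ∃ x : L, ∃ n ∈ N, ⁅x, n⁆ ≠ 0
      · obtain ⟨c, hc, hcN, hinj⟩ := exists_casimir N hatom hne
        have hcN' : ∀ n ∈ N.toSubmodule, c n ∈ N.toSubmodule :=
          fun n hn => hcN n fun x => N.lie_mem hn
        have hsurj : Function.Surjective (c.restrict hcN') := by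
          rw [← LinearMap.injective_iff_surjective, injective_iff_map_eq_zero]
          rintro ⟨n, hn⟩ h
          exact Subtype.ext (hinj n hn (congrArg Subtype.val h))
        -- With `c n = c m`, the vector `⁅x, m - n⁆` lies in `N` and is killed by `c`, hence is
        -- zero.
        obtain ⟨⟨n, hn⟩, hnm⟩ := hsurj ⟨c m, hcN m hm⟩
        have hnm' : c n = c m := congrArg Subtype.val hnm
        refine ⟨n, hn, fun x => hinj _ ?_ ?_⟩
        · rw [lie_sub]; exact N.sub_mem (hm x) (N.lie_mem hn)
        · rw [← hc, map_sub, hnm', sub_self, lie_zero]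
      · push Not at hne
        refine ⟨0, N.zero_mem, fun x => ?_⟩
        rw [sub_zero]
        -- When `L` acts trivially on `N`, brackets kill `m`, and `L` is spanned by brackets.
        let p : Submodule k L := LinearMap.ker ((toEnd k L M : L →ₗ[k] Module.End k M).flip m)
        have : x ∈ p := bracket_induction (fun x y => by
          change ⁅⁅x, y⁆, m⁆ = 0
          rw [lie_lie, hne _ _ (hm y), hne _ _ (hm x), sub_zero]) x
        exact this
    -- When `N` has a proper nonzero submodule `N'`, the correction is made first modulo `N'`, then
    -- inside `N'`.
    · obtain ⟨N', hN'⟩ : ∃ N' < N, N' ≠ ⊥ := by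
        by_contra! h
        exact hatom ⟨hbot, h⟩
      obtain ⟨hlt, hne⟩ := hN'
      have hlt' : N'.toSubmodule < N.toSubmodule := hlt
      let q := LieSubmodule.Quotient.mk' N'
      let Nq : LieSubmodule k L (M ⧸ N') := N.map q
      have hdim : Module.finrank k Nq < Module.finrank k N := by
        let f : N.toSubmodule →ₗ[k] (M ⧸ N') := (q : M →ₗ[k] M ⧸ N') ∘ₗ N.toSubmodule.subtype
        have hr : LinearMap.range f = Nq.toSubmodule := by
          ext y; constructor
          · rintro ⟨⟨z, hz⟩, rfl⟩; exact ⟨z, hz, rfl⟩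
          · rintro ⟨z, hz, rfl⟩; exact ⟨⟨z, hz⟩, rfl⟩
        have hk : 0 < Module.finrank k (LinearMap.ker f) := by
          obtain ⟨⟨z, hz⟩, hz0'⟩ := @exists_ne N' ((LieSubmodule.nontrivial_iff_ne_bot k L M).2 hne) 0
          have hz0 : z ≠ 0 := fun h => hz0' (Subtype.ext h)
          have : Nontrivial (LinearMap.ker f) :=
            ⟨⟨⟨⟨z, hlt.le hz⟩, (LieSubmodule.Quotient.mk_eq_zero _).2 hz⟩, 0,
              fun h => hz0 (congrArg (fun t => ((t : LinearMap.ker f) : N.toSubmodule).1) h)⟩⟩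
          exact Module.finrank_pos
        have := LinearMap.finrank_range_add_finrank_ker f
        rw [hr] at this
        change Module.finrank k Nq.toSubmodule < Module.finrank k N.toSubmodule
        omega
      obtain ⟨_, ⟨n, hn, rfl⟩, hn'⟩ := ih _ hdim Nq (q m)
        (fun x => by rw [← LieModuleHom.map_lie]; exact ⟨_, hm x, rfl⟩) rfl
      have h1 : ∀ x : L, ⁅x, m - n⁆ ∈ N' := by
        intro x
        have := hn' x
        change ⁅x, q m - q n⁆ = 0 at this
        rw [← map_sub, ← LieModuleHom.map_lie] at this
        exact (LieSubmodule.Quotient.mk_eq_zero _).1 this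
      obtain ⟨n', hn', h2⟩ := ih _ (Submodule.finrank_lt_finrank_of_lt hlt') N' (m - n) h1 rfl
      exact ⟨n + n', N.add_mem hn (hlt.le hn'), fun x => by rw [← sub_sub]; exact h2 x⟩

/-- Complete reducibility: every submodule is the image of an equivariant projection. -/
theorem exists_equivariant_projection [LieAlgebra.HasTrivialRadical k L] [FiniteDimensional k M]
    (W : LieSubmodule k L M) :
    ∃ p : Module.End k M, (∀ (x : L) (m : M), p ⁅x, m⁆ = ⁅x, p m⁆) ∧
      (∀ m, p m ∈ W) ∧ ∀ w ∈ W, p w = w := by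
  obtain ⟨p₀, hp₀⟩ := Submodule.exists_isCompl W.toSubmodule
  let P : Module.End k M := W.toSubmodule.subtype ∘ₗ W.toSubmodule.projectionOnto p₀ hp₀
  have hP1 : ∀ m, P m ∈ W := fun m => (W.toSubmodule.projectionOnto p₀ hp₀ m).2
  have hP2 : ∀ w ∈ W, P w = w := fun w hw =>
    congrArg Subtype.val (Submodule.projectionOnto_apply_left hp₀ ⟨w, hw⟩)
  -- Two linear projections onto `W` differ by an element of `N`. A linear projection `P` is thus
  -- invariant modulo `N`, because `⁅x, P⁆` maps into `W` and kills `W`, and it can be corrected to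
  -- an invariant one.
  let N : LieSubmodule k L (M →ₗ[k] M) :=
    { carrier := {f | (∀ m, f m ∈ W) ∧ ∀ w ∈ W, f w = 0}
      add_mem' := fun {f g} hf hg => ⟨fun m => W.add_mem (hf.1 m) (hg.1 m), fun w hw => by
        rw [LinearMap.add_apply, hf.2 w hw, hg.2 w hw, add_zero]⟩
      zero_mem' := ⟨fun m => W.zero_mem, fun w _ => rfl⟩
      smul_mem' := fun r f hf => ⟨fun m => W.smul_mem r (hf.1 m), fun w hw => by
        rw [LinearMap.smul_apply, hf.2 w hw, smul_zero]⟩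
      lie_mem := fun {x f} hf => ⟨fun m => by
          rw [LieHom.lie_apply]; exact W.sub_mem (W.lie_mem (hf.1 m)) (hf.1 _),
        fun w hw => by
          rw [LieHom.lie_apply, hf.2 w hw, hf.2 _ (W.lie_mem hw), lie_zero, sub_zero]⟩ }
  obtain ⟨n, hn, h⟩ := exists_sub_invariant (L := L) (M := M →ₗ[k] M) N P fun x => by
    refine ⟨fun m => ?_, fun w hw => ?_⟩
    · rw [LieHom.lie_apply]; exact W.sub_mem (W.lie_mem (hP1 m)) (hP1 _)
    · rw [LieHom.lie_apply, hP2 w hw, hP2 _ (W.lie_mem hw), sub_self]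
  refine ⟨P - n, fun x m => ?_, fun m => W.sub_mem (hP1 m) (hn.1 m), fun w hw => ?_⟩
  · have h1 := LinearMap.congr_fun (h x) m
    rw [LieHom.lie_apply, LinearMap.zero_apply, sub_eq_zero] at h1
    exact h1.symm
  · rw [LinearMap.sub_apply, hP2 w hw, hn.2 w hw, sub_zero]

/-- An `ad`-nilpotent element of a semisimple Lie algebra acts nilpotently on every module. -/
theorem isNilpotent_toEnd_of_isNilpotent_ad [IsAlgClosed k] [LieAlgebra.HasTrivialRadical k L]
    [FiniteDimensional k M] {x : L} (hx : IsNilpotent (LieAlgebra.ad k L x)) :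
    IsNilpotent (toEnd k L M x) := by
  have key : ∀ μ : k, μ ≠ 0 → (toEnd k L M x).maxGenEigenspace μ = ⊥ := by
    intro μ hμ
    -- Since `ad x` is nilpotent, all of `L` is its generalized eigenspace for `0`, so `L` preserves
    -- the generalized eigenspaces of `x` on `M`.
    let W : LieSubmodule k L M :=
      { (toEnd k L M x).maxGenEigenspace μ with
        lie_mem := fun {y m} hm => by
          have hy : y ∈ (toEnd k L L x).maxGenEigenspace 0 := by
            rw [Module.End.mem_maxGenEigenspace]
            obtain ⟨n, hn⟩ := hx
            exact ⟨n, by rw [zero_smul, sub_zero]; exact LinearMap.congr_fun hn y⟩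
          have := lie_mem_maxGenEigenspace_toEnd hy hm
          rwa [zero_add] at this }
    -- Every element of `L` has trace zero on `W` because `L` is spanned by brackets. The trace of
    -- `x` is also `μ dim W`, which forces `W = 0` for `μ ≠ 0`.
    have htr : LinearMap.trace k W (toEnd k L W x) = 0 := by
      let p : Submodule k L :=
        LinearMap.ker (LinearMap.trace k W ∘ₗ (toEnd k L W : L →ₗ[k] Module.End k W))
      exact bracket_induction (p := p) (fun x y => by
        change LinearMap.trace k W (toEnd k L W ⁅x, y⁆) = 0
        simp) x
    have hnil : IsNilpotent (toEnd k L W x - algebraMap k (Module.End k W) μ) :=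
      Module.End.isNilpotent_restrict_maxGenEigenspace_sub_algebraMap (toEnd k L M x) μ
    have h0 := (LinearMap.isNilpotent_trace_of_isNilpotent hnil).eq_zero
    rw [map_sub, htr, zero_sub, neg_eq_zero, Algebra.algebraMap_eq_smul_one, map_smul,
      LinearMap.trace_one, smul_eq_mul, mul_eq_zero, Nat.cast_eq_zero] at h0
    have := h0.resolve_left hμ
    exact Submodule.finrank_eq_zero.1 this
  have htop : (toEnd k L M x).maxGenEigenspace 0 = ⊤ := by
    rw [eq_top_iff, ← Module.End.iSup_maxGenEigenspace_eq_top (toEnd k L M x)]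
    refine iSup_le fun μ => ?_
    by_cases hμ : μ = 0
    · rw [hμ]
    · rw [key μ hμ]; exact bot_le
  rw [Module.End.maxGenEigenspace_eq_genEigenspace_finrank] at htop
  refine ⟨Module.finrank k M, LinearMap.ext fun m => ?_⟩
  have : m ∈ (toEnd k L M x).genEigenspace 0 (Module.finrank k M) := htop ▸ Submodule.mem_top
  rw [Module.End.mem_genEigenspace_nat, zero_smul, sub_zero] at this
  exact this

attribute [local instance 100] LieRing.ofAssociativeRing

variable {V : Type*} [AddCommGroup V] [Module k V] [FiniteDimensional k V]
  [LieAlgebra.HasTrivialRadical k L]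

theorem isNilpotent_of_isNilpotent_ad [IsAlgClosed k] (ρ : L →ₗ⁅k⁆ Module.End k V) {x : L}
    (hx : IsNilpotent (LieAlgebra.ad k L x)) : IsNilpotent (ρ x) := by
  let _ : LieRingModule L V := LieRingModule.compLieHom V ρ
  have : LieModule k L V := LieModule.compLieHom V ρ
  have h := isNilpotent_toEnd_of_isNilpotent_ad (M := V) hx
  have h1 : LieModule.toEnd k L V x = ρ x := LinearMap.ext fun v => rfl
  rwa [h1] at h

theorem exists_projection (ρ : L →ₗ⁅k⁆ Module.End k V) (W : Submodule k V)
    (hW : ∀ x, ∀ w ∈ W, ρ x w ∈ W) :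
    ∃ p : Module.End k V, (∀ x v, p (ρ x v) = ρ x (p v)) ∧ (∀ v, p v ∈ W) ∧ ∀ w ∈ W, p w = w := by
  let _ : LieRingModule L V := LieRingModule.compLieHom V ρ
  have : LieModule k L V := LieModule.compLieHom V ρ
  exact exists_equivariant_projection (L := L) { W with lie_mem := fun {x w} hw => hW x w hw }

end LieReps

noncomputable section

attribute [local instance 100] LieRing.ofAssociativeRing

/-! ### The Zariski topology -/

section Zariski

variable {k : Type*} [Field k] {X Y : Type*}

theorem isClosed_zeroLocus (A : Subalgebra k (X → k)) (S : Set (X → k)) (hS : ∀ f ∈ S, f ∈ A) :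
    IsZariskiClosed A {x | ∀ f ∈ S, f x = 0} := by
  let _ := zariski A
  have : {x | ∀ f ∈ S, f x = 0} = ⋂ f ∈ S, {x | f x ≠ 0}ᶜ := by
    ext x; simp
  change IsClosed _
  rw [this]
  refine isClosed_biInter fun f hf => IsOpen.isClosed_compl ?_
  exact TopologicalSpace.isOpen_generateFrom_of_mem ⟨f, hS f hf, rfl⟩

theorem isOpen_nonvanishing (A : Subalgebra k (X → k)) {f : X → k} (hf : f ∈ A) :
    @IsOpen X (zariski A) {x | f x ≠ 0} :=
  TopologicalSpace.isOpen_generateFrom_of_mem ⟨f, hf, rfl⟩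

theorem IsRegularMap.continuous {A : Subalgebra k (X → k)} {B : Subalgebra k (Y → k)} {φ : X → Y}
    (h : IsRegularMap A B φ) : @Continuous X Y (zariski A) (zariski B) φ := by
  let _ := zariski A
  rw [continuous_generateFrom_iff]
  rintro _ ⟨f, hf, rfl⟩
  exact isOpen_nonvanishing A (h f hf)

theorem isTopologicalBasis_zariski (A : Subalgebra k (X → k)) :
    @TopologicalSpace.IsTopologicalBasis X (zariski A) {U | ∃ f ∈ A, U = {x | f x ≠ 0}} := by
  let _ := zariski A
  refine ⟨?_, ?_, rfl⟩
  · rintro _ ⟨f, hf, rfl⟩ _ ⟨g, hg, rfl⟩ x ⟨hx, hx'⟩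
    refine ⟨{x | (f * g) x ≠ 0}, ⟨f * g, A.mul_mem hf hg, rfl⟩, mul_ne_zero hx hx', fun y hy => ?_⟩
    exact ⟨left_ne_zero_of_mul hy, right_ne_zero_of_mul hy⟩
  · rw [Set.sUnion_eq_univ_iff]
    exact fun x => ⟨_, ⟨1, A.one_mem, rfl⟩, one_ne_zero⟩

end Zariski

/-! ### Formal one-parameter subgroups and the derivative of the adjoint representation -/

section Derivations

theorem derivation_iterate_mul {R A : Type*} [CommRing R] [CommRing A] [Algebra R A]
    (D : Derivation R A A) (n : ℕ) (a b : A) :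
    D^[n] (a * b) = ∑ ij ∈ Finset.HasAntidiagonal.antidiagonal n,
      n.choose ij.1 • (D^[ij.1] a * D^[ij.2] b) := by
  induction n with
  | zero => simp
  | succ n ih =>
    rw [Finset.sum_antidiagonal_choose_succ_nsmul (M := A) (fun i j => D^[i] a * D^[j] b) n]
    simp only [Function.iterate_succ_apply', ih, map_sum, map_nsmul, Derivation.leibniz, smul_add,
      Finset.sum_add_distrib, smul_eq_mul]
    congr 1
    refine Finset.sum_congr rfl fun ⟨i, j⟩ hij => ?_
    rw [n.choose_symm_of_eq_add (Finset.HasAntidiagonal.mem_antidiagonal.1 hij).symm, mul_comm]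

end Derivations

section Exponential

variable {k : Type*} [Field k] {G : Type*} [Group G] [AffineAlgGroup k G]

instance : Algebra.FiniteType k (coordRing k G) :=
  (Subalgebra.fg_iff_finiteType _).1 AffineAlgGroup.fg

instance : IsNoetherianRing (coordRing k G) :=
  Algebra.FiniteType.isNoetherianRing k _

/-- The formal one-parameter subgroup `f ↦ ∑ tⁿ / n! (Dⁿ f)(1)` of an element of the Lie
algebra. -/
def formalExp [CharZero k] (D : LieAlg k G) : coordRing k G →ₐ[k] PowerSeries k where
  toFun f := PowerSeries.mk fun n =>
    (n.factorial : k)⁻¹ * (((toDer k G D)^[n] f : coordRing k G) : G → k) 1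
  map_one' := by
    ext n
    rw [PowerSeries.coeff_mk, PowerSeries.coeff_one]
    rcases n with _ | n
    · simp
    · simp [Function.iterate_succ_apply]
  map_mul' f g := by
    ext n
    rw [PowerSeries.coeff_mk, PowerSeries.coeff_mul, derivation_iterate_mul]
    simp only [AddSubmonoidClass.coe_finsetSum, Finset.sum_apply, Finset.mul_sum,
      PowerSeries.coeff_mk]
    refine Finset.sum_congr rfl fun ⟨i, j⟩ hij => ?_
    have hn : i + j = n := Finset.HasAntidiagonal.mem_antidiagonal.1 hij
    have h := Nat.add_choose_mul_factorial_mul_factorial i j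
    rw [hn, ← n.choose_symm_of_eq_add hn.symm] at h
    have h' : (n.choose i : k) * i.factorial * j.factorial = n.factorial := by exact_mod_cast h
    have hi : (i.factorial : k) ≠ 0 := Nat.cast_ne_zero.2 i.factorial_ne_zero
    have hj : (j.factorial : k) ≠ 0 := Nat.cast_ne_zero.2 j.factorial_ne_zero
    have hn0 : (n.factorial : k) ≠ 0 := Nat.cast_ne_zero.2 n.factorial_ne_zero
    rw [AddSubmonoidClass.coe_nsmul, Pi.smul_apply, MulMemClass.coe_mul, Pi.mul_apply, nsmul_eq_mul]
    field_simp
    rw [← h']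
    ring
  map_zero' := by
    ext n
    simp [iterate_map_zero]
  map_add' f g := by
    ext n
    simp [iterate_map_add, mul_add]
  commutes' c := by
    ext n
    rw [PowerSeries.coeff_mk, PowerSeries.algebraMap_apply, PowerSeries.coeff_C]
    rcases n with _ | n
    · simp
    · simp [Function.iterate_succ_apply, iterate_map_zero]

theorem coeff_formalExp [CharZero k] (D : LieAlg k G) (f : coordRing k G) (n : ℕ) :
    PowerSeries.coeff n (formalExp D f) =
      (n.factorial : k)⁻¹ * (((toDer k G D)^[n] f : coordRing k G) : G → k) 1 := by
  exact PowerSeries.coeff_mk (R := k) n fun n =>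
    (n.factorial : k)⁻¹ * (((toDer k G D)^[n] f : coordRing k G) : G → k) 1

theorem constantCoeff_formalExp [CharZero k] (D : LieAlg k G) (f : coordRing k G) :
    PowerSeries.constantCoeff (R := k) (formalExp D f) = (f : G → k) 1 := by
  have h := coeff_formalExp D f 0
  rw [PowerSeries.coeff_zero_eq_constantCoeff_apply] at h
  simpa using h

/-- If the formal one-parameter subgroup satisfies the equations `S`, it satisfies every equation
that holds on their zero locus. -/
theorem formalExp_eq_zero [CharZero k] [IsAlgClosed k] (D : LieAlg k G)
    {S : Set (coordRing k G)} (hS : ∀ s ∈ S, formalExp D s = 0) {f : coordRing k G}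
    (hf : ∀ g : G, (∀ s ∈ S, (s : G → k) g = 0) → (f : G → k) g = 0) : formalExp D f = 0 := by
  by_contra hne
  -- The kernel is prime because power series form a domain. The coordinate ring is a Jacobson ring,
  -- so some maximal ideal contains `P` but not `f`. Its residue field is `k`, and it yields a point
  -- where `S` vanishes and `f` does not.
  let P : Ideal (coordRing k G) := RingHom.ker (formalExp D)
  have hP : P.IsPrime := RingHom.ker_isPrime _
  have hJ : IsJacobsonRing (coordRing k G) := isJacobsonRing_of_finiteType (A := k)
  have hjac : P.jacobson = P := hJ.out hP.isRadical
  have hfP : f ∉ P.jacobson := by rw [hjac]; exact hne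
  rw [Ideal.jacobson, Submodule.mem_sInf] at hfP
  push Not at hfP
  obtain ⟨m, ⟨hPm, hm⟩, hfm⟩ := hfP
  let _ := Ideal.Quotient.field m
  have : Module.Finite k (coordRing k G ⧸ m) := finite_of_finite_type_of_isJacobsonRing k _
  have : Algebra.IsIntegral k (coordRing k G ⧸ m) := Algebra.IsIntegral.of_finite k _
  have hbij : Function.Bijective (algebraMap k (coordRing k G ⧸ m)) :=
    IsAlgClosed.algebraMap_bijective_of_isIntegral
  let e : k ≃ₐ[k] (coordRing k G ⧸ m) := AlgEquiv.ofBijective (Algebra.ofId k _) hbij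
  let χ : coordRing k G →ₐ[k] k := (e.symm : (coordRing k G ⧸ m) →ₐ[k] k).comp
    (Ideal.Quotient.mkₐ k m)
  obtain ⟨g, hg⟩ := AffineAlgGroup.exists_point χ
  have hχ : ∀ s, χ s = 0 ↔ s ∈ m := by
    intro s
    change e.symm (Ideal.Quotient.mk m s) = 0 ↔ _
    rw [EmbeddingLike.map_eq_zero_iff, Ideal.Quotient.eq_zero_iff_mem]
  refine hfm ((hχ f).1 ?_)
  rw [hg]
  refine hf g fun s hs => ?_
  rw [← hg, hχ]
  exact hPm (hS s hs)

/-- The formal one-parameter subgroup acts on a representation through the powers of the derived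
endomorphism. -/
theorem iterate_toDer_coeff {V : Type*} [AddCommGroup V] [Module k V] [FiniteDimensional k V]
    {ρ : Representation k G V} (hρ : IsRegularRep k ρ) (D : LieAlg k G) (l : Module.Dual k V)
    (v : V) (n : ℕ) :
    (toDer k G D)^[n] (coeff k hρ l v) = coeff k hρ l ((derived k hρ D ^ n) v) := by
  induction n with
  | zero => rfl
  | succ n ih =>
    rw [Function.iterate_succ_apply', ih, apply_coeff, pow_succ']
    rfl

theorem coeff_apply {V : Type*} [AddCommGroup V] [Module k V]
    {ρ : Representation k G V} (hρ : IsRegularRep k ρ) (l : Module.Dual k V) (v : V) (g : G) :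
    (coeff k hρ l v : G → k) g = l (ρ g v) := rfl

/-- The derived representation of the adjoint representation of the group is the adjoint
representation of the Lie algebra. -/
theorem derived_Ad (D E : LieAlg k G) : derived k (isRegularRep_Ad k) D E = ⁅D, E⁆ := by
  apply lieAlg_ext k
  intro f
  let l : Module.Dual k (LieAlg k G) :=
    { toFun := fun E => tangent k E f
      map_add' := fun D E => tangent_add k D E f
      map_smul' := fun c D => tangent_smul k c D f }
  have h1 : tangent k (derived k (isRegularRep_Ad k) D E) f =
      tangent k D (coeff k (isRegularRep_Ad k) l E) := dual_derivedFun k _ D E l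
  obtain ⟨n, a, b, hab⟩ := mul_sum f.2
  have hright : ∀ g : G, rightTrans k g f = ∑ i, (b i : G → k) g • a i := by
    intro g
    ext x
    rw [rightTrans_apply, hab]
    simp [mul_comm]
  have hleft : ∀ g : G, leftTrans k g f = ∑ i, (a i : G → k) g • b i := by
    intro g
    ext x
    rw [leftTrans_apply, hab]
    simp
  let bi : Fin n → coordRing k G := fun i => ⟨fun g => (b i : G → k) g⁻¹,
    AffineAlgGroup.inv_regular _ (b i).2⟩
  -- With `f (x y) = ∑ a i (x) b i (y)`, the tangent vector of `Ad g E` on `f` is `∑ b i (g⁻¹) (E (a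
  -- i)) (g)`. Differentiating this product along `D` at the identity gives the two terms of the
  -- commutator.
  have h2 : coeff k (isRegularRep_Ad k) l E = ∑ i, bi i * toDer k G E (a i) := by
    ext g
    change tangent k (Ad k g E) f = _
    rw [tangent_apply, Ad_apply, rightTrans_apply, one_mul, hright]
    simp [bi]
  -- Inversion has differential `-1` at the identity: differentiate `∑ c i (g) d i (g⁻¹) = h 1`.
  have hinv : ∀ h : coordRing k G, ∀ hi : coordRing k G, (∀ g : G, (hi : G → k) g = (h : G → k) g⁻¹) →
      tangent k D hi = - tangent k D h := by
    intro h hi hh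
    obtain ⟨m, c, d, hcd⟩ := mul_sum h.2
    let di : Fin m → coordRing k G := fun i => ⟨fun g => (d i : G → k) g⁻¹,
      AffineAlgGroup.inv_regular _ (d i).2⟩
    have e1 : ∑ i, c i * di i = algebraMap k _ ((h : G → k) 1) := by
      ext g
      have := hcd g g⁻¹
      rw [mul_inv_cancel] at this
      simpa [di] using this.symm
    have e2 := congrArg (tangent k D) e1
    have e3 : h = ∑ i, (d i : G → k) 1 • c i := by
      ext g
      have := hcd g 1
      rw [mul_one] at this
      simpa [mul_comm] using this
    have e4 : hi = ∑ i, (c i : G → k) 1 • di i := by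
      ext g
      have := hcd 1 g⁻¹
      rw [one_mul] at this
      simpa [di, hh] using this
    have e5 : tangent k D h = ∑ i, (d i : G → k) 1 * tangent k D (c i) := by
      conv_lhs => rw [e3, map_sum]
      simp
    have e6 : tangent k D hi = ∑ i, (c i : G → k) 1 * tangent k D (di i) := by
      conv_lhs => rw [e4, map_sum]
      simp
    have e7 : ∀ i, tangent k D (c i * di i) = (c i : G → k) 1 * tangent k D (di i) +
        (d i : G → k) 1 * tangent k D (c i) := by
      intro i
      simp [tangent_apply, di]
    rw [map_sum] at e2
    simp only [e7, Finset.sum_add_distrib, ← e5, ← e6] at e2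
    have e8 : tangent k D (algebraMap k _ ((h : G → k) 1)) = 0 := by simp [tangent_apply]
    rw [e8] at e2
    exact eq_neg_of_add_eq_zero_left e2
  have h3 : f = ∑ i, (b i : G → k) 1 • a i := by
    rw [← hright, rightTrans_one]
  have h4 : tangent k D (toDer k G E f) = ∑ i, (b i : G → k) 1 * tangent k D (toDer k G E (a i)) := by
    conv_lhs => rw [h3, map_sum, map_sum]
    simp
  have h5 : toDer k G D f = ∑ i, tangent k D (b i) • a i := by
    ext g
    rw [apply_eq_tangent, hleft, map_sum]
    simp [mul_comm]
  have h6 : tangent k E (toDer k G D f) = ∑ i, tangent k D (b i) * tangent k E (a i) := by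
    rw [h5, map_sum]
    simp
  have h7 : tangent k ⁅D, E⁆ f = tangent k D (toDer k G E f) - tangent k E (toDer k G D f) := by
    simp [tangent_apply, Derivation.commutator_apply]
  rw [h1, h2, h7, h4, h6, map_sum, ← Finset.sum_sub_distrib]
  refine Finset.sum_congr rfl fun i _ => ?_
  have h8 := hinv (b i) (bi i) fun g => rfl
  have h9 : tangent k D (bi i * toDer k G E (a i)) = (bi i : G → k) 1 *
      tangent k D (toDer k G E (a i)) + tangent k E (a i) * tangent k D (bi i) := by
    simp [tangent_apply]
  have h10 : (bi i : G → k) 1 = (b i : G → k) 1 := by simp [bi]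
  rw [h9, h8, h10]
  ring

end Exponential

/-! ### Euler operators and ideals stable under the Lie algebra -/

section Euler

variable {k : Type*} [Field k] {G : Type*} [Group G] [AffineAlgGroup k G]

variable (k G) in
/-- Evaluation of regular functions at the identity. -/
def evalOne : coordRing k G →ₐ[k] k :=
  (Pi.evalAlgHom k (fun _ : G => k) 1).comp (coordRing k G).val

variable (k G) in
/-- The maximal ideal of the identity. -/
def idealOne : Ideal (coordRing k G) := RingHom.ker (evalOne k G)

theorem mem_idealOne {f : coordRing k G} : f ∈ idealOne k G ↔ (f : G → k) 1 = 0 := Iff.rfl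

theorem sub_const_mem_idealOne (f : coordRing k G) :
    f - algebraMap k _ ((f : G → k) 1) ∈ idealOne k G := by
  rw [mem_idealOne]; simp

/-- Every point derivation at the identity is the tangent vector of an element of the Lie
algebra. -/
theorem exists_tangent_eq (δ : coordRing k G →ₗ[k] k)
    (hδ : ∀ f g : coordRing k G, δ (f * g) = (f : G → k) 1 * δ g + (g : G → k) 1 * δ f) :
    ∃ D : LieAlg k G, ∀ f, tangent k D f = δ f := by
  have hmem : ∀ f : coordRing k G, (fun g => δ (leftTrans k g f)) ∈ coordRing k G := by
    intro f
    obtain ⟨n, a, b, hab⟩ := mul_sum f.2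
    have : (fun g => δ (leftTrans k g f)) = ∑ i, δ (b i) • (a i : G → k) := by
      funext g
      have : leftTrans k g f = ∑ i, (a i : G → k) g • b i := by
        ext x; rw [leftTrans_apply, hab]; simp
      rw [this, map_sum]
      simp [mul_comm]
    rw [this]
    exact Subalgebra.sum_mem _ fun i _ => Subalgebra.smul_mem _ (a i).2 _
  -- Left invariance dictates the value of `D f` at `g`: it is `δ` applied to the left translate of
  -- `f` by `g`.
  let D : Derivation k (coordRing k G) (coordRing k G) := Derivation.mk'
    { toFun := fun f => ⟨fun g => δ (leftTrans k g f), hmem f⟩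
      map_add' := fun f g => by ext x; simp
      map_smul' := fun c f => by ext x; simp } (fun f g => by
        ext x
        simp [hδ, leftTrans_apply])
  have hD : ∀ f x, (D f : G → k) x = δ (leftTrans k x f) := fun f x => rfl
  refine ⟨ofDer k D fun h f => ?_, fun f => ?_⟩
  · ext x
    rw [leftTrans_apply, hD, hD]
    congr 1
    ext y
    simp [leftTrans_apply, mul_assoc]
  · rw [tangent_apply, toDer_ofDer, hD]
    congr 1
    ext y
    simp [leftTrans_apply]

/-- A function vanishing at the identity whose derivatives there vanish lies in the square of the
maximal ideal. -/
theorem mem_idealOne_sq {f : coordRing k G} (hf : f ∈ idealOne k G)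
    (h : ∀ D : LieAlg k G, tangent k D f = 0) : f ∈ idealOne k G ^ 2 := by
  by_contra hne
  -- If `f` is not in `𝔪²`, it is not in `𝔪² ⊕ k` either. A linear form killing this sum but not `f`
  -- is a point derivation, so it comes from the Lie algebra.
  let p : Submodule k (coordRing k G) :=
    (idealOne k G ^ 2).restrictScalars k ⊔ (k ∙ (1 : coordRing k G))
  have hfp : f ∉ p := by
    intro hfp
    obtain ⟨s, hs, c, hc, rfl⟩ := Submodule.mem_sup.1 hfp
    obtain ⟨c, rfl⟩ := Submodule.mem_span_singleton.1 hc
    have hs1 : (s : G → k) 1 = 0 := mem_idealOne.1 (Ideal.pow_le_self two_ne_zero hs)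
    have : c = 0 := by
      have := mem_idealOne.1 hf
      simpa [hs1] using this
    rw [this, zero_smul, add_zero] at hne
    exact hne hs
  obtain ⟨δ, hδf, hδ⟩ := Submodule.exists_le_ker_of_notMem hfp
  have hδ1 : δ 1 = 0 := hδ (Submodule.mem_sup_right (Submodule.mem_span_singleton_self 1))
  have hδ2 : ∀ a ∈ idealOne k G, ∀ b ∈ idealOne k G, δ (a * b) = 0 := fun a ha b hb =>
    hδ (Submodule.mem_sup_left (by
      rw [Submodule.restrictScalars_mem, sq]; exact Ideal.mul_mem_mul ha hb))
  obtain ⟨D, hD⟩ := exists_tangent_eq δ (fun a b => by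
    have h1 := hδ2 _ (sub_const_mem_idealOne a) _ (sub_const_mem_idealOne b)
    have h2 : (a - algebraMap k _ ((a : G → k) 1)) * (b - algebraMap k _ ((b : G → k) 1)) =
        a * b - (a : G → k) 1 • b - (b : G → k) 1 • a +
          ((a : G → k) 1 * (b : G → k) 1) • 1 := by
      simp only [Algebra.smul_def, map_mul]; ring
    rw [h2] at h1
    simp only [map_add, map_sub, map_smul, hδ1, smul_eq_mul, mul_zero, add_zero] at h1
    linear_combination h1)
  exact hδf ((hD f).symm.trans (h D))

/-- There are functions `x i` vanishing at the identity and elements `D i` of the Lie algebra such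
that the derivation `∑ x i * D i` is multiplication by `n` on `𝔪ⁿ / 𝔪ⁿ⁺¹`. -/
theorem exists_euler : ∃ (r : ℕ) (x : Fin r → coordRing k G) (D : Fin r → LieAlg k G),
    (∀ i, x i ∈ idealOne k G) ∧ ∀ (n : ℕ) (f : coordRing k G), f ∈ idealOne k G ^ n →
      ∑ i, x i * toDer k G (D i) f - n • f ∈ idealOne k G ^ (n + 1) := by
  classical
  let D := Module.finBasis k (LieAlg k G)
  let T : coordRing k G →ₗ[k] (Fin (Module.finrank k (LieAlg k G)) → k) :=
    LinearMap.pi fun i => tangent k (D i)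
  -- A linear relation satisfied by all `T f` would be a linear relation between the basis vectors
  -- `D i`. Surjectivity provides functions whose differentials at `1` are dual to the `D i`.
  have hT : LinearMap.range T = ⊤ := by
    by_contra hne
    obtain ⟨l, hl0, hl⟩ := Submodule.exists_le_ker_of_lt_top _ (lt_top_iff_ne_top.2 hne)
    have h0 : ∑ i, l (Pi.single i 1) • D i = 0 := by
      apply lieAlg_ext k
      intro f
      have h1 : l (T f) = 0 := hl ⟨f, rfl⟩
      rw [LinearMap.pi_apply_eq_sum_univ] at h1
      let L : Module.Dual k (LieAlg k G) :=
        { toFun := fun E => tangent k E f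
          map_add' := fun D E => tangent_add k D E f
          map_smul' := fun c D => tangent_smul k c D f }
      change L _ = L 0
      rw [map_zero, map_sum, ← h1]
      refine Finset.sum_congr rfl fun i _ => ?_
      rw [map_smul, smul_eq_mul, smul_eq_mul, mul_comm]
      congr 2
      funext j
      simp [Pi.single_apply, eq_comm]
    have h1 := Fintype.linearIndependent_iff.1 D.linearIndependent _ h0
    exact hl0 (LinearMap.pi_ext' fun i => LinearMap.ext_ring (by simpa using h1 i))
  rw [LinearMap.range_eq_top] at hT
  choose y hy using fun i => hT (Pi.single i 1)
  let x : Fin (Module.finrank k (LieAlg k G)) → coordRing k G :=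
    fun i => y i - algebraMap k _ ((y i : G → k) 1)
  have hx : ∀ i, x i ∈ idealOne k G := fun i => sub_const_mem_idealOne (y i)
  have hDx : ∀ i j, tangent k (D j) (x i) = if i = j then 1 else 0 := by
    intro i j
    have h1 := congrFun (hy i) j
    have h2 : tangent k (D j) (x i) = tangent k (D j) (y i) := by
      simp [x, tangent_apply]
    rw [h2]
    change T (y i) j = _
    rw [h1, Pi.single_apply]
    simp only [eq_comm]
  refine ⟨_, x, D, hx, ?_⟩
  let E : coordRing k G →ₗ[k] coordRing k G :=
    ∑ i, LinearMap.mulLeft k (x i) ∘ₗ (toDer k G (D i)).toLinearMap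
  have hE : ∀ f, E f = ∑ i, x i * toDer k G (D i) f := fun f => by
    simp [E, LinearMap.sum_apply]
  have hEmul : ∀ a b, E (a * b) = a * E b + b * E a := by
    intro a b
    simp only [hE, Derivation.leibniz, smul_eq_mul, Finset.mul_sum, ← Finset.sum_add_distrib]
    exact Finset.sum_congr rfl fun i _ => by ring
  -- The Euler operator is the identity on `𝔪 / 𝔪²`; being a derivation, it is then multiplication
  -- by `n` on `𝔪ⁿ / 𝔪ⁿ⁺¹`.
  have h1 : ∀ f ∈ idealOne k G, E f - f ∈ idealOne k G ^ 2 := by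
    intro f hf
    have e1 : f - ∑ i, tangent k (D i) f • x i ∈ idealOne k G ^ 2 := by
      apply mem_idealOne_sq
      · refine Ideal.sub_mem _ hf (Ideal.sum_mem _ fun i _ => ?_)
        rw [Algebra.smul_def]
        exact Ideal.mul_mem_left _ _ (hx i)
      · intro D'
        have e2 : ∀ j, tangent k (D j) (f - ∑ i, tangent k (D i) f • x i) = 0 := by
          intro j
          rw [map_sub, map_sum]
          simp [hDx]
        let L : Module.Dual k (LieAlg k G) :=
          { toFun := fun E => tangent k E (f - ∑ i, tangent k (D i) f • x i)
            map_add' := fun D E => tangent_add k D E _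
            map_smul' := fun c D => tangent_smul k c D _ }
        have hL : L = 0 := D.ext e2
        exact LinearMap.congr_fun hL D'
    have e3 : E f - ∑ i, tangent k (D i) f • x i ∈ idealOne k G ^ 2 := by
      rw [hE, ← Finset.sum_sub_distrib]
      refine Ideal.sum_mem _ fun i _ => ?_
      have : x i * toDer k G (D i) f - tangent k (D i) f • x i =
          x i * (toDer k G (D i) f - algebraMap k _ ((toDer k G (D i) f : G → k) 1)) := by
        rw [tangent_apply, Algebra.smul_def]; ring
      rw [this, sq]
      exact Ideal.mul_mem_mul (hx i) (sub_const_mem_idealOne _)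
    have := Ideal.sub_mem _ e3 e1
    rwa [sub_sub_sub_cancel_right] at this
  intro n
  induction n with
  | zero =>
    intro f _
    rw [zero_smul, sub_zero, zero_add, pow_one]
    exact Ideal.sum_mem _ fun i _ => Ideal.mul_mem_right _ _ (hx i)
  | succ n ih =>
    intro f hf
    simp only [← hE] at ih ⊢
    rw [pow_succ'] at hf
    induction hf using Submodule.mul_induction_on' with
    | mem_mul_mem a ha b hb =>
      have : E (a * b) - (n + 1) • (a * b) = a * (E b - n • b) + b * (E a - a) := by
        rw [hEmul, nsmul_eq_mul, nsmul_eq_mul]; push_cast; ring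
      rw [this]
      refine Ideal.add_mem _ ?_ ?_
      · rw [pow_succ' _ (n + 1)]
        exact Ideal.mul_mem_mul ha (ih b hb)
      · rw [add_assoc, pow_add]
        exact Ideal.mul_mem_mul hb (h1 a ha)
    | add a _ b _ ha hb =>
      have : E (a + b) - (n + 1) • (a + b) = (E a - (n + 1) • a) + (E b - (n + 1) • b) := by
        rw [map_add, smul_add]; ring
      rw [this]
      exact Ideal.add_mem _ ha hb

/-- An ideal of functions vanishing at the identity that is stable under the Lie algebra vanishes
in a neighbourhood of the identity. -/
theorem exists_annihilator [CharZero k] (I : Ideal (coordRing k G)) (hI : I ≤ idealOne k G)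
    (hD : ∀ (D : LieAlg k G), ∀ f ∈ I, toDer k G D f ∈ I) :
    ∃ u : coordRing k G, (u : G → k) 1 = 1 ∧ ∀ f ∈ I, u * f = 0 := by
  obtain ⟨r, x, D, hx, hE⟩ := exists_euler (k := k) (G := G)
  -- Let `I ⊆ 𝔪ⁿ⁺¹`. The Euler operator sends `f ∈ I` into `𝔪 I ⊆ 𝔪ⁿ⁺²`, yet it is congruent to `(n
  -- + 1) f` modulo `𝔪ⁿ⁺²`. In characteristic zero, `f ∈ 𝔪ⁿ⁺²`.
  have hpow : ∀ n, I ≤ idealOne k G ^ (n + 1) := by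
    intro n
    induction n with
    | zero => rwa [zero_add, pow_one]
    | succ n ih =>
      intro f hf
      have h1 := hE (n + 1) f (ih hf)
      have h2 : ∑ i, x i * toDer k G (D i) f ∈ idealOne k G ^ (n + 1 + 1) := by
        refine Ideal.sum_mem _ fun i _ => ?_
        rw [pow_succ']
        exact Ideal.mul_mem_mul (hx i) (ih (hD (D i) f hf))
      have h3 := Ideal.sub_mem _ h2 h1
      rw [sub_sub_cancel] at h3
      have h4 : f = algebraMap k (coordRing k G) (((n + 1 : ℕ) : k)⁻¹) * ((n + 1) • f) := by
        rw [nsmul_eq_mul, ← mul_assoc, ← map_natCast (algebraMap k (coordRing k G)), ← map_mul,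
          inv_mul_cancel₀ (Nat.cast_ne_zero.2 n.succ_ne_zero), map_one, one_mul]
      rw [h4]
      exact Ideal.mul_mem_left _ _ h3
  -- By Krull's intersection theorem, an element of all powers of `𝔪` satisfies `a f = f` for some
  -- `a ∈ 𝔪`.
  have hker : ∀ f ∈ I, ∃ a ∈ idealOne k G, a * f = f := by
    intro f hf
    have h := (Ideal.mem_iInf_smul_pow_eq_bot_iff (M := coordRing k G) (idealOne k G) f).1 (by
      rw [Submodule.mem_iInf]
      intro n
      have h1 : f ∈ idealOne k G ^ n := Ideal.pow_le_pow_right (Nat.le_succ n) (hpow n hf)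
      have h2 := Submodule.smul_mem_smul h1 (Submodule.mem_top (x := (1 : coordRing k G)))
      simpa using h2)
    obtain ⟨a, ha⟩ := h
    exact ⟨a, a.2, ha⟩
  obtain ⟨s, hs⟩ := IsNoetherian.noetherian I
  choose! a ha haf using hker
  -- Each factor kills its generator of `I` and takes the value `1` at the identity.
  refine ⟨∏ f ∈ s, (1 - a f), ?_, fun f hf => ?_⟩
  · change evalOne k G _ = 1
    rw [map_prod]
    refine Finset.prod_eq_one fun f hf => ?_
    have hfI : f ∈ I := hs ▸ Submodule.subset_span hf
    rw [map_sub, map_one, show evalOne k G (a f) = 0 from ha f hfI, sub_zero]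
  · rw [← hs] at hf
    induction hf using Submodule.span_induction with
    | mem f hf =>
      have hfI : f ∈ I := hs ▸ Submodule.subset_span hf
      have : (1 - a f) * f = 0 := by rw [sub_mul, one_mul, haf f hfI, sub_self]
      obtain ⟨c, hc⟩ := Finset.dvd_prod_of_mem (fun f => 1 - a f) hf
      rw [hc, mul_right_comm, this, zero_mul]
    | zero => rw [mul_zero]
    | add f g _ _ hf hg => rw [mul_add, hf, hg, add_zero]
    | smul c f _ hf => rw [smul_eq_mul, mul_left_comm, hf, mul_zero]

end Euler

/-! ### Connected groups: from the Lie algebra back to the group -/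

section Connected

variable {k : Type*} [Field k] {G : Type*} [Group G] [AffineAlgGroup k G]

theorem isRegularMap_mul_left (h : G) : IsRegularMap (coordRing k G) (coordRing k G) (h * ·) :=
  fun _ hf => mul_left_mem h hf

theorem isRegularMap_conj (h : G) :
    IsRegularMap (coordRing k G) (coordRing k G) (fun g => h * g * h⁻¹) :=
  fun _ hf => mul_left_mem h (mul_right_mem h⁻¹ hf)

/-- A closed submonoid of a connected group that contains a neighbourhood of the identity is the
whole group. -/
theorem mem_of_nonvanishing_subset (hconn : IsZariskiConnected (coordRing k G) (Set.univ : Set G))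
    (H : Submonoid G) (hcl : IsZariskiClosed (coordRing k G) (H : Set G)) (u : coordRing k G)
    (hu : (u : G → k) 1 ≠ 0) (hH : ∀ g, (u : G → k) g ≠ 0 → g ∈ H) (g : G) : g ∈ H := by
  let _ := zariski (coordRing k G)
  have hopen : IsOpen (H : Set G) := by
    rw [isOpen_iff_forall_mem_open]
    intro h hh
    refine ⟨{g | (u : G → k) (h⁻¹ * g) ≠ 0}, fun g hg => ?_,
      isOpen_nonvanishing _ (mul_left_mem h⁻¹ u.2), by simpa using hu⟩
    have := H.mul_mem hh (hH _ hg)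
    rwa [mul_inv_cancel_left] at this
  have : PreconnectedSpace G := ⟨hconn.isPreconnected⟩
  have h1 : (H : Set G) = Set.univ := IsClopen.eq_univ ⟨hcl, hopen⟩ ⟨1, H.one_mem⟩
  exact (h1 ▸ Set.mem_univ g : g ∈ (H : Set G))

/-- A subspace stable under a representation is stable under the derived one. -/
theorem derived_mem_of_map_mem {V : Type*} [AddCommGroup V] [Module k V] [FiniteDimensional k V]
    {ρ : Representation k G V} (hρ : IsRegularRep k ρ) (W : Submodule k V)
    (hW : ∀ (g : G), ∀ w ∈ W, ρ g w ∈ W) (D : LieAlg k G) {w : V} (hw : w ∈ W) :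
    derived k hρ D w ∈ W := by
  rw [← Subspace.forall_mem_dualAnnihilator_apply_eq_zero_iff]
  intro l hl
  have : coeff k hρ l w = 0 := by
    ext g
    exact (Submodule.mem_dualAnnihilator l).1 hl _ (hW g w hw)
  change l (derivedFun k hρ D w) = 0
  rw [dual_derivedFun, this, map_zero]

/-- The derived representation of a product. -/
theorem derived_prod {V W : Type*} [AddCommGroup V] [Module k V] [AddCommGroup W]
    [Module k W] [FiniteDimensional k V] [FiniteDimensional k W]
    {ρ : Representation k G V} {σ : Representation k G W}
    (hρ : IsRegularRep k ρ) (hσ : IsRegularRep k σ) (D : LieAlg k G) (v : V × W) :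
    derived k (hρ.prod k hσ) D v = (derived k hρ D v.1, derived k hσ D v.2) := by
  apply dual_ext k
  intro l
  have h1 : l (derived k (hρ.prod k hσ) D v) = tangent k D (coeff k (hρ.prod k hσ) l v) :=
    dual_derivedFun k _ D v l
  have h2 : (l ∘ₗ LinearMap.inl k V W) (derived k hρ D v.1) = tangent k D (coeff k hρ _ v.1) :=
    dual_derivedFun k _ D v.1 _
  have h3 : (l ∘ₗ LinearMap.inr k V W) (derived k hσ D v.2) = tangent k D (coeff k hσ _ v.2) :=
    dual_derivedFun k _ D v.2 _
  have h4 : l (derived k hρ D v.1, derived k hσ D v.2) =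
      (l ∘ₗ LinearMap.inl k V W) (derived k hρ D v.1) +
        (l ∘ₗ LinearMap.inr k V W) (derived k hσ D v.2) := by
    simp [← map_add]
  rw [h1, h4, h2, h3, ← map_add]
  congr 1
  ext g
  simp [coeff, ← map_add]

/-- The derived representation intertwines the adjoint action. -/
theorem derived_Ad_apply {V : Type*} [AddCommGroup V] [Module k V] [FiniteDimensional k V]
    {ρ : Representation k G V} (hρ : IsRegularRep k ρ) (g : G) (D : LieAlg k G) (v : V) :
    derived k hρ (Ad k g D) (ρ g v) = ρ g (derived k hρ D v) := by
  apply dual_ext k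
  intro l
  have h1 : l (derived k hρ (Ad k g D) (ρ g v)) = tangent k (Ad k g D) (coeff k hρ l (ρ g v)) :=
    dual_derivedFun k _ _ _ l
  have h2 : (l ∘ₗ ρ g) (derived k hρ D v) = tangent k D (coeff k hρ (l ∘ₗ ρ g) v) :=
    dual_derivedFun k _ D v _
  rw [h1]
  refine Eq.trans ?_ h2.symm
  rw [tangent_apply, Ad_apply, rightTrans_apply, one_mul, apply_eq_tangent]
  congr 1
  ext x
  simp [leftTrans_apply, rightTrans_apply, coeff, mul_assoc]

variable [CharZero k]

/-- A subspace stable under the derived representation of a connected group is stable under the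
group. -/
theorem map_mem_of_derived_mem (hconn : IsZariskiConnected (coordRing k G) (Set.univ : Set G))
    {V : Type*} [AddCommGroup V] [Module k V] [FiniteDimensional k V] {ρ : Representation k G V}
    (hρ : IsRegularRep k ρ) (W : Submodule k V)
    (hW : ∀ (D : LieAlg k G), ∀ w ∈ W, derived k hρ D w ∈ W) (g : G) {w : V} (hw : w ∈ W) :
    ρ g w ∈ W := by
  -- These are the equations of the stabilizer of `W`. Since `W` is stable under the derived
  -- representation, they generate an ideal stable under the Lie algebra. The ideal vanishes near
  -- the identity, so the stabilizer contains a neighbourhood of `1`.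
  let S : Set (coordRing k G) := {f | ∃ l ∈ W.dualAnnihilator, ∃ w ∈ W, f = coeff k hρ l w}
  have hmem : ∀ v : V, v ∈ W ↔ ∀ l ∈ W.dualAnnihilator, l v = 0 := fun v =>
    (Subspace.forall_mem_dualAnnihilator_apply_eq_zero_iff W v).symm
  let H : Submonoid G :=
    { carrier := {g | ∀ w ∈ W, ρ g w ∈ W}
      one_mem' := fun w hw => by simpa using hw
      mul_mem' := fun {g h} hg hh w hw => by
        rw [map_mul]; exact hg _ (hh w hw) }
  have hH : (H : Set G) = {g | ∀ f ∈ Subtype.val '' S, f g = 0} := by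
    ext g
    constructor
    · rintro hg _ ⟨_, ⟨l, hl, w, hw, rfl⟩, rfl⟩
      exact (hmem _).1 (hg w hw) l hl
    · intro hg w hw
      exact (hmem _).2 fun l hl => hg _ ⟨_, ⟨l, hl, w, hw, rfl⟩, rfl⟩
  have hcl : IsZariskiClosed (coordRing k G) (H : Set G) := by
    rw [hH]
    apply isClosed_zeroLocus
    rintro _ ⟨f, -, rfl⟩
    exact f.2
  obtain ⟨u, hu1, hu⟩ := exists_annihilator (Ideal.span S)
    (by
      rw [Ideal.span_le]
      rintro _ ⟨l, hl, w, hw, rfl⟩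
      change l (ρ 1 w) = 0
      rw [map_one]
      exact (hmem w).1 hw l hl)
    (by
      intro D f hf
      induction hf using Submodule.span_induction with
      | mem f hf =>
        obtain ⟨l, hl, w, hw, rfl⟩ := hf
        rw [apply_coeff]
        exact Ideal.subset_span ⟨l, hl, _, hW D w hw, rfl⟩
      | zero => rw [map_zero]; exact Ideal.zero_mem _
      | add f g _ _ hf hg => rw [map_add]; exact Ideal.add_mem _ hf hg
      | smul c f hf' hf =>
        rw [smul_eq_mul, Derivation.leibniz]
        exact Ideal.add_mem _ (Ideal.mul_mem_left _ _ hf) (Ideal.mul_mem_right _ _ hf'))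
  refine mem_of_nonvanishing_subset hconn H hcl u (by rw [hu1]; exact one_ne_zero) (fun g hg => ?_) g
    w hw
  change g ∈ (H : Set G)
  rw [hH]
  rintro _ ⟨f, hf, rfl⟩
  have h := congrFun (congrArg Subtype.val (hu f (Ideal.subset_span hf))) g
  exact (mul_eq_zero.1 h).resolve_left hg

/-- A connected group with trivial Lie algebra is trivial. -/
theorem subsingleton_of_lieAlg (hconn : IsZariskiConnected (coordRing k G) (Set.univ : Set G))
    [Subsingleton (LieAlg k G)] : Subsingleton G := by
  -- Without nonzero derivations `𝔪` itself is stable, hence killed by some `u` with `u 1 = 1`. The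
  -- identity is then the only point where `u` does not vanish.
  obtain ⟨u, hu1, hu⟩ := exists_annihilator (idealOne k G) le_rfl fun D f _ => by
    rw [Subsingleton.elim D 0, map_zero]; exact Ideal.zero_mem _
  have hone : ∀ g : G, (∀ f ∈ idealOne k G, (f : G → k) g = 0) → g = 1 := by
    intro g hg
    refine AffineAlgGroup.separates (k := k) g 1 fun f hf => ?_
    have := hg _ (sub_const_mem_idealOne ⟨f, hf⟩)
    simpa [sub_eq_zero] using this
  have hcl : IsZariskiClosed (coordRing k G) ((⊥ : Submonoid G) : Set G) := by
    have : ((⊥ : Submonoid G) : Set G) = 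
        {g | ∀ f ∈ Subtype.val '' (idealOne k G : Set (coordRing k G)), f g = 0} := by
      ext g
      constructor
      · rintro rfl _ ⟨f, hf, rfl⟩
        exact hf
      · intro hg
        exact hone g fun f hf => hg _ ⟨f, hf, rfl⟩
    rw [this]
    apply isClosed_zeroLocus
    rintro _ ⟨f, -, rfl⟩
    exact f.2
  have h := mem_of_nonvanishing_subset hconn ⊥ hcl u (by rw [hu1]; exact one_ne_zero) fun g hg =>
    Submonoid.mem_bot.2 (hone g fun f hf => by
      have h := congrFun (congrArg Subtype.val (hu f hf)) g
      exact (mul_eq_zero.1 h).resolve_left hg)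
  exact ⟨fun a b => (Submonoid.mem_bot.1 (h a)).trans (Submonoid.mem_bot.1 (h b)).symm⟩

/-- For a connected group, an endomorphism commuting with the derived representation commutes with
the group. -/
theorem commute_of_commute_derived
    (hconn : IsZariskiConnected (coordRing k G) (Set.univ : Set G))
    {V : Type*} [AddCommGroup V] [Module k V] [FiniteDimensional k V] {ρ : Representation k G V}
    (hρ : IsRegularRep k ρ) (t : Module.End k V)
    (ht : ∀ (D : LieAlg k G) (v : V), t (derived k hρ D v) = derived k hρ D (t v)) (g : G) (v : V) :
    t (ρ g v) = ρ g (t v) := by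
  -- Commuting with an action means that the graph of `t` is stable in `V ⊕ V`.
  have := map_mem_of_derived_mem hconn (hρ.prod k hρ) t.graph (fun D w hw => by
    rw [LinearMap.mem_graph_iff] at hw ⊢
    rw [derived_prod hρ hρ]
    simp only [hw, ht]) g (w := (v, t v)) (by rw [LinearMap.mem_graph_iff])
  rw [LinearMap.mem_graph_iff] at this
  exact this.symm

end Connected

/-! ### Connected components of closed sets -/

section Component

variable {k : Type*} [Field k] {X : Type*}

/-- A point outside a Zariski closed set is separated from it by a regular function. -/
theorem exists_separating {A : Subalgebra k (X → k)} {Z : Set X} (hZ : IsZariskiClosed A Z) {x : X}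
    (hx : x ∉ Z) : ∃ f ∈ A, (∀ z ∈ Z, f z = 0) ∧ f x ≠ 0 := by
  let _ := zariski A
  obtain ⟨_, ⟨f, hf, rfl⟩, hxf, hfZ⟩ :=
    (isTopologicalBasis_zariski A).exists_subset_of_mem_open (show x ∈ Zᶜ from hx) hZ.isOpen_compl
  exact ⟨f, hf, fun z hz => by_contra fun h => hfZ h hz, hxf⟩

/-- In a variety with Noetherian coordinate ring, every point of a closed subset has a connected
closed neighbourhood in it with closed complement. -/
theorem exists_connected_component (A : Subalgebra k (X → k)) [IsNoetherianRing A] {C : Set X}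
    (hC : IsZariskiClosed A C) {x : X} (hx : x ∈ C) :
    ∃ Z ⊆ C, x ∈ Z ∧ IsZariskiClosed A Z ∧ IsZariskiClosed A (C \ Z) ∧ IsZariskiConnected A Z := by
  let _ := zariski A
  let I : Set X → Ideal A := fun Z =>
    { carrier := {f | ∀ z ∈ Z, (f : X → k) z = 0}
      add_mem' := fun {f g} hf hg z hz => by
        change (f : X → k) z + (g : X → k) z = 0
        rw [hf z hz, hg z hz, add_zero]
      zero_mem' := fun z _ => rfl
      smul_mem' := fun c f hf z hz => by
        change (c : X → k) z * (f : X → k) z = 0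
        rw [hf z hz, mul_zero] }
  let good : Set (Set X) := {Z | Z ⊆ C ∧ x ∈ Z ∧ IsClosed Z ∧ IsClosed (C \ Z)}
  -- A maximal vanishing ideal among the relatively clopen subsets of `C` through `x` exists by
  -- Noetherianity. It gives a minimal such subset, because closed sets are determined by their
  -- ideals.
  obtain ⟨_, ⟨Z, ⟨hZC, hxZ, hZ, hCZ⟩, rfl⟩, hmax⟩ := WellFounded.has_min
    (wellFounded_gt : WellFounded ((· > ·) : Ideal A → Ideal A → Prop)) (I '' good)
    ⟨_, C, ⟨subset_rfl, hx, hC, by rw [Set.sdiff_self]; exact isClosed_empty⟩, rfl⟩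
  have hkey : ∀ u, IsClosed u → x ∈ u → IsClosed (C \ (Z ∩ u)) → Z ⊆ u := by
    intro u hu hxu hcl z hz
    by_contra hzu
    have hgood : Z ∩ u ∈ good :=
      ⟨fun y hy => hZC hy.1, ⟨hxZ, hxu⟩, hZ.inter hu, hcl⟩
    have hle : I Z ≤ I (Z ∩ u) := fun f hf y hy => hf y hy.1
    refine hmax _ ⟨_, hgood, rfl⟩ (lt_of_le_of_ne hle fun heq => ?_)
    obtain ⟨f, hf, hf0, hfz⟩ := exists_separating (A := A) (hZ.inter hu) (fun h => hzu h.2 : z ∉ Z ∩ u)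
    have : (⟨f, hf⟩ : A) ∈ I Z := by rw [heq]; exact hf0
    exact hfz (this z hz)
  refine ⟨Z, hZC, hxZ, hZ, hCZ, ⟨x, hxZ⟩, ?_⟩
  rw [isPreconnected_iff_subset_of_fully_disjoint_closed hZ]
  have hdiff : ∀ u v, IsClosed v → Z ⊆ u ∪ v → Disjoint u v → IsClosed (C \ (Z ∩ u)) := by
    intro u v hv hZuv hd
    have : C \ (Z ∩ u) = (C \ Z) ∪ (Z ∩ v) := by
      ext y
      have h1 := @hZC y
      have h2 := @hZuv y
      have h3 : y ∈ u → y ∉ v := fun a b => Set.disjoint_left.1 hd a b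
      simp only [Set.mem_sdiff, Set.mem_inter_iff, Set.mem_union] at h2 ⊢
      tauto
    rw [this]
    exact hCZ.union (hZ.inter hv)
  intro u v hu hv hZuv hd
  rcases hZuv hxZ with hxu | hxv
  · exact Or.inl (hkey u hu hxu (hdiff u v hv hZuv hd))
  · exact Or.inr (hkey v hv hxv (hdiff v u hu (by rwa [Set.union_comm]) hd.symm))

/-- A connected subset of `C` meeting a relatively clopen subset is contained in it. -/
theorem subset_of_connected (A : Subalgebra k (X → k)) {C Z S : Set X}
    (hZ : IsZariskiClosed A Z) (hCZ : IsZariskiClosed A (C \ Z)) (hS : S ⊆ C)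
    (hSc : IsZariskiConnected A S) {x : X} (hxS : x ∈ S) (hxZ : x ∈ Z) : S ⊆ Z := by
  let _ := zariski A
  have h := isPreconnected_closed_iff.1 hSc.isPreconnected Z (C \ Z) hZ hCZ (fun y hy => by
    by_cases hyZ : y ∈ Z
    · exact Or.inl hyZ
    · exact Or.inr ⟨hS hy, hyZ⟩) ⟨x, hxS, hxZ⟩
  intro y hy
  by_contra hyZ
  obtain ⟨z, -, hz1, hz2⟩ := h ⟨y, hy, hS hy, hyZ⟩
  exact hz2.2 hz1

end Component

/-! ### Semisimplicity of the Lie algebra -/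

section Radical

variable {k : Type*} [Field k] {G : Type*} [Group G] [AffineAlgGroup k G]

/-- A closed normal commutative subgroup of a semisimple group is discrete: some regular function
vanishes on it outside the identity, but not at the identity. -/
theorem exists_isolating (hG : IsSemisimple k G) (C : Subgroup G) (hn : C.Normal)
    (hcl : IsZariskiClosed (coordRing k G) (C : Set G)) (hcomm : ∀ a ∈ C, ∀ b ∈ C, a * b = b * a) :
    ∃ f : coordRing k G, (f : G → k) 1 ≠ 0 ∧ ∀ c ∈ C, c ≠ 1 → (f : G → k) c = 0 := by
  -- The component `Z` of the identity in `C` is a closed connected normal commutative subgroup, so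
  -- it is trivial. Then `1` is outside the closed set `C \ Z`, and a regular function separates
  -- them.
  obtain ⟨Z, hZC, h1Z, hZ, hCZ, hZconn⟩ := exists_connected_component (coordRing k G) hcl C.one_mem
  have himage : ∀ φ : G → G, IsRegularMap (coordRing k G) (coordRing k G) φ →
      IsZariskiConnected (coordRing k G) (φ '' Z) := fun φ hφ => by
    let _ := zariski (coordRing k G)
    exact hZconn.image φ hφ.continuous.continuousOn
  have hdiv : ∀ a ∈ Z, ∀ b ∈ Z, a⁻¹ * b ∈ Z := by
    intro a ha b hb
    refine subset_of_connected _ hZ hCZ ?_ (himage (a⁻¹ * ·) (isRegularMap_mul_left a⁻¹))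
      (x := 1) ⟨a, ha, by simp⟩ h1Z ⟨b, hb, rfl⟩
    rintro _ ⟨c, hc, rfl⟩
    exact C.mul_mem (C.inv_mem (hZC ha)) (hZC hc)
  let N : Subgroup G :=
    { carrier := Z
      one_mem' := h1Z
      mul_mem' := fun {a b} ha hb => by
        have h := hdiv a⁻¹ (by simpa using hdiv a ha 1 h1Z) b hb
        rwa [inv_inv] at h
      inv_mem' := fun {a} ha => by simpa using hdiv a ha 1 h1Z }
  have hN : N = ⊥ := by
    refine hG.radical_trivial N ⟨fun n hn' g => ?_⟩ hZ hZconn ?_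
    · refine subset_of_connected _ hZ hCZ ?_ (himage _ (isRegularMap_conj g))
        (x := 1) ⟨1, h1Z, by simp⟩ h1Z ⟨n, hn', rfl⟩
      rintro _ ⟨c, hc, rfl⟩
      exact hn.conj_mem c (hZC hc) g
    · exact Group.isSolvable_of_comm fun a b => Subtype.ext (hcomm _ (hZC a.2) _ (hZC b.2))
  have h1 : (1 : G) ∉ (C : Set G) \ Z := fun h => h.2 h1Z
  obtain ⟨f, hf, hfC, hf1⟩ := exists_separating hCZ h1
  refine ⟨⟨f, hf⟩, hf1, fun c hc hc1 => hfC c ⟨hc, fun hcZ => hc1 ?_⟩⟩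
  have : c ∈ N := hcZ
  rwa [hN, Subgroup.mem_bot] at this

theorem toDer_iterate_left (D : LieAlg k G) (h : G) (f : coordRing k G) (n : ℕ) :
    (toDer k G D)^[n] (leftTrans k h f) = leftTrans k h ((toDer k G D)^[n] f) := by
  induction n with
  | zero => rfl
  | succ n ih => rw [Function.iterate_succ_apply', ih, toDer_left, Function.iterate_succ_apply']

theorem toDer_iterate_right {D : LieAlg k G} {h : G} (hD : Ad k h D = D) (f : coordRing k G)
    (n : ℕ) : (toDer k G D)^[n] (rightTrans k h f) = rightTrans k h ((toDer k G D)^[n] f) := by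
  have key : ∀ f, toDer k G D (rightTrans k h f) = rightTrans k h (toDer k G D f) := by
    intro f
    conv_lhs => rw [← hD, Ad_apply]
    rw [← rightTrans_mul, inv_mul_cancel, rightTrans_one]
  induction n with
  | zero => rfl
  | succ n ih => rw [Function.iterate_succ_apply', ih, key, Function.iterate_succ_apply']

/-- The Lie algebra of a semisimple group has trivial radical. -/
theorem hasTrivialRadical [CharZero k] [IsAlgClosed k] (hG : IsSemisimple k G) :
    LieAlgebra.HasTrivialRadical k (LieAlg k G) := by
  rw [LieAlgebra.hasTrivialRadical_iff_no_abelian_ideals]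
  intro 𝔞 h𝔞
  -- The aim is to show that `𝔞` is tangent to the closed commutative normal subgroup `C` below,
  -- which is discrete.
  have hstab : ∀ (g : G), ∀ y ∈ 𝔞, Ad k g y ∈ 𝔞 := fun g y hy =>
    map_mem_of_derived_mem hG.connected (isRegularRep_Ad k) 𝔞.toSubmodule
      (fun D w hw => by rw [derived_Ad]; exact 𝔞.lie_mem hw) g hy
  let H : Subgroup G :=
    { carrier := {g | ∀ y ∈ 𝔞, Ad k g y = y}
      one_mem' := fun y _ => by simp
      mul_mem' := fun {g h} hg hh y hy => by
        rw [map_mul, Module.End.mul_apply, hh y hy, hg y hy]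
      inv_mem' := fun {g} hg y hy => by
        conv_lhs => rw [← hg y hy]
        rw [← Module.End.mul_apply, ← map_mul, inv_mul_cancel, map_one, Module.End.one_apply] }
  have hHn : ∀ (g : G), ∀ h ∈ H, g * h * g⁻¹ ∈ H := by
    intro g h hh y hy
    rw [map_mul, map_mul, Module.End.mul_apply, Module.End.mul_apply, hh _ (hstab g⁻¹ y hy),
      ← Module.End.mul_apply, ← map_mul, mul_inv_cancel, map_one, Module.End.one_apply]
  -- `C` is the center of the pointwise fixer `H` of `𝔞`; both are normal because `𝔞` is
  -- `Ad`-stable.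
  let C : Subgroup G := H ⊓ Subgroup.centralizer (H : Set G)
  have hCn : C.Normal := by
    refine ⟨fun c hc g => ⟨hHn g c hc.1, ?_⟩⟩
    refine Subgroup.mem_centralizer_iff.2 ?_
    intro h hh
    have h1 := (Subgroup.mem_centralizer_iff.1 hc.2) (g⁻¹ * h * g) (by
      simpa using hHn g⁻¹ h hh)
    have h2 : h * (g * c * g⁻¹) = g * ((g⁻¹ * h * g) * c) * g⁻¹ := by group
    rw [h2, h1]
    group
  have hcomm : ∀ a ∈ C, ∀ b ∈ C, a * b = b * a := fun a ha b hb =>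
    (Subgroup.mem_centralizer_iff.1 hb.2) a ha.1
  let S : Set (coordRing k G) :=
    {f | ∃ (l : Module.Dual k (LieAlg k G)), ∃ y ∈ 𝔞,
      f = coeff k (isRegularRep_Ad k) l y - algebraMap k _ (l y)} ∪
    {f | ∃ h ∈ H, ∃ f', f = rightTrans k h f' - leftTrans k h f'}
  have hCS : (C : Set G) = {g | ∀ f ∈ Subtype.val '' S, f g = 0} := by
    ext g
    constructor
    · rintro hg _ ⟨_, (⟨l, y, hy, rfl⟩ | ⟨h, hh, f, rfl⟩), rfl⟩
      · have := hg.1 y hy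
        simp [coeff, this]
      · have := (Subgroup.mem_centralizer_iff.1 hg.2) h hh
        simp [rightTrans_apply, leftTrans_apply, this]
    · intro hg
      refine ⟨fun y hy => dual_ext k fun l => ?_, ?_⟩
      · have := hg _ ⟨_, Or.inl ⟨l, y, hy, rfl⟩, rfl⟩
        simpa [coeff, sub_eq_zero] using this
      · refine Subgroup.mem_centralizer_iff.2 ?_
        intro h hh
        refine AffineAlgGroup.separates (k := k) _ _ fun f hf => ?_
        have := hg _ ⟨_, Or.inr ⟨h, hh, ⟨f, hf⟩, rfl⟩, rfl⟩
        simp only [AddSubgroupClass.coe_sub, Pi.sub_apply, rightTrans_apply, leftTrans_apply,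
          sub_eq_zero] at this
        exact this.symm
  have hcl : IsZariskiClosed (coordRing k G) (C : Set G) := by
    rw [hCS]
    apply isClosed_zeroLocus
    rintro _ ⟨f, -, rfl⟩
    exact f.2
  obtain ⟨f, hf1, hfC⟩ := exists_isolating hG C hCn hcl hcomm
  rw [eq_bot_iff]
  intro D hD
  rw [LieSubmodule.mem_bot]
  -- The formal one-parameter subgroup of `D ∈ 𝔞` satisfies the equations of `C`: it fixes `𝔞`
  -- because `𝔞` is abelian, and it commutes with `H` because `H` fixes `D`.
  have hkill : ∀ s ∈ S, formalExp D s = 0 := by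
    rintro _ (⟨l, y, hy, rfl⟩ | ⟨h, hh, f, rfl⟩)
    · ext n
      rw [map_sub, map_sub, coeff_formalExp, iterate_toDer_coeff, AlgHom.commutes,
        PowerSeries.algebraMap_apply, PowerSeries.coeff_C]
      rcases n with _ | n
      · simp [coeff]
      · have hDy : derived k (isRegularRep_Ad k) D y = 0 := by
          rw [derived_Ad]
          exact congrArg Subtype.val (h𝔞.trivial ⟨D, hD⟩ ⟨y, hy⟩)
        rw [pow_succ, Module.End.mul_apply, hDy, map_zero]
        simp [coeff]
    · ext n
      rw [map_sub, map_sub, coeff_formalExp, coeff_formalExp, toDer_iterate_left,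
        toDer_iterate_right (hh D hD), rightTrans_apply, leftTrans_apply]
      simp
  apply lieAlg_ext k
  intro u
  -- The product `u₀ f` vanishes on `C`: `u₀` at the identity, `f` elsewhere. So its image under
  -- `formalExp D` is zero. The image of `f` has nonzero constant term, hence that of `u₀` vanishes,
  -- and its coefficient of degree one is the tangent vector of `D` on `u`.
  let u₀ := u - algebraMap k _ ((u : G → k) 1)
  have h1 : formalExp D (u₀ * f) = 0 := by
    refine formalExp_eq_zero D hkill fun g hg => ?_
    have hgC : g ∈ C := by
      change g ∈ (C : Set G)
      rw [hCS]
      rintro _ ⟨s, hs, rfl⟩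
      exact hg s hs
    by_cases hg1 : g = 1
    · simp [u₀, hg1]
    · simp [hfC g hgC hg1]
  rw [map_mul] at h1
  have h2 : formalExp D f ≠ 0 := by
    intro h
    apply hf1
    rw [← constantCoeff_formalExp D f, h, map_zero]
  have h3 := (mul_eq_zero.1 h1).resolve_right h2
  have h4 := coeff_formalExp D u₀ 1
  rw [h3] at h4
  have h5 : tangent k D u₀ = 0 := by
    simpa [tangent_apply] using h4.symm
  have h6 : tangent k D u = tangent k D u₀ := by simp [u₀, tangent_apply]
  rw [h6, h5]
  simp [tangent_apply]

end Radical

/-! ### Inner automorphisms are given by the group -/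

section Inner

variable {k : Type*} [Field k] {G : Type*} [Group G] [AffineAlgGroup k G]

/-- The span of the right translates of a regular function. -/
def translates (f : coordRing k G) : Submodule k (coordRing k G) :=
  Submodule.span k (Set.range fun g : G => rightTrans k g f)

theorem rightTrans_mem_translates (f : coordRing k G) (g : G) {h : coordRing k G}
    (hh : h ∈ translates f) : rightTrans k g h ∈ translates f := by
  induction hh using Submodule.span_induction with
  | mem _ hx =>
    obtain ⟨g', rfl⟩ := hx
    rw [← rightTrans_mul]
    exact Submodule.subset_span ⟨g * g', rfl⟩
  | zero => rw [map_zero]; exact Submodule.zero_mem _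
  | add _ _ _ _ h1 h2 => rw [map_add]; exact Submodule.add_mem _ h1 h2
  | smul c _ _ h1 => rw [map_smul]; exact Submodule.smul_mem _ _ h1

instance (f : coordRing k G) : FiniteDimensional k (translates f) := by
  obtain ⟨n, a, b, hab⟩ := mul_sum f.2
  have hle : translates f ≤ Submodule.span k (Set.range a) := by
    refine Submodule.span_le.2 ?_
    rintro _ ⟨g, rfl⟩
    have : rightTrans k g f = ∑ i, (b i : G → k) g • a i := by
      ext x
      rw [rightTrans_apply, hab]
      simp [mul_comm]
    simp only [this]
    exact Submodule.sum_mem _ fun i _ => Submodule.smul_mem _ _ (Submodule.subset_span ⟨i, rfl⟩)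
  have : FiniteDimensional k (Submodule.span k (Set.range a)) :=
    FiniteDimensional.span_of_finite k (Set.finite_range a)
  exact Submodule.finiteDimensional_of_le hle

/-- The representation of `G` on the span of the right translates of a regular function. -/
def translatesRep (f : coordRing k G) : Representation k G (translates f) where
  toFun g := (rightTrans k g).toLinearMap.restrict fun _ hh => rightTrans_mem_translates f g hh
  map_one' := LinearMap.ext fun h => Subtype.ext (rightTrans_one k h.1)
  map_mul' g g' := LinearMap.ext fun h => Subtype.ext (rightTrans_mul k g g' h.1)

theorem translatesRep_apply (f : coordRing k G) (g : G) (h : translates f) :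
    (translatesRep f g h : coordRing k G) = rightTrans k g h := rfl

theorem isRegularRep_translatesRep (f : coordRing k G) :
    IsRegularRep (V := translates f) k (translatesRep f) := by
  intro l v
  obtain ⟨l', hl'⟩ := LinearMap.exists_extend l
  obtain ⟨n, a, b, hab⟩ := mul_sum v.1.2
  have h1 : ∀ g, rightTrans k g v.1 = ∑ i, (b i : G → k) g • a i := by
    intro g
    ext x
    rw [rightTrans_apply, hab]
    simp [mul_comm]
  have h2 : (fun g => l (translatesRep f g v)) = ∑ i, l' (a i) • (b i : G → k) := by
    funext g
    rw [← hl', LinearMap.comp_apply, Submodule.subtype_apply, translatesRep_apply, h1, map_sum]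
    simp [mul_comm]
  rw [h2]
  exact Subalgebra.sum_mem _ fun i _ => Subalgebra.smul_mem _ (b i).2 _

/-- For the linear form `h ↦ h x`, the matrix coefficient of `h` is its left translate by `x`, whose
derivative at `1` is the value of the derivation at `x`. -/
theorem derived_translatesRep (f : coordRing k G) (D : LieAlg k G) (h : translates f) :
    ((derived k (isRegularRep_translatesRep f) D h : translates f) : coordRing k G) = toDer k G D h := by
  ext x
  let l : Module.Dual k (translates f) :=
    { toFun := fun h => ((h : coordRing k G) : G → k) x
      map_add' := fun _ _ => rfl
      map_smul' := fun _ _ => rfl }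
  have h1 : l (derived k (isRegularRep_translatesRep f) D h) = tangent k D (coeff k _ l h) :=
    dual_derivedFun k _ D h l
  change l _ = _
  rw [h1, apply_eq_tangent]
  rfl

variable [CharZero k] [IsAlgClosed k]

/-- An `ad`-nilpotent element of the Lie algebra of a semisimple group acts locally nilpotently on
regular functions. -/
theorem exists_iterate_eq_zero (hG : IsSemisimple k G) {D : LieAlg k G}
    (hD : IsNilpotent (LieAlgebra.ad k (LieAlg k G) D)) (f : coordRing k G) :
    ∃ N, ∀ n ≥ N, (toDer k G D)^[n] f = 0 := by
  have := hasTrivialRadical hG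
  -- The right translates of `f` span a finite-dimensional representation, on which `D` acts as `ρ
  -- D`; `ad`-nilpotent elements are nilpotent in every such representation.
  let ρ := derived k (isRegularRep_translatesRep f)
  obtain ⟨N, hN'⟩ := isNilpotent_of_isNilpotent_ad (V := translates f) ρ hD
  let f' : translates f := ⟨f, Submodule.subset_span ⟨1, rightTrans_one k f⟩⟩
  have hpow : ∀ n, ((ρ D ^ n) f' : coordRing k G) = (toDer k G D)^[n] f := by
    intro n
    induction n with
    | zero => rfl
    | succ n ih =>
      rw [pow_succ', Module.End.mul_apply, derived_translatesRep, ih, Function.iterate_succ_apply']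
  refine ⟨N, fun n hn => ?_⟩
  rw [← hpow, pow_eq_zero_of_le hn hN']
  rfl

/-- Exponentials of `ad`-nilpotent elements are realized by the group. -/
theorem exists_exp (hG : IsSemisimple k G) {D : LieAlg k G}
    (hD : IsNilpotent (LieAlgebra.ad k (LieAlg k G) D)) :
    ∃ g : G, (Ad k g : Module.End k (LieAlg k G)) = nilExp (LieAlgebra.ad k (LieAlg k G) D) := by
  choose N hN using exists_iterate_eq_zero hG hD
  have hpoly : ∀ f, ∃ p : Polynomial k, (p : PowerSeries k) = formalExp D f := by
    intro f
    refine ⟨PowerSeries.trunc (N f) (formalExp D f), ?_⟩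
    ext n
    rw [Polynomial.coeff_coe, PowerSeries.coeff_trunc]
    split_ifs with h
    · rfl
    · rw [coeff_formalExp, hN f n (not_lt.1 h)]
      simp
  choose p hp using hpoly
  have hinj : Function.Injective ((↑) : Polynomial k → PowerSeries k) := Polynomial.coe_injective k
  -- By local nilpotency the formal one-parameter subgroup takes values in polynomials, so it can be
  -- evaluated at `t = 1`. The resulting character is a point of `G`, the exponential of `D`.
  let χ : coordRing k G →ₐ[k] k := AlgHom.comp (Polynomial.aeval (1 : k))
    { toFun := p
      map_one' := hinj (by rw [hp, map_one, Polynomial.coe_one])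
      map_mul' := fun f g => hinj (by rw [hp, map_mul, Polynomial.coe_mul, hp, hp])
      map_zero' := hinj (by rw [hp, map_zero, Polynomial.coe_zero])
      map_add' := fun f g => hinj (by rw [hp, map_add, Polynomial.coe_add, hp, hp])
      commutes' := fun c => hinj (by
        rw [hp, AlgHom.commutes]
        exact (Polynomial.coe_C c).symm) }
  have hχ : ∀ f, χ f = (p f).eval 1 := fun f => by
    change Polynomial.aeval (1 : k) (p f) = _
    rw [Polynomial.coe_aeval_eq_eval]
  obtain ⟨g, hg⟩ := AffineAlgGroup.exists_point χ
  refine ⟨g, LinearMap.ext fun E => dual_ext k fun l => ?_⟩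
  have h1 : l (Ad k g E) = (p (coeff k (isRegularRep_Ad k) l E)).eval 1 := by
    rw [← hχ, hg]
    rfl
  have hder : derived k (isRegularRep_Ad k) D = LieAlgebra.ad k (LieAlg k G) D :=
    LinearMap.ext fun E => derived_Ad D E
  have hcoef : ∀ n, (p (coeff k (isRegularRep_Ad k) l E)).coeff n =
      (n.factorial : k)⁻¹ * l ((LieAlgebra.ad k (LieAlg k G) D ^ n) E) := by
    intro n
    rw [← Polynomial.coeff_coe, hp, coeff_formalExp, iterate_toDer_coeff, hder, coeff_apply,
      map_one, Module.End.one_apply]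
  -- The second alternative covers nilpotency class `0`, that is, a zero Lie algebra, where no
  -- degree is small enough.
  have hdeg : (p (coeff k (isRegularRep_Ad k) l E)).natDegree <
      nilpotencyClass (LieAlgebra.ad k (LieAlg k G) D) ∨
      p (coeff k (isRegularRep_Ad k) l E) = 0 := by
    by_contra! h
    refine h.2 (Polynomial.leadingCoeff_eq_zero.1 ?_)
    rw [Polynomial.leadingCoeff, hcoef, pow_eq_zero_of_le h.1 (pow_nilpotencyClass hD)]
    simp
  rw [h1, nilExp, LinearMap.sum_apply, map_sum]
  rcases hdeg with hdeg | hdeg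
  · rw [Polynomial.eval_eq_sum_range' hdeg]
    refine Finset.sum_congr rfl fun n _ => ?_
    rw [hcoef]
    simp
  · rw [hdeg, Polynomial.eval_zero]
    symm
    refine Finset.sum_eq_zero fun n _ => ?_
    have := hcoef n
    rw [hdeg, Polynomial.coeff_zero] at this
    simpa using this.symm

/-- Every inner automorphism of the Lie algebra of a semisimple group is given by the adjoint
action of an element of the group. -/
theorem exists_Ad_eq_of_isInnerAut (hG : IsSemisimple k G) {α : LieAlg k G ≃ₗ⁅k⁆ LieAlg k G}
    (hα : IsInnerAut α) : ∃ g : G, ∀ x, Ad k g x = α x := by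
  have h : ∀ φ ∈ Submonoid.closure {φ : Module.End k (LieAlg k G) | ∃ x : LieAlg k G,
      IsNilpotent (LieAlgebra.ad k (LieAlg k G) x) ∧
        φ = nilExp (LieAlgebra.ad k (LieAlg k G) x)}, ∃ g : G, Ad k g = φ := by
    intro φ hφ
    induction hφ using Submonoid.closure_induction with
    | mem φ hφ =>
      obtain ⟨x, hx, rfl⟩ := hφ
      exact exists_exp hG hx
    | one => exact ⟨1, map_one _⟩
    | mul φ ψ _ _ h1 h2 =>
      obtain ⟨g, rfl⟩ := h1
      obtain ⟨h, rfl⟩ := h2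
      exact ⟨g * h, map_mul _ _ _⟩
  obtain ⟨g, hg⟩ := h _ hα
  exact ⟨g, fun x => LinearMap.congr_fun hg x⟩

end Inner

/-! ### Tori -/

section Torus

variable {k : Type*} [Field k]

theorem isRegularMap_adjoin {X Y : Type*} {A : Subalgebra k (X → k)} {S : Set (Y → k)} {φ : X → Y}
    (h : ∀ f ∈ S, (fun x => f (φ x)) ∈ A) : IsRegularMap A (Algebra.adjoin k S) φ := by
  intro f hf
  induction hf using Algebra.adjoin_induction with
  | mem f hf => exact h f hf
  | algebraMap c => exact A.algebraMap_mem c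
  | add f g _ _ hf hg => exact A.add_mem hf hg
  | mul f g _ _ hf hg => exact A.mul_mem hf hg

theorem mem_restrictCoord {X : Type*} {A : Subalgebra k (X → k)} {S : Set X} {f : S → k} :
    f ∈ restrictCoord A S ↔ ∃ F ∈ A, ∀ s : S, F s = f s := by
  rw [restrictCoord, Subalgebra.mem_map]
  constructor
  · rintro ⟨F, hF, rfl⟩
    exact ⟨F, hF, fun s => rfl⟩
  · rintro ⟨F, hF, h⟩
    exact ⟨F, hF, funext h⟩

theorem coe_mem_torusCoord {r : ℕ} (i : Fin r) :
    (fun t : Fin r → kˣ => (t i : k)) ∈ torusCoord k r :=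
  Algebra.subset_adjoin (Or.inl ⟨i, rfl⟩)

theorem inv_mem_torusCoord {r : ℕ} (i : Fin r) :
    (fun t : Fin r → kˣ => (((t i)⁻¹ : kˣ) : k)) ∈ torusCoord k r :=
  Algebra.subset_adjoin (Or.inr ⟨i, rfl⟩)

variable {G : Type*} [Group G]

/-- A subgroup is a torus if and only if it has a regular parametrization whose parameters are
regular functions. -/
theorem isTorusOfRank_iff {A : Subalgebra k (G → k)} {H : Subgroup G} {r : ℕ} :
    IsTorusOfRank A H r ↔ ∃ T : (Fin r → kˣ) →* G, T.range = H ∧ IsRegularMap (torusCoord k r) A T ∧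
      ∀ i, (∃ F ∈ A, ∀ t, F (T t) = t i) ∧ ∃ F ∈ A, ∀ t, F (T t) = ((t i)⁻¹ : kˣ) := by
  constructor
  · rintro ⟨φ, h1, h2⟩
    refine ⟨H.subtype.comp φ.symm.toMonoidHom, ?_, fun f hf => ?_, fun i => ⟨?_, ?_⟩⟩
    · ext g
      constructor
      · rintro ⟨t, rfl⟩
        exact (φ.symm t).2
      · intro hg
        exact ⟨φ ⟨g, hg⟩, by simp⟩
    · exact h2 (fun s => f s) (mem_restrictCoord.2 ⟨f, hf, fun _ => rfl⟩)
    · obtain ⟨F, hF, h⟩ := mem_restrictCoord.1 (h1 _ (coe_mem_torusCoord i))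
      refine ⟨F, hF, fun t => ?_⟩
      have := h (φ.symm t)
      simpa using this
    · obtain ⟨F, hF, h⟩ := mem_restrictCoord.1 (h1 _ (inv_mem_torusCoord i))
      refine ⟨F, hF, fun t => ?_⟩
      have := h (φ.symm t)
      simpa using this
  · rintro ⟨T, rfl, hT, hF⟩
    have hinj : Function.Injective T := by
      intro s t hst
      funext i
      obtain ⟨⟨F, -, h⟩, -⟩ := hF i
      exact Units.ext (by rw [← h, ← h, hst])
    let ψ : (Fin r → kˣ) ≃* T.range := MonoidHom.ofInjective hinj
    have hψ : ∀ t, (ψ t : G) = T t := fun t => rfl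
    refine ⟨ψ.symm, isRegularMap_adjoin ?_, fun f hf => ?_⟩
    · rintro _ (⟨i, rfl⟩ | ⟨i, rfl⟩)
      · obtain ⟨⟨F, hFA, h⟩, -⟩ := hF i
        refine mem_restrictCoord.2 ⟨F, hFA, fun s => ?_⟩
        obtain ⟨t, rfl⟩ := ψ.surjective s
        rw [hψ, h, MulEquiv.symm_apply_apply]
      · obtain ⟨-, ⟨F, hFA, h⟩⟩ := hF i
        refine mem_restrictCoord.2 ⟨F, hFA, fun s => ?_⟩
        obtain ⟨t, rfl⟩ := ψ.surjective s
        rw [hψ, h, MulEquiv.symm_apply_apply]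
    · obtain ⟨F, hFA, h⟩ := mem_restrictCoord.1 hf
      have h1 := hT F hFA
      have h2 : (fun t => f (ψ t)) = fun t => F (T t) := funext fun t => (h (ψ t)).symm
      change (fun t => f (ψ t)) ∈ _
      rwa [h2]

/-- The product of two tori is a torus. -/
theorem IsTorusOfRank.prod {G' : Type*} [Group G'] {A : Subalgebra k (G → k)}
    {B : Subalgebra k (G' → k)} {H : Subgroup G} {K : Subgroup G'} {r s : ℕ}
    (hH : IsTorusOfRank A H r) (hK : IsTorusOfRank B K s) :
    IsTorusOfRank (prodCoord A B) (H.prod K) (r + s) := by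
  rw [isTorusOfRank_iff] at hH hK ⊢
  obtain ⟨T, rfl, hT, hTF⟩ := hH
  obtain ⟨T', rfl, hT', hTF'⟩ := hK
  let p₁ : (Fin (r + s) → kˣ) →* (Fin r → kˣ) :=
    { toFun := fun t i => t (Fin.castAdd s i), map_one' := rfl, map_mul' := fun _ _ => rfl }
  let p₂ : (Fin (r + s) → kˣ) →* (Fin s → kˣ) :=
    { toFun := fun t i => t (Fin.natAdd r i), map_one' := rfl, map_mul' := fun _ _ => rfl }
  have hp₁ : IsRegularMap (torusCoord k (r + s)) (torusCoord k r) p₁ := isRegularMap_adjoin (by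
    rintro _ (⟨i, rfl⟩ | ⟨i, rfl⟩)
    · exact coe_mem_torusCoord _
    · exact inv_mem_torusCoord _)
  have hp₂ : IsRegularMap (torusCoord k (r + s)) (torusCoord k s) p₂ := isRegularMap_adjoin (by
    rintro _ (⟨i, rfl⟩ | ⟨i, rfl⟩)
    · exact coe_mem_torusCoord _
    · exact inv_mem_torusCoord _)
  refine ⟨(T.comp p₁).prod (T'.comp p₂), ?_, isRegularMap_adjoin ?_, fun i => ?_⟩
  · ext ⟨g, g'⟩
    rw [Subgroup.mem_prod]
    constructor
    · rintro ⟨t, ht⟩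
      exact ⟨⟨p₁ t, congrArg Prod.fst ht⟩, ⟨p₂ t, congrArg Prod.snd ht⟩⟩
    · rintro ⟨⟨t, rfl⟩, ⟨t', rfl⟩⟩
      refine ⟨Fin.append t t', Prod.ext ?_ ?_⟩
      · change T (p₁ (Fin.append t t')) = T t
        congr 1
        funext i
        exact Fin.append_left t t' i
      · change T' (p₂ (Fin.append t t')) = T' t'
        congr 1
        funext i
        exact Fin.append_right t t' i
  · rintro _ (⟨f, hf, rfl⟩ | ⟨f, hf, rfl⟩)
    · exact hp₁ _ (hT f hf)
    · exact hp₂ _ (hT' f hf)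
  · have hA : ∀ F ∈ A, (fun p : G × G' => F p.1) ∈ prodCoord A B := fun F hF =>
      Algebra.subset_adjoin (Or.inl ⟨F, hF, rfl⟩)
    have hB : ∀ F ∈ B, (fun p : G × G' => F p.2) ∈ prodCoord A B := fun F hF =>
      Algebra.subset_adjoin (Or.inr ⟨F, hF, rfl⟩)
    induction i using Fin.addCases with
    | left i =>
      obtain ⟨⟨F, hF, h⟩, ⟨F', hF', h'⟩⟩ := hTF i
      exact ⟨⟨_, hA F hF, fun t => h (p₁ t)⟩, ⟨_, hA F' hF', fun t => h' (p₁ t)⟩⟩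
    | right i =>
      obtain ⟨⟨F, hF, h⟩, ⟨F', hF', h'⟩⟩ := hTF' i
      exact ⟨⟨_, hB F hF, fun t => h (p₂ t)⟩, ⟨_, hB F' hF', fun t => h' (p₂ t)⟩⟩

/-- Clearing denominators by a power of the product of all coordinates turns a Laurent polynomial
into a polynomial. -/
theorem exists_mvPolynomial_of_mem_torusCoord {r : ℕ} {f : (Fin r → kˣ) → k}
    (hf : f ∈ torusCoord k r) : ∃ (N : ℕ) (P : MvPolynomial (Fin r) k),
      ∀ t, f t * (∏ i, (t i : k)) ^ N = MvPolynomial.eval (fun i => (t i : k)) P := by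
  classical
  induction hf using Algebra.adjoin_induction with
  | mem f hf =>
    rcases hf with ⟨i, rfl⟩ | ⟨i, rfl⟩
    · exact ⟨0, MvPolynomial.X i, fun t => by simp⟩
    · refine ⟨1, ∏ j ∈ Finset.univ.erase i, MvPolynomial.X j, fun t => ?_⟩
      rw [map_prod, pow_one, ← Finset.mul_prod_erase _ _ (Finset.mem_univ i)]
      simp
  | algebraMap c => exact ⟨0, MvPolynomial.C c, fun t => by simp⟩
  | add f g _ _ hf hg =>
    obtain ⟨N, P, hP⟩ := hf
    obtain ⟨M, Q, hQ⟩ := hg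
    refine ⟨N + M, P * (∏ i, MvPolynomial.X i) ^ M + Q * (∏ i, MvPolynomial.X i) ^ N, fun t => ?_⟩
    simp only [map_add, map_mul, map_pow, map_prod, MvPolynomial.eval_X, ← hP, ← hQ, Pi.add_apply]
    ring
  | mul f g _ _ hf hg =>
    obtain ⟨N, P, hP⟩ := hf
    obtain ⟨M, Q, hQ⟩ := hg
    refine ⟨N + M, P * Q, fun t => ?_⟩
    simp only [map_mul, ← hP, ← hQ, Pi.mul_apply]
    ring

/-- The torus is even irreducible: over an infinite field the product of two nonzero polynomials and
all coordinates is nonzero at some point, which lies in the torus and in both given open sets. -/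
theorem isZariskiConnected_torusCoord [Infinite k] (r : ℕ) :
    IsZariskiConnected (torusCoord k r) (Set.univ : Set (Fin r → kˣ)) := by
  let _ := zariski (torusCoord k r)
  refine ⟨⟨1, trivial⟩, IsPreirreducible.isPreconnected ?_⟩
  rintro U V hU hV ⟨x, -, hx⟩ ⟨y, -, hy⟩
  obtain ⟨_, ⟨f, hf, rfl⟩, hxf, hfU⟩ :=
    (isTopologicalBasis_zariski (torusCoord k r)).exists_subset_of_mem_open hx hU
  obtain ⟨_, ⟨g, hg, rfl⟩, hyg, hgV⟩ :=
    (isTopologicalBasis_zariski (torusCoord k r)).exists_subset_of_mem_open hy hV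
  obtain ⟨N, P, hP⟩ := exists_mvPolynomial_of_mem_torusCoord hf
  obtain ⟨M, Q, hQ⟩ := exists_mvPolynomial_of_mem_torusCoord hg
  have hprod : ∀ (t : Fin r → kˣ) (n : ℕ), (∏ i, (t i : k)) ^ n ≠ 0 := fun t n =>
    pow_ne_zero _ (Finset.prod_ne_zero_iff.2 fun i _ => (t i).ne_zero)
  have hP0 : P ≠ 0 := fun h => mul_ne_zero hxf (hprod x N) (by rw [hP, h, map_zero])
  have hQ0 : Q ≠ 0 := fun h => mul_ne_zero hyg (hprod y M) (by rw [hQ, h, map_zero])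
  have hX0 : (∏ i : Fin r, (MvPolynomial.X i : MvPolynomial (Fin r) k)) ≠ 0 :=
    Finset.prod_ne_zero_iff.2 fun i _ => MvPolynomial.X_ne_zero i
  obtain ⟨z, hz⟩ : ∃ z, MvPolynomial.eval z (P * Q * ∏ i, MvPolynomial.X i) ≠ 0 := by
    by_contra! h
    exact mul_ne_zero (mul_ne_zero hP0 hQ0) hX0 (MvPolynomial.funext fun z => by rw [h, map_zero])
  rw [map_mul, map_mul, map_prod] at hz
  simp only [MvPolynomial.eval_X] at hz
  have hz0 : ∀ i, z i ≠ 0 := fun i =>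
    Finset.prod_ne_zero_iff.1 (right_ne_zero_of_mul hz) i (Finset.mem_univ i)
  let t : Fin r → kˣ := fun i => Units.mk0 (z i) (hz0 i)
  have hPQ := left_ne_zero_of_mul hz
  refine ⟨t, trivial, hfU ?_, hgV ?_⟩
  · exact left_ne_zero_of_mul (a := f t) (b := _) (by rw [hP t]; exact left_ne_zero_of_mul hPQ)
  · exact left_ne_zero_of_mul (a := g t) (b := _) (by rw [hQ t]; exact right_ne_zero_of_mul hPQ)

/-- A torus is connected. -/
theorem IsTorusOfRank.isZariskiConnected [Infinite k] {A : Subalgebra k (G → k)} {H : Subgroup G}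
    {r : ℕ} (h : IsTorusOfRank A H r) : IsZariskiConnected A (H : Set G) := by
  obtain ⟨T, rfl, hT, -⟩ := isTorusOfRank_iff.1 h
  rw [MonoidHom.coe_range, ← Set.image_univ]
  let _ := zariski A
  let _ := zariski (torusCoord k r)
  exact IsConnected.image (isZariskiConnected_torusCoord r) T hT.continuous.continuousOn

/-- The group of automorphisms of `V = ⨁ c, M c` acting by scalars on the summands, with equal
scalars on the summands in each fibre of `q`, is a torus. -/
theorem isTorusOfRank_of_decomposition {V C ι : Type*} [AddCommGroup V] [Module k V] [Finite C]
    [Fintype ι] {M : C → Submodule k V} (hind : iSupIndep M) (htop : ⨆ c, M c = ⊤)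
    (hne : ∀ c, M c ≠ ⊥) {q : C → ι} (hq : Function.Surjective q)
    {H : Subgroup (LinearMap.GeneralLinearGroup k V)}
    (hH : ∀ t, t ∈ H ↔ ∃ a : ι → kˣ, ∀ c, ∀ v ∈ M c, t.1 v = (a (q c) : k) • v) :
    IsTorusOfRank (glCoord k V) H (Fintype.card ι) := by
  classical
  have := Fintype.ofFinite C
  have hext : ∀ f g : Module.End k V, (∀ c, ∀ v ∈ M c, f v = g v) → f = g := by
    intro f g h
    have : ⨆ c, M c ≤ LinearMap.eqLocus f g := iSup_le fun c v hv => h c v hv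
    rw [htop] at this
    exact LinearMap.ext fun v => this Submodule.mem_top
  have hcompl : ∀ c, IsCompl (M c) (⨆ d ≠ c, M d) := by
    refine fun c => ⟨hind c, codisjoint_iff_le_sup.2 ?_⟩
    rw [← htop]
    refine iSup_le fun d => ?_
    by_cases h : d = c
    · rw [h]; exact le_sup_left
    · exact le_sup_of_le_right (le_iSup₂_of_le d h le_rfl)
  let π : C → Module.End k V := fun c =>
    (M c).subtype ∘ₗ (M c).projectionOnto _ (hcompl c)
  have hπ : ∀ c, ∀ v ∈ M c, π c v = v := fun c v hv =>
    congrArg Subtype.val (Submodule.projectionOnto_apply_left (hcompl c) ⟨v, hv⟩)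
  have hπ' : ∀ c d, d ≠ c → ∀ v ∈ M d, π c v = 0 := by
    intro c d hd v hv
    have : v ∈ ⨆ d ≠ c, M d := (le_iSup₂_of_le (f := fun d (_ : d ≠ c) => M d) d hd le_rfl) hv
    have h0 := (Submodule.projectionOnto_apply_eq_zero_iff (hcompl c)).2 this
    change ((M c).projectionOnto _ (hcompl c) v : V) = 0
    rw [h0]; rfl
  let e : Fin (Fintype.card ι) ≃ ι := (Fintype.equivFin ι).symm
  -- The diagonal automorphism with scalar `t (q c)` on `M c`, up to the enumeration `e` of `ι`.
  let S : (Fin (Fintype.card ι) → kˣ) → Module.End k V := fun t =>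
    ∑ c, (t (e.symm (q c)) : k) • π c
  have hS : ∀ t c, ∀ v ∈ M c, S t v = (t (e.symm (q c)) : k) • v := by
    intro t c v hv
    simp only [S, LinearMap.sum_apply, LinearMap.smul_apply]
    rw [Finset.sum_eq_single c]
    · rw [hπ c v hv]
    · intro d _ hd
      rw [hπ' d c hd.symm v hv, smul_zero]
    · simp
  have hSmul : ∀ s t, S (s * t) = S s * S t := fun s t => hext _ _ fun c v hv => by
    rw [Module.End.mul_apply, hS t c v hv, map_smul, hS s c v hv, hS (s * t) c v hv, smul_smul,
      Pi.mul_apply, Units.val_mul, mul_comm]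
  have hSone : S 1 = 1 := hext _ _ fun c v hv => by
    rw [hS 1 c v hv]; simp
  let T : (Fin (Fintype.card ι) → kˣ) →* LinearMap.GeneralLinearGroup k V :=
    { toFun := fun t => ⟨S t, S t⁻¹, by rw [← hSmul, mul_inv_cancel, hSone],
        by rw [← hSmul, inv_mul_cancel, hSone]⟩
      map_one' := Units.ext hSone
      map_mul' := fun s t => Units.ext (hSmul s t) }
  have hT : ∀ t, (T t).1 = S t := fun t => rfl
  have hTinv : ∀ t, ((T t)⁻¹).1 = S t⁻¹ := fun t => rfl
  rw [isTorusOfRank_iff]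
  refine ⟨T, ?_, isRegularMap_adjoin ?_, fun i => ?_⟩
  · ext g
    rw [hH]
    constructor
    · rintro ⟨t, rfl⟩
      exact ⟨fun i => t (e.symm i), fun c v hv => hS t c v hv⟩
    · rintro ⟨a, ha⟩
      refine ⟨fun i => a (e i), Units.ext (hext _ _ fun c v hv => ?_)⟩
      rw [hT, ha c v hv, hS (fun i => a (e i)) c v hv, Equiv.apply_symm_apply]
  · have key : ∀ (l : Module.Dual k V) (v : V) (t : Fin (Fintype.card ι) → kˣ),
        l (S t v) = ∑ c, l (π c v) * (t (e.symm (q c)) : k) := by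
      intro l v t
      simp [S, LinearMap.sum_apply, mul_comm]
    rintro _ (⟨l, v, rfl⟩ | ⟨l, v, rfl⟩)
    · have h1 : (fun t => l ((T t).1 v)) = ∑ c, l (π c v) •
          fun t : Fin (Fintype.card ι) → kˣ => (t (e.symm (q c)) : k) := by
        funext t
        rw [hT, key]
        simp
      rw [h1]
      exact Subalgebra.sum_mem _ fun c _ => Subalgebra.smul_mem _ (coe_mem_torusCoord _) _
    · have h1 : (fun t => l (((T t)⁻¹).1 v)) = ∑ c, l (π c v) •
          fun t : Fin (Fintype.card ι) → kˣ => (((t (e.symm (q c)))⁻¹ : kˣ) : k) := by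
        funext t
        rw [hTinv, key]
        simp
      rw [h1]
      exact Subalgebra.sum_mem _ fun c _ => Subalgebra.smul_mem _ (inv_mem_torusCoord _) _
  -- Each parameter is recovered as a matrix coefficient on a nonzero vector of a summand over it;
  -- surjectivity of `q` and nonzero summands are needed here.
  · obtain ⟨c, hc⟩ := hq (e i)
    obtain ⟨v, hv, hv0⟩ := (Submodule.ne_bot_iff _).1 (hne c)
    obtain ⟨l, hl⟩ := Module.Projective.exists_dual_eq_one k hv0
    have hi : e.symm (q c) = i := by rw [hc, Equiv.symm_apply_apply]
    refine ⟨⟨_, Algebra.subset_adjoin (Or.inl ⟨l, v, rfl⟩), fun t => ?_⟩,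
      ⟨_, Algebra.subset_adjoin (Or.inr ⟨l, v, rfl⟩), fun t => ?_⟩⟩
    · change l (S t v) = _
      rw [hS t c v hv, map_smul, hl, hi, smul_eq_mul, mul_one]
    · change l (S t⁻¹ v) = _
      rw [hS t⁻¹ c v hv, map_smul, hl, hi, smul_eq_mul, mul_one, Pi.inv_apply]

/-- The group of scalars is a torus of rank one. -/
theorem isTorusOfRank_scalars {V : Type*} [AddCommGroup V] [Module k V] [Nontrivial V] :
    IsTorusOfRank (glCoord k V) (scalars k V) 1 := by
  have h := isTorusOfRank_of_decomposition (k := k) (V := V) (C := Unit) (ι := Unit)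
    (M := fun _ => ⊤) (q := id) (H := scalars k V) ?_ ?_ ?_ Function.surjective_id ?_
  · simpa using h
  · exact iSupIndep_subsingleton _
  · simp
  · intro _; exact top_ne_bot
  · intro t
    constructor
    · rintro ⟨c, rfl⟩
      exact ⟨fun _ => c, fun _ v _ => rfl⟩
    · rintro ⟨a, ha⟩
      exact ⟨a (), Units.ext (LinearMap.ext fun v => (ha () v Submodule.mem_top).symm)⟩

end Torus

/-! ### Isotypic components and the center of the endomorphism algebra -/

section Isotypic

variable {k : Type*} [Field k]

section Module

variable {R M : Type*} [Ring R] [Algebra k R] [AddCommGroup M] [Module k M] [Module R M]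
  [IsScalarTower k R M]

/-- An endomorphism of a semisimple module that commutes with all endomorphisms is a scalar on every
isotypic component. -/
theorem exists_scalar_of_commute [IsAlgClosed k] [FiniteDimensional k M] [IsSemisimpleModule R M]
    (t : Module.End R M) (ht : ∀ (s : Module.End R M) (v : M), t (s v) = s (t v))
    {c : Submodule R M} (hc : c ∈ isotypicComponents R M) :
    ∃ a : k, ∀ v ∈ c, t v = a • v := by
  obtain ⟨S, hS, rfl⟩ := hc
  obtain ⟨q, hq⟩ := exists_isCompl S
  set p : M →ₗ[R] S := Submodule.projectionOnto S q hq with hp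
  have hpS : ∀ v : S, p v = v := fun v => Submodule.projectionOnto_apply_left hq v
  -- Commuting with the projection onto `S`, `t` preserves `S` and so has an eigenvector there. By
  -- simplicity of `S` the eigenspace, a submodule, contains all of `S`.
  have htS : ∀ v : S, t v = (p (t v) : S) := fun v => by
    have := ht (S.subtype ∘ₗ p) v
    simpa [hpS] using this
  have : Nontrivial S := IsSimpleModule.nontrivial R S
  have : FiniteDimensional k (S.restrictScalars k) := inferInstance
  have : FiniteDimensional k S := this
  let T : Module.End k S := (p ∘ₗ t ∘ₗ S.subtype).restrictScalars k
  obtain ⟨a, ha⟩ := Module.End.exists_eigenvalue T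
  obtain ⟨v, hv⟩ := ha.exists_hasEigenvector
  let N : Submodule R M :=
    { carrier := {v | t v = a • v}
      add_mem' := fun {x y} hx hy => by
        change t (x + y) = _; rw [map_add, hx, hy, smul_add]
      zero_mem' := by simp
      smul_mem' := fun r x hx => by
        change t (r • x) = _; rw [map_smul, hx, smul_comm] }
  have hSN : S ≤ N := by
    rcases (isSimpleModule_iff_isAtom.1 hS).le_iff.1 (inf_le_left : S ⊓ N ≤ S) with h | h
    · exfalso
      apply hv.2
      have h1 : (v : M) ∈ S ⊓ N := by
        refine ⟨v.2, ?_⟩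
        change t v = a • (v : M)
        rw [htS]
        exact congrArg Subtype.val hv.apply_eq_smul
      rw [h] at h1
      exact Subtype.ext ((Submodule.mem_bot R).1 h1)
    · exact inf_eq_left.1 h
  refine ⟨a, fun v hv => ?_⟩
  suffices isotypicComponent R M S ≤ N from this hv
  refine sSup_le ?_
  rintro m ⟨e⟩ w hw
  -- A submodule `m` isomorphic to `S` is the image of `S` under an endomorphism of `M`; commuting
  -- with it carries the scalar from `S` to `m`.
  have h1 := ht (m.subtype ∘ₗ (e.symm : S →ₗ[R] m) ∘ₗ p) (e ⟨w, hw⟩)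
  have h2 : t (e ⟨w, hw⟩) = a • ((e ⟨w, hw⟩ : S) : M) := hSN (e ⟨w, hw⟩).2
  rw [h2, LinearMap.map_smul_of_tower] at h1
  change t w = a • w
  simpa [hpS] using h1

/-- An additive property that holds on the isotypic components of a semisimple module holds
everywhere. -/
theorem isotypic_induction [IsSemisimpleModule R M] {p : M → Prop} (v : M)
    (h : ∀ c ∈ isotypicComponents R M, ∀ v ∈ c, p v) (h0 : p 0)
    (hadd : ∀ v w, p v → p w → p (v + w)) : p v := by
  have hv : v ∈ ⨆ c : isotypicComponents R M, (c : Submodule R M) := by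
    rw [← sSup_eq_iSup', sSup_isotypicComponents]; trivial
  exact Submodule.iSup_induction _ (motive := p) hv (fun c x hx => h c c.2 x hx) h0 hadd

end Module

variable {G V : Type*} [Group G] [AddCommGroup V] [Module k V] (ρ : Representation k G V)

theorem mem_endAlg_iff {t : Module.End k V} :
    t ∈ endAlg k ρ ↔ ∀ g v, t (ρ g v) = ρ g (t v) := by
  rw [endAlg, Subalgebra.mem_centralizer_iff]
  simp only [Set.forall_mem_range]
  exact forall_congr' fun g => ⟨fun h v => (LinearMap.congr_fun h v).symm,
    fun h => LinearMap.ext fun v => (h v).symm⟩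

/-- An endomorphism of a representation as an endomorphism of the module over the group algebra. -/
def toModuleEnd (t : endAlg k ρ) : Module.End (MonoidAlgebra k G) ρ.asModule where
  toFun v := ρ.asModuleEquiv.symm (t.1 (ρ.asModuleEquiv v))
  map_add' v w := by simp
  map_smul' r v := by
    apply ρ.asModuleEquiv.injective
    simp only [Representation.asModuleEquiv_map_smul, LinearEquiv.apply_symm_apply, RingHom.id_apply]
    have : t.1 * ρ.asAlgebraHom r = ρ.asAlgebraHom r * t.1 := by
      induction r using MonoidAlgebra.induction_linear with
      | zero => simp
      | add f g hf hg => rw [map_add, mul_add, add_mul, hf, hg]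
      | single g a =>
        rw [Representation.asAlgebraHom_single, mul_smul_comm, smul_mul_assoc]
        congr 1
        exact LinearMap.ext ((mem_endAlg_iff ρ).1 t.2 g)
    exact LinearMap.congr_fun this _

/-- An endomorphism of the module over the group algebra as an endomorphism of the representation. -/
def ofModuleEnd (s : Module.End (MonoidAlgebra k G) ρ.asModule) : endAlg k ρ :=
  ⟨ρ.asModuleEquiv.toLinearMap ∘ₗ (s.restrictScalars k) ∘ₗ ρ.asModuleEquiv.symm.toLinearMap, by
    rw [mem_endAlg_iff]
    intro g v
    simp only [LinearMap.comp_apply, LinearEquiv.coe_coe, LinearMap.restrictScalars_apply,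
      Representation.asModuleEquiv_symm_map_rho, map_smul, Representation.asModuleEquiv_map_smul,
      Representation.asAlgebraHom_of]⟩

theorem ofModuleEnd_apply (s : Module.End (MonoidAlgebra k G) ρ.asModule) (v : V) :
    (ofModuleEnd ρ s).1 v = ρ.asModuleEquiv (s (ρ.asModuleEquiv.symm v)) := rfl

theorem toModuleEnd_apply (t : endAlg k ρ) (v : ρ.asModule) :
    toModuleEnd ρ t v = ρ.asModuleEquiv.symm (t.1 (ρ.asModuleEquiv v)) := rfl

/-- A stable subspace as a submodule over the group algebra. -/
def stableSubmodule (W : Submodule k V) (hW : ∀ g, ∀ w ∈ W, ρ g w ∈ W) :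
    Submodule (MonoidAlgebra k G) ρ.asModule :=
  ρ.mapSubmodule ⟨W, by
    rw [Representation.mem_invtSubmodule]
    intro g w hw
    exact hW g w hw⟩

theorem mem_stableSubmodule {W : Submodule k V} {hW : ∀ g, ∀ w ∈ W, ρ g w ∈ W}
    {v : ρ.asModule} : v ∈ stableSubmodule ρ W hW ↔ ρ.asModuleEquiv v ∈ W := by
  constructor
  · rintro ⟨w, hw, rfl⟩
    simpa using hw
  · intro h
    exact ⟨ρ.asModuleEquiv v, h, by simp⟩

/-- A submodule over the group algebra as a subspace of the representation. -/
def toSubspace (c : Submodule (MonoidAlgebra k G) ρ.asModule) : Submodule k V :=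
  (c.restrictScalars k).map ρ.asModuleEquiv.toLinearMap

theorem mem_toSubspace {c : Submodule (MonoidAlgebra k G) ρ.asModule} {v : V} :
    v ∈ toSubspace ρ c ↔ ρ.asModuleEquiv.symm v ∈ c := by
  rw [toSubspace, Submodule.mem_map_equiv]; rfl

theorem map_mem_toSubspace (c : Submodule (MonoidAlgebra k G) ρ.asModule) (g : G) {v : V}
    (hv : v ∈ toSubspace ρ c) : ρ g v ∈ toSubspace ρ c := by
  rw [mem_toSubspace] at *
  rw [Representation.asModuleEquiv_symm_map_rho]
  exact c.smul_mem _ hv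

/-- The kernel of an equivariant projection is a complement over the group algebra. -/
theorem isSemisimpleModule_asModule
    (hss : ∀ W : Submodule k V, (∀ g, ∀ w ∈ W, ρ g w ∈ W) →
      ∃ p ∈ endAlg k ρ, (∀ v, p v ∈ W) ∧ ∀ w ∈ W, p w = w) :
    IsSemisimpleModule (MonoidAlgebra k G) ρ.asModule := by
  rw [isSemisimpleModule_iff]
  constructor
  intro c
  obtain ⟨p, hp, hpW, hpw⟩ := hss (toSubspace ρ c) fun g w hw => map_mem_toSubspace ρ c g hw
  let f : ρ.asModule →ₗ[MonoidAlgebra k G] c :=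
    (toModuleEnd ρ ⟨p, hp⟩).codRestrict c fun v => (mem_toSubspace ρ).1 (hpW _)
  refine ⟨LinearMap.ker f, LinearMap.isCompl_of_proj (f := f) fun x => ?_⟩
  apply Subtype.ext
  change ρ.asModuleEquiv.symm (p (ρ.asModuleEquiv x)) = _
  rw [hpw _ ((mem_toSubspace ρ).2 (by simp)), LinearEquiv.symm_apply_apply]

theorem iSupIndep_toSubspace : iSupIndep
    fun c : isotypicComponents (MonoidAlgebra k G) ρ.asModule => toSubspace ρ c := by
  have h := sSupIndep_isotypicComponents (MonoidAlgebra k G) ρ.asModule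
  rw [sSupIndep_iff] at h
  have h' := iSupIndep.map_orderIso (Submodule.orderIsoMapComap ρ.asModuleEquiv)
    (a := fun c : isotypicComponents (MonoidAlgebra k G) ρ.asModule =>
      c.1.restrictScalars k) ?_
  · exact h'
  · intro c
    have := h c
    rw [disjoint_iff] at this ⊢
    simp only [← Submodule.restrictScalars_iSup] 
    rw [← Submodule.restrictScalars_inf, this, Submodule.restrictScalars_bot]

theorem iSup_toSubspace [IsSemisimpleModule (MonoidAlgebra k G) ρ.asModule] :
    ⨆ c : isotypicComponents (MonoidAlgebra k G) ρ.asModule, toSubspace ρ c = ⊤ := by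
  rw [eq_top_iff]
  rintro v -
  suffices ∀ v : ρ.asModule, ρ.asModuleEquiv v ∈
      ⨆ c : isotypicComponents (MonoidAlgebra k G) ρ.asModule, toSubspace ρ c by
    simpa using this (ρ.asModuleEquiv.symm v)
  intro v
  refine isotypic_induction (R := MonoidAlgebra k G)
    (p := fun v => ρ.asModuleEquiv v ∈
      ⨆ c : isotypicComponents (MonoidAlgebra k G) ρ.asModule, toSubspace ρ c) v
    (fun c hc v hv => ?_) (by simp)
    (fun v w hv hw => ?_)
  · exact Submodule.mem_iSup_of_mem ⟨c, hc⟩ ((mem_toSubspace ρ).2 (by simpa using hv))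
  · rw [map_add]; exact Submodule.add_mem _ hv hw

theorem toSubspace_ne_bot (c : isotypicComponents (MonoidAlgebra k G) ρ.asModule) :
    toSubspace ρ c ≠ ⊥ := by
  intro h
  apply (bot_lt_isotypicComponents c.2).ne'
  rw [eq_bot_iff]
  intro v hv
  have : ρ.asModuleEquiv v ∈ toSubspace ρ c := (mem_toSubspace ρ).2 (by simpa using hv)
  rw [h, Submodule.mem_bot] at this
  simpa using this

/-- The endomorphisms in the centre of `End_G(V)` are those that are scalars on every isotypic
component. -/
theorem mem_center_endAlg_iff [IsAlgClosed k] [FiniteDimensional k V]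
    [IsSemisimpleModule (MonoidAlgebra k G) ρ.asModule] {t : Module.End k V} :
    (t ∈ endAlg k ρ ∧ ∀ s ∈ endAlg k ρ, Commute t s) ↔
      ∀ c ∈ isotypicComponents (MonoidAlgebra k G) ρ.asModule,
        ∃ a : k, ∀ v ∈ toSubspace ρ c, t v = a • v := by
  constructor
  · rintro ⟨ht, hcomm⟩ c hc
    have : FiniteDimensional k ρ.asModule := inferInstance
    obtain ⟨a, ha⟩ := exists_scalar_of_commute (k := k) (toModuleEnd ρ ⟨t, ht⟩) (fun s v => by
      have := LinearMap.congr_fun (hcomm _ (ofModuleEnd ρ s).2) (ρ.asModuleEquiv v)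
      rw [Module.End.mul_apply, Module.End.mul_apply, ofModuleEnd_apply, ofModuleEnd_apply] at this
      rw [toModuleEnd_apply, toModuleEnd_apply]
      apply ρ.asModuleEquiv.injective
      simpa using this) hc
    refine ⟨a, fun v hv => ?_⟩
    have := ha _ ((mem_toSubspace ρ).1 hv)
    rw [toModuleEnd_apply] at this
    apply ρ.asModuleEquiv.symm.injective
    simpa using this
  · intro h
    -- An endomorphism that is scalar on each isotypic component commutes with whatever preserves
    -- the components. The group does, and so does `End_G(V)`, since isotypic components are fully
    -- invariant.
    have key : ∀ s : Module.End k V,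
        (∀ c ∈ isotypicComponents (MonoidAlgebra k G) ρ.asModule, ∀ v ∈ toSubspace ρ c,
          s v ∈ toSubspace ρ c) → ∀ v, t (s v) = s (t v) := by
      intro s hs v
      suffices ∀ v : ρ.asModule, t (s (ρ.asModuleEquiv v)) = s (t (ρ.asModuleEquiv v)) by
        simpa using this (ρ.asModuleEquiv.symm v)
      intro v
      refine isotypic_induction (R := MonoidAlgebra k G)
        (p := fun v => t (s (ρ.asModuleEquiv v)) = s (t (ρ.asModuleEquiv v))) v
        (fun c hc v hv => ?_) (by simp)
        (fun v w hv hw => by simp [hv, hw])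
      obtain ⟨a, ha⟩ := h c hc
      have hv' : ρ.asModuleEquiv v ∈ toSubspace ρ c := (mem_toSubspace ρ).2 (by simpa using hv)
      rw [ha _ hv', ha _ (hs c hc _ hv'), map_smul]
    refine ⟨(mem_endAlg_iff ρ).2 fun g v =>
      key (ρ g) (fun c _ v hv => map_mem_toSubspace ρ c g hv) v, fun s hs => ?_⟩
    refine LinearMap.ext fun v => key s (fun c hc v hv => ?_) v
    rw [mem_toSubspace] at hv ⊢
    have := Submodule.IsFullyInvariant.of_mem_isotypicComponents hc (toModuleEnd ρ ⟨s, hs⟩) hv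
    simpa [toModuleEnd_apply] using this

/-- The centre of the unit group of `End_G(V)` consists of the units that are central in
`End_G(V)`. -/
theorem mem_center_units_iff [Infinite k] [FiniteDimensional k V]
    {t : LinearMap.GeneralLinearGroup k V} :
    t ∈ (Subgroup.center (endAlg k ρ)ˣ).map (Units.map (endAlg k ρ).val.toMonoidHom) ↔
      t.1 ∈ endAlg k ρ ∧ ∀ s ∈ endAlg k ρ, Commute t.1 s := by
  have hinv : ∀ u : LinearMap.GeneralLinearGroup k V, u.1 ∈ endAlg k ρ →
      (u⁻¹).1 ∈ endAlg k ρ := by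
    intro u hu
    rw [endAlg, Subalgebra.mem_centralizer_iff] at *
    intro g hg
    exact (Commute.units_inv_right (hu g hg) : Commute g (u⁻¹).1)
  constructor
  · rintro ⟨u, hu, rfl⟩
    refine ⟨u.1.2, fun s hs => ?_⟩
    -- For `c` outside the finite spectrum, `c - s` is invertible, and commuting with it is the same
    -- as commuting with `s`.
    obtain ⟨c, hc⟩ := (Module.End.finite_spectrum s).exists_notMem
    rw [spectrum.notMem_iff] at hc
    obtain ⟨w, hw⟩ := hc
    have hwm : w.1 ∈ endAlg k ρ := by
      rw [hw]; exact Subalgebra.sub_mem _ (Subalgebra.algebraMap_mem _ c) hs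
    let w' : (endAlg k ρ)ˣ := ⟨⟨w.1, hwm⟩, ⟨(w⁻¹).1, hinv w hwm⟩,
      Subtype.ext w.mul_inv, Subtype.ext w.inv_mul⟩
    have h1 : Commute (u.1 : endAlg k ρ).1 w.1 := 
      congrArg (fun x : (endAlg k ρ)ˣ => (x.1 : endAlg k ρ).1)
        ((Subgroup.mem_center_iff.1 hu w').symm)
    rw [hw] at h1
    have h2 := (Algebra.commute_algebraMap_right c (u.1 : endAlg k ρ).1).sub_right h1
    simpa using h2
  · rintro ⟨ht, hcomm⟩
    refine ⟨⟨⟨t.1, ht⟩, ⟨(t⁻¹).1, hinv t ht⟩, Subtype.ext t.mul_inv, Subtype.ext t.inv_mul⟩,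
      ?_, Units.ext rfl⟩
    rw [SetLike.mem_coe, Subgroup.mem_center_iff]
    intro w
    exact Units.ext (Subtype.ext (hcomm w.1.1 w.1.2).symm)

end Isotypic

/-! ### Simple ideals as subrepresentations -/

section SimpleFactors

variable {k : Type*} [Field k] {G₀ : Type*} [Group G₀] [AffineAlgGroup k G₀]

theorem commute_derived_of_commute {V : Type*} [AddCommGroup V] [Module k V] [FiniteDimensional k V]
    {ρ : Representation k G₀ V} (hρ : IsRegularRep k ρ) {t : Module.End k V}
    (ht : t ∈ endAlg k ρ) (D : LieAlg k G₀) (v : V) :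
    t (derived k hρ D v) = derived k hρ D (t v) := by
  refine dual_ext k fun l => ?_
  change (l ∘ₗ t) (derivedFun k hρ D v) = l (derivedFun k hρ D (t v))
  rw [dual_derivedFun, dual_derivedFun]
  congr 1
  ext g
  exact congrArg l ((mem_endAlg_iff ρ).1 ht g v)

variable {U₀ : Type*} [AddCommGroup U₀] [Module k U₀]
  {ρ₀ : Representation k G₀ U₀}

theorem rho0'_apply (g : G₀) (v : U₀ × LieAlg k G₀) :
    rho0' k ρ₀ g v = (ρ₀ g v.1, Ad k g v.2) := rfl

theorem rho0'der_apply [FiniteDimensional k U₀] (hρ₀ : IsRegularRep k ρ₀)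
    (x : LieAlg k G₀) (v : U₀ × LieAlg k G₀) :
    rho0'der k hρ₀ x v = (derived k hρ₀ x v.1, ⁅x, v.2⁆) := by
  rw [← derived_Ad]
  exact derived_prod hρ₀ (isRegularRep_Ad k) x v

theorem isSimple_iff_isAtom {L : Type*} [LieRing L] [LieAlgebra k L] [LieAlgebra.IsSemisimple k L]
    {I : LieIdeal k L} : LieAlgebra.IsSimple k I ↔ IsAtom I := by
  refine ⟨fun h => ⟨?_, fun J hJ => ?_⟩, fun h => LieAlgebra.IsSemisimple.isSimple_of_isAtom I h⟩
  · rintro rfl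
    exact h.non_abelian inferInstance
  · rcases h.eq_bot_or_eq_top (J.comap I.incl) with h | h
    · rw [eq_bot_iff]
      intro x hx
      have : (⟨x, hJ.le hx⟩ : I) ∈ J.comap I.incl := hx
      rw [h] at this
      exact congrArg Subtype.val ((LieSubmodule.mem_bot _).1 this)
    · exfalso
      refine hJ.not_ge fun x hx => ?_
      have : (⟨x, hx⟩ : I) ∈ J.comap I.incl := by rw [h]; trivial
      exact this

theorem atom_induction {L : Type*} [LieRing L] [LieAlgebra k L] [LieAlgebra.IsSemisimple k L]
    {p : Submodule k L} (h : ∀ I : LieIdeal k L, IsAtom I → ∀ x ∈ I, x ∈ p) : p = ⊤ := by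
  have h1 := congrArg LieSubmodule.toSubmodule
    (LieAlgebra.IsSemisimple.sSup_atoms_eq_top (R := k) (L := L))
  rw [LieSubmodule.sSup_toSubmodule, LieSubmodule.top_toSubmodule] at h1
  rw [eq_top_iff, ← h1]
  refine sSup_le ?_
  rintro _ ⟨I, hI, rfl⟩
  exact h I hI

variable [CharZero k]

theorem exists_endAlg_projection [IsAlgClosed k] [FiniteDimensional k U₀]
    (hρ₀ : IsRegularRep k ρ₀) (hG₀ : IsSemisimple k G₀) (W : Submodule k (U₀ × LieAlg k G₀))
    (hW : ∀ g, ∀ w ∈ W, rho0' k ρ₀ g w ∈ W) :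
    ∃ p ∈ endAlg k (rho0' k ρ₀), (∀ v, p v ∈ W) ∧ ∀ w ∈ W, p w = w := by
  have := hasTrivialRadical hG₀
  obtain ⟨p, hp, hpW, hpw⟩ := exists_projection (rho0'der k hρ₀) W
    (fun x w hw => derived_mem_of_map_mem _ W hW x hw)
  refine ⟨p, (mem_endAlg_iff _).2 fun g v => ?_, hpW, hpw⟩
  exact commute_of_commute_derived hG₀.connected (hρ₀.prod k (isRegularRep_Ad k)) p hp g v

theorem isSemisimpleModule_rho0' [IsAlgClosed k] [FiniteDimensional k U₀]
    (hρ₀ : IsRegularRep k ρ₀) (hG₀ : IsSemisimple k G₀) :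
    IsSemisimpleModule (MonoidAlgebra k G₀) (rho0' k ρ₀).asModule :=
  isSemisimpleModule_asModule _ (exists_endAlg_projection hρ₀ hG₀)

theorem Ad_mem_ideal (hG₀ : IsSemisimple k G₀) (I : LieIdeal k (LieAlg k G₀)) (g : G₀)
    {x : LieAlg k G₀} (hx : x ∈ I) : Ad k g x ∈ I :=
  map_mem_of_derived_mem hG₀.connected (isRegularRep_Ad k) I.toSubmodule
    (fun D w hw => by rw [derived_Ad]; exact I.lie_mem hw) g hx

variable (ρ₀) in
/-- The submodule of `U₀ ⊕ 𝔤₀` given by an ideal of `𝔤₀`. -/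
def idealSubmodule (hG₀ : IsSemisimple k G₀) (I : LieIdeal k (LieAlg k G₀)) :
    Submodule (MonoidAlgebra k G₀) (rho0' k ρ₀).asModule :=
  stableSubmodule (rho0' k ρ₀) (Submodule.prod ⊥ I.toSubmodule) (by
    rintro g ⟨u, x⟩ ⟨hu, hx⟩
    have hu' : u = 0 := hu
    subst hu'
    exact ⟨by simp [rho0'_apply], Ad_mem_ideal hG₀ I g hx⟩)

theorem mem_idealSubmodule {hG₀ : IsSemisimple k G₀} {I : LieIdeal k (LieAlg k G₀)}
    {v : (rho0' k ρ₀).asModule} : v ∈ idealSubmodule ρ₀ hG₀ I ↔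
      ∃ x ∈ I, (rho0' k ρ₀).asModuleEquiv v = (0, x) := by
  rw [idealSubmodule, mem_stableSubmodule]
  constructor
  · rintro ⟨h1, h2⟩
    exact ⟨_, h2, Prod.ext h1 rfl⟩
  · rintro ⟨x, hx, h⟩
    rw [h]
    exact ⟨rfl, hx⟩

/-- A subrepresentation of `0 ⊕ I` is stable under the derived representation, hence is given by an
ideal of `𝔤₀` contained in `I`. -/
theorem isSimpleModule_idealSubmodule [IsAlgClosed k] [FiniteDimensional k U₀]
    (hρ₀ : IsRegularRep k ρ₀) (hG₀ : IsSemisimple k G₀) {I : LieIdeal k (LieAlg k G₀)}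
    (hI : IsAtom I) : IsSimpleModule (MonoidAlgebra k G₀) (idealSubmodule ρ₀ hG₀ I) := by
  rw [isSimpleModule_iff_isAtom]
  have hle : ∀ J : LieIdeal k (LieAlg k G₀), idealSubmodule ρ₀ hG₀ J = ⊥ → J = ⊥ := by
    intro J hJ
    rw [eq_bot_iff]
    intro x hx
    have : (rho0' k ρ₀).asModuleEquiv.symm (0, x) ∈ idealSubmodule ρ₀ hG₀ J :=
      mem_idealSubmodule.2 ⟨x, hx, by simp⟩
    rw [hJ, Submodule.mem_bot] at this
    have h2 : ((0, x) : U₀ × LieAlg k G₀) = 0 := by simpa using this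
    exact (LieSubmodule.mem_bot x).2 (congrArg Prod.snd h2)
  refine ⟨fun h => hI.1 (hle I h), fun N hN => ?_⟩
  let J : LieIdeal k (LieAlg k G₀) :=
    { (toSubspace (rho0' k ρ₀) N).comap (LinearMap.inr k U₀ (LieAlg k G₀)) with
      lie_mem := by
        intro x y hy
        have h1 : rho0'der k hρ₀ x (0, y) ∈ toSubspace (rho0' k ρ₀) N :=
          derived_mem_of_map_mem _ _ (fun g w hw => map_mem_toSubspace _ N g hw) x hy
        rw [rho0'der_apply, map_zero] at h1
        exact h1 }
  have hJ : ∀ x, x ∈ J ↔ (rho0' k ρ₀).asModuleEquiv.symm (0, x) ∈ N :=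
    fun x => mem_toSubspace _
  have hNJ : N = idealSubmodule ρ₀ hG₀ J := by
    ext v
    rw [mem_idealSubmodule]
    constructor
    · intro hv
      obtain ⟨x, hx, h⟩ := mem_idealSubmodule.1 (hN.le hv)
      refine ⟨x, (hJ x).2 ?_, h⟩
      rw [← h]; simpa using hv
    · rintro ⟨x, hx, h⟩
      have := (hJ x).1 hx
      rw [← h] at this; simpa using this
  have hJI : J < I := by
    refine lt_of_le_of_ne ?_ ?_
    · intro x hx
      obtain ⟨y, hy, h⟩ := mem_idealSubmodule.1 (hN.le ((hJ x).1 hx))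
      have h2 : ((0, x) : U₀ × LieAlg k G₀) = (0, y) := by simpa using h
      rw [show x = y from congrArg Prod.snd h2]; exact hy
    · intro h
      rw [hNJ, h] at hN
      exact lt_irrefl _ hN
  rw [hNJ, hI.2 J hJI, eq_bot_iff]
  intro v hv
  obtain ⟨x, hx, h⟩ := mem_idealSubmodule.1 hv
  rw [(LieSubmodule.mem_bot x).1 hx] at h
  rw [Submodule.mem_bot]
  apply (rho0' k ρ₀).asModuleEquiv.injective
  rw [h, map_zero]; rfl

/-- Equality of the components gives an equivariant isomorphism from `I` to `J`. If `I ≠ J`, then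
`[I, J] ⊆ I ∩ J = 0`, so `I` acts trivially on `J` and therefore on itself. It would be a nonzero
abelian ideal. -/
theorem eq_of_isotypicComponent_eq [IsAlgClosed k] [FiniteDimensional k U₀]
    (hρ₀ : IsRegularRep k ρ₀) (hG₀ : IsSemisimple k G₀) {I J : LieIdeal k (LieAlg k G₀)}
    (hI : IsAtom I) (hJ : IsAtom J)
    (h : isotypicComponent (MonoidAlgebra k G₀) (rho0' k ρ₀).asModule (idealSubmodule ρ₀ hG₀ I) =
      isotypicComponent (MonoidAlgebra k G₀) (rho0' k ρ₀).asModule (idealSubmodule ρ₀ hG₀ J)) :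
    I = J := by
  by_contra hne
  have hrad := hasTrivialRadical hG₀
  have := isSemisimpleModule_rho0' hρ₀ hG₀
  have := isSimpleModule_idealSubmodule hρ₀ hG₀ hI
  have := isSimpleModule_idealSubmodule hρ₀ hG₀ hJ
  obtain ⟨e⟩ := isIsotypicOfType_submodule_iff.1
    (IsIsotypicOfType.isotypicComponent (MonoidAlgebra k G₀) (rho0' k ρ₀).asModule
      (idealSubmodule ρ₀ hG₀ J)) _ ((Submodule.le_isotypicComponent _).trans_eq h)
  obtain ⟨q, hq⟩ := exists_isCompl (idealSubmodule ρ₀ hG₀ I)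
  let f := ofModuleEnd (rho0' k ρ₀) ((idealSubmodule ρ₀ hG₀ J).subtype ∘ₗ e.toLinearMap ∘ₗ
    Submodule.projectionOnto _ q hq)
  have hf : ∀ x (hx : x ∈ I), f.1 (0, x) = (rho0' k ρ₀).asModuleEquiv
      (e ⟨(rho0' k ρ₀).asModuleEquiv.symm (0, x), mem_idealSubmodule.2 ⟨x, hx, by simp⟩⟩) := by
    intro x hx
    have hx' : (rho0' k ρ₀).asModuleEquiv.symm (0, x) ∈ idealSubmodule ρ₀ hG₀ I :=
      mem_idealSubmodule.2 ⟨x, hx, by simp⟩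
    rw [ofModuleEnd_apply]
    simp [Submodule.projectionOnto_apply_of_mem_left hq hx']
  have hdisj : I ⊓ J = ⊥ := (hI.disjoint_of_ne hJ hne).eq_bot
  apply hI.1
  refine LieAlgebra.HasTrivialRadical.eq_bot_of_isSolvable (R := k) I (hI := ?_)
  suffices IsLieAbelian I from inferInstance
  constructor
  intro x y
  have h1 : f.1 (0, ⁅(x : LieAlg k G₀), (y : LieAlg k G₀)⁆) = 0 := by
    have h2 := commute_derived_of_commute (hρ₀.prod k (isRegularRep_Ad k)) f.2 x.1 (0, y.1)
    have h3 : f.1 (rho0'der k hρ₀ x.1 (0, y.1)) = rho0'der k hρ₀ x.1 (f.1 (0, y.1)) := h2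
    rw [rho0'der_apply, map_zero] at h3
    dsimp only at h3
    rw [h3, hf y.1 y.2]
    obtain ⟨z, hz, h4⟩ := mem_idealSubmodule.1
      (e ⟨(rho0' k ρ₀).asModuleEquiv.symm (0, y.1),
        mem_idealSubmodule.2 ⟨y.1, y.2, by simp⟩⟩).2
    rw [h4, rho0'der_apply, map_zero]
    have : ⁅x.1, z⁆ ∈ I ⊓ J := ⟨lie_mem_left k _ I _ _ x.2, J.lie_mem hz⟩
    rw [hdisj, LieSubmodule.mem_bot] at this
    dsimp only
    rw [this]; rfl
  rw [hf _ (I.lie_mem y.2)] at h1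
  have h2 : (0, ⁅(x : LieAlg k G₀), (y : LieAlg k G₀)⁆) = (0 : U₀ × LieAlg k G₀) := by
    simpa using h1
  exact Subtype.ext (congrArg Prod.snd h2)

end SimpleFactors

/-! ### The torus `T'` and its rank -/

section CentralTorus

variable {k : Type*} [Field k] [IsAlgClosed k] {G₀ : Type*} [Group G₀]
  [AffineAlgGroup k G₀] {U₀ : Type*} [AddCommGroup U₀] [Module k U₀] [FiniteDimensional k U₀]
  {ρ₀ : Representation k G₀ U₀}

theorem mem_T'_iff {t : LinearMap.GeneralLinearGroup k (U₀ × LieAlg k G₀)} :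
    t ∈ T' k ρ₀ ↔ (t.1 ∈ endAlg k (rho0' k ρ₀) ∧ ∀ s ∈ endAlg k (rho0' k ρ₀), Commute t.1 s) ∧
      ∃ c : kˣ, ∀ x : LieAlg k G₀, t.1 (0, x) = (c : k) • (0, x) := by
  rw [T', Subgroup.mem_inf, T0', mem_center_units_iff]; rfl

variable [CharZero k]

/-- The isotypic components of `U₀ ⊕ 𝔤₀` that contain a simple ideal of `𝔤₀`. -/
def adjointComponents (hG₀ : IsSemisimple k G₀) (ρ₀ : Representation k G₀ U₀) :
    Set (isotypicComponents (MonoidAlgebra k G₀) (rho0' k ρ₀).asModule) :=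
  {c | ∃ I : LieIdeal k (LieAlg k G₀), IsAtom I ∧
    c.1 = isotypicComponent (MonoidAlgebra k G₀) (rho0' k ρ₀).asModule (idealSubmodule ρ₀ hG₀ I)}

theorem ncard_adjointComponents (hρ₀ : IsRegularRep k ρ₀) (hG₀ : IsSemisimple k G₀) :
    (adjointComponents hG₀ ρ₀).ncard = numSimpleFactors k (LieAlg k G₀) := by
  have := hasTrivialRadical hG₀
  have h1 : Subtype.val '' adjointComponents hG₀ ρ₀ =
      (fun I : LieIdeal k (LieAlg k G₀) => isotypicComponent (MonoidAlgebra k G₀)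
        (rho0' k ρ₀).asModule (idealSubmodule ρ₀ hG₀ I)) '' {I | LieAlgebra.IsSimple k I} := by
    ext c
    constructor
    · rintro ⟨c, ⟨I, hI, hc⟩, rfl⟩
      exact ⟨I, isSimple_iff_isAtom.2 hI, hc.symm⟩
    · rintro ⟨I, hI, rfl⟩
      have hI' := isSimple_iff_isAtom.1 hI
      exact ⟨⟨_, _, isSimpleModule_idealSubmodule hρ₀ hG₀ hI', rfl⟩, ⟨I, hI', rfl⟩, rfl⟩
  rw [← Set.ncard_image_of_injective _ Subtype.val_injective, h1, numSimpleFactors]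
  refine Set.InjOn.ncard_image fun I hI J hJ h => ?_
  exact eq_of_isotypicComponent_eq hρ₀ hG₀ (isSimple_iff_isAtom.1 hI) (isSimple_iff_isAtom.1 hJ) h

theorem adjointComponents_nonempty (hρ₀ : IsRegularRep k ρ₀) (hG₀ : IsSemisimple k G₀)
    [Nontrivial G₀] : (adjointComponents hG₀ ρ₀).Nonempty := by
  have := hasTrivialRadical hG₀
  by_contra hne
  have hno : ∀ I : LieIdeal k (LieAlg k G₀), ¬ IsAtom I := fun I hI =>
    hne ⟨⟨_, _, isSimpleModule_idealSubmodule hρ₀ hG₀ hI, rfl⟩, I, hI, rfl⟩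
  have h := atom_induction (k := k) (L := LieAlg k G₀) (p := ⊥) fun I hI => absurd hI (hno I)
  have : Subsingleton (LieAlg k G₀) :=
    (Submodule.subsingleton_iff k).1 (subsingleton_of_bot_eq_top h)
  have : Subsingleton G₀ := subsingleton_of_lieAlg (k := k) hG₀.connected
  exact not_subsingleton G₀ this

/-- `T'` is a torus; its rank is the number of isotypic components, where those that meet `𝔤₀` are
counted as one. -/
theorem isTorusOfRank_T' (hρ₀ : IsRegularRep k ρ₀) (hG₀ : IsSemisimple k G₀) :
    ∃ r : ℕ, IsTorusOfRank (glCoord k (U₀ × LieAlg k G₀)) (T' k ρ₀) r ∧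
      (Nontrivial G₀ →
        (r : ℤ) = 1 + numIsotypic k (rho0' k ρ₀) - numSimpleFactors k (LieAlg k G₀)) := by
  classical
  have hrad := hasTrivialRadical hG₀
  have hss := isSemisimpleModule_rho0' hρ₀ hG₀
  have : IsNoetherian (MonoidAlgebra k G₀) (rho0' k ρ₀).asModule :=
    isNoetherian_of_tower k (inferInstance : IsNoetherian k (rho0' k ρ₀).asModule)
  set C := isotypicComponents (MonoidAlgebra k G₀) (rho0' k ρ₀).asModule with hC
  set S := adjointComponents hG₀ ρ₀ with hS
  -- All components meeting `𝔤₀` in a simple ideal share the parameter `none`; each other component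
  -- keeps its own. The range of `q₀` is used because `none` is not attained when `𝔤₀ = 0`.
  let q₀ : C → Option C := fun c => if c ∈ S then none else some c
  let q : C → Set.range q₀ := Set.rangeFactorization q₀
  have hqS : ∀ c ∈ S, q₀ c = none := fun c hc => if_pos hc
  have hqS' : ∀ c ∉ S, q₀ c = some c := fun c hc => if_neg hc
  let _ : Fintype (Set.range q₀) := Fintype.ofFinite _
  refine ⟨Fintype.card (Set.range q₀), ?_, fun hnt => ?_⟩
  · refine isTorusOfRank_of_decomposition (M := fun c : C => toSubspace (rho0' k ρ₀) c) (q := q)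
      (iSupIndep_toSubspace _) (iSup_toSubspace _) (toSubspace_ne_bot _)
      Set.rangeFactorization_surjective fun t => ?_
    rw [mem_T'_iff, mem_center_endAlg_iff]
    constructor
    · rintro ⟨h, μ, hμ⟩
      choose a ha using h
      have hne : ∀ c hc, a c hc ≠ 0 := by
        intro c hc h0
        apply toSubspace_ne_bot _ ⟨c, hc⟩
        rw [eq_bot_iff]
        intro v hv
        have h1 := ha c hc v hv
        rw [h0, zero_smul] at h1
        have h2 : (t⁻¹ * t).1 v = v := by rw [inv_mul_cancel]; rfl
        change (t⁻¹).1 (t.1 v) = v at h2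
        rw [h1, map_zero] at h2
        rw [Submodule.mem_bot, h2]
      refine ⟨fun i => i.1.elim μ fun c => Units.mk0 (a c c.2) (hne c c.2), fun c v hv => ?_⟩
      change t.1 v = (((q₀ c).elim μ fun c => Units.mk0 (a c c.2) (hne c c.2) : kˣ) : k) • v
      by_cases hc : c ∈ S
      · rw [hqS c hc]
        obtain ⟨I, hI, hcI⟩ := hc
        have hsimple := isSimpleModule_idealSubmodule (ρ₀ := ρ₀) hρ₀ hG₀ hI
        obtain ⟨x, hx, hx0⟩ : ∃ x ∈ I, x ≠ 0 := by
          by_contra hcon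
          push Not at hcon
          exact hI.1 (eq_bot_iff.2 fun x hx => (LieSubmodule.mem_bot x).2 (hcon x hx))
        have hxc : ((0, x) : U₀ × LieAlg k G₀) ∈ toSubspace (rho0' k ρ₀) c := by
          rw [mem_toSubspace, hcI]
          exact Submodule.le_isotypicComponent _ (mem_idealSubmodule.2 ⟨x, hx, by simp⟩)
        have h1 := ha c c.2 _ hxc
        rw [hμ] at h1
        have h2 : (μ : k) = a c c.2 := smul_left_injective k hx0 (congrArg Prod.snd h1)
        rw [ha c c.2 v hv, ← h2]; rfl
      · rw [hqS' c hc]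
        exact ha c c.2 v hv
    · rintro ⟨a, ha⟩
      refine ⟨fun c hc => ⟨_, ha ⟨c, hc⟩⟩, ?_⟩
      -- If `none` is not attained there are no simple ideals and `𝔤₀ = 0`, so the default `1` is
      -- harmless.
      let μ : kˣ := if h : none ∈ Set.range q₀ then a ⟨none, h⟩ else 1
      refine ⟨μ, fun x => ?_⟩
      have htop := atom_induction (k := k) (L := LieAlg k G₀)
        (p := LinearMap.ker ((t.1 - (μ : k) • LinearMap.id) ∘ₗ LinearMap.inr k U₀ (LieAlg k G₀)))
        fun I hI x hx => by
          have hsimple := isSimpleModule_idealSubmodule (ρ₀ := ρ₀) hρ₀ hG₀ hI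
          let c : C := ⟨_, _, hsimple, rfl⟩
          have hc : c ∈ S := ⟨I, hI, rfl⟩
          have hxc : ((0, x) : U₀ × LieAlg k G₀) ∈ toSubspace (rho0' k ρ₀) c := by
            rw [mem_toSubspace]
            exact Submodule.le_isotypicComponent _ (mem_idealSubmodule.2 ⟨x, hx, by simp⟩)
          have h1 := ha c _ hxc
          have h2 : none ∈ Set.range q₀ := ⟨c, hqS c hc⟩
          have h3 : a (q c) = μ := by
            have : q c = ⟨none, h2⟩ := Subtype.ext (hqS c hc)
            rw [this]
            simp only [μ, dif_pos h2]
          rw [LinearMap.mem_ker, LinearMap.comp_apply, LinearMap.sub_apply, sub_eq_zero,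
            LinearMap.smul_apply, LinearMap.inr_apply, h1, h3]
          rfl
      have hx : x ∈ (⊤ : Submodule k (LieAlg k G₀)) := trivial
      rw [← htop, LinearMap.mem_ker, LinearMap.comp_apply, LinearMap.sub_apply, sub_eq_zero] at hx
      exact hx
  · obtain ⟨c₀, hc₀⟩ := adjointComponents_nonempty hρ₀ hG₀
    -- For `G₀ ≠ 1` the value `none` is attained, so the rank is one plus the number of components
    -- without a simple ideal.
    have hrange : Set.range q₀ = insert none (some '' Sᶜ) := by
      ext o
      constructor
      · rintro ⟨c, rfl⟩
        by_cases hc : c ∈ S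
        · left; exact hqS c hc
        · right; exact ⟨c, hc, (hqS' c hc).symm⟩
      · rintro (rfl | ⟨c, hc, rfl⟩)
        · exact ⟨c₀, hqS c₀ hc₀⟩
        · exact ⟨c, hqS' c hc⟩
    have h1 : (Set.range q₀).ncard = Sᶜ.ncard + 1 := by
      rw [hrange, Set.ncard_insert_of_notMem (by simp),
        Set.ncard_image_of_injective _ (Option.some_injective _)]
    have h2 : S.ncard + Sᶜ.ncard = numIsotypic k (rho0' k ρ₀) :=
      (Set.ncard_add_ncard_compl S).trans (Nat.card_coe_set_eq _)
    have h3 : S.ncard = numSimpleFactors k (LieAlg k G₀) := ncard_adjointComponents hρ₀ hG₀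
    rw [← Nat.card_eq_fintype_card, Nat.card_coe_set_eq]
    omega

end CentralTorus

/-! ### Unravelling the stabilizer -/

section Stabilizer

variable {k : Type*} [Field k] {G₀ : Type*} [Group G₀] [AffineAlgGroup k G₀]
  {U : Type*} [AddCommGroup U] [Module k U]
  {U₀ : Type*} [AddCommGroup U₀] [Module k U₀] {ρ₀ : Representation k G₀ U₀}

theorem mem_scalars_iff {V : Type*} [AddCommGroup V] [Module k V]
    {t : LinearMap.GeneralLinearGroup k V} :
    t ∈ scalars k V ↔ ∃ c : kˣ, ∀ v, t.1 v = (c : k) • v := by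
  constructor
  · rintro ⟨c, rfl⟩
    exact ⟨c, fun v => rfl⟩
  · rintro ⟨c, hc⟩
    exact ⟨c, Units.ext (LinearMap.ext fun v => (hc v).symm)⟩

theorem eq_zero_of_apply_eq_zero {V : Type*} [AddCommGroup V] [Module k V]
    (t : LinearMap.GeneralLinearGroup k V) {v : V} (h : t.1 v = 0) : v = 0 := by
  have h2 : (t⁻¹ * t).1 v = v := by rw [inv_mul_cancel]; rfl
  change (t⁻¹).1 (t.1 v) = v at h2
  rw [← h2, h, map_zero]

theorem commute_adjoin_singleton_iff {A : Type*} [Ring A] [Algebra k A] {a t : A} :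
    (∀ b ∈ Algebra.adjoin k {a}, Commute t b) ↔ Commute t a := by
  refine ⟨fun h => h a (Algebra.subset_adjoin rfl), fun h b hb => ?_⟩
  have hle : Algebra.adjoin k {a} ≤ Subalgebra.centralizer k {t} :=
    Algebra.adjoin_le (by
      rintro _ rfl
      exact Subalgebra.mem_centralizer_iff k |>.2 (by rintro _ rfl; exact h))
  exact Subalgebra.mem_centralizer_iff k |>.1 (hle hb) t rfl

/-- The projection of `U₀ ⊕ 𝔤₀` onto `𝔤₀` is an endomorphism of the representation. -/
theorem inr_comp_snd_mem_endAlg :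
    LinearMap.inr k U₀ (LieAlg k G₀) ∘ₗ LinearMap.snd k U₀ (LieAlg k G₀) ∈
      endAlg k (rho0' k ρ₀) := by
  rw [mem_endAlg_iff]
  intro g v
  simp [rho0'_apply]

theorem rho0'_commute_endAlg (h : G₀) {s : Module.End k (U₀ × LieAlg k G₀)}
    (hs : s ∈ endAlg k (rho0' k ρ₀)) : Commute (rho0' k ρ₀ h) s :=
  LinearMap.ext fun v => ((mem_endAlg_iff _).1 hs h v).symm

/-- Compare `t` with the projection onto `𝔤₀`, one of the endomorphisms it commutes with. -/
theorem apply_inr_eq {t : Module.End k (U₀ × LieAlg k G₀)}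
    (ht : ∀ s ∈ endAlg k (rho0' k ρ₀), Commute t s) (v : U₀ × LieAlg k G₀) :
    t (0, v.2) = (0, (t v).2) :=
  LinearMap.congr_fun (ht _ inr_comp_snd_mem_endAlg) v

theorem tensorAct_tmul (g : Ambient k G₀ U U₀) (x : U) (u : U × LieAlg k G₀)
    (v : U₀ × LieAlg k G₀) :
    tensorAct k G₀ U U₀ g (x ⊗ₜ (u ⊗ₜ v)) = g.1.1 x ⊗ₜ (g.2.1.1 u ⊗ₜ g.2.2.1 v) := rfl

variable [FiniteDimensional k U₀] {hρ₀ : IsRegularRep k ρ₀} {e : U}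

theorem endoA_tmul (x : U) (u : U × LieAlg k G₀) (v : U₀ × LieAlg k G₀) :
    endoA k U hρ₀ e (x ⊗ₜ (u ⊗ₜ v)) =
      x ⊗ₜ (((0, v.2) : U × LieAlg k G₀) ⊗ₜ[k] ((0, u.2) : U₀ × LieAlg k G₀) +
          ((e, 0) : U × LieAlg k G₀) ⊗ₜ[k] rho0'der k hρ₀ u.2 v) := by
  simp [endoA]

theorem mem_stab_iff {g : Ambient k G₀ U U₀} : g ∈ stab k U hρ₀ e ↔
    Commute (tensorAct k G₀ U U₀ g) (endoA k U hρ₀ e) ∧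
      Commute g.2.1.1 (endoA' k (G₀ := G₀) U) ∧
      ∀ b ∈ endAlg k (rho0' k ρ₀), Commute g.2.2.1 b := by
  rw [← commute_adjoin_singleton_iff (k := k), ← commute_adjoin_singleton_iff (k := k)]
  rfl

/-- The four conditions match the two terms of `a`: in the first, `l` moves across the tensor
product of the two copies of `𝔤₀`; in the second, `c` comes from the action on `e` and is absorbed
by `hder`. -/
theorem mem_stab_of_intertwines {g : Ambient k G₀ U U₀} {c l : k} {γ : Module.End k (LieAlg k G₀)}
    (hg' : ∀ u, g.2.1.1 u = (c • u.1, γ u.2)) (hg₀ : ∀ v, (g.2.2.1 v).2 = l • γ v.2)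
    (hcomm : ∀ b ∈ endAlg k (rho0' k ρ₀), Commute g.2.2.1 b)
    (hder : ∀ x v, c • g.2.2.1 (rho0'der k hρ₀ x v) = rho0'der k hρ₀ (γ x) (g.2.2.1 v)) :
    g ∈ stab k U hρ₀ e := by
  refine mem_stab_iff.2 ⟨?_, ?_, hcomm⟩
  · refine TensorProduct.ext' fun x w => ?_
    induction w with
    | zero => simp
    | add a b ha hb => simp only [TensorProduct.tmul_add, map_add, ha, hb]
    | tmul u v =>
      rw [Module.End.mul_apply, Module.End.mul_apply, endoA_tmul, tensorAct_tmul, endoA_tmul,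
        TensorProduct.tmul_add, map_add, tensorAct_tmul, tensorAct_tmul, ← TensorProduct.tmul_add,
        hg', hg', hg']
      congr 1
      have h1 : g.2.2.1 (0, u.2) = l • (0, γ u.2) := by
        rw [apply_inr_eq hcomm (0, u.2), hg₀]
        simp
      have h2 : ((0, l • γ v.2) : U × LieAlg k G₀) = l • (0, γ v.2) := by simp
      have h3 : ((c • e, 0) : U × LieAlg k G₀) = c • (e, 0) := by simp
      simp only [smul_zero, map_zero, h1, hg₀, h2, h3, TensorProduct.smul_tmul,
        TensorProduct.tmul_smul, ← hder]
  · refine LinearMap.ext fun u => ?_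
    simp [Module.End.mul_apply, endoA', hg']

/-- The components of an element of the stabilizer. -/
theorem exists_components_of_mem_stab (hU : Module.finrank k U = 1) (he : e ≠ 0)
    {g : Ambient k G₀ U U₀} (hg : g ∈ stab k U hρ₀ e) :
    g.1 ∈ scalars k U ∧ ∃ (c l : kˣ) (γ : LieAlg k G₀ ≃ₗ[k] LieAlg k G₀),
      (∀ u, g.2.1.1 u = ((c : k) • u.1, γ u.2)) ∧
      (∀ v, (g.2.2.1 v).2 = (l : k) • γ v.2) ∧
      ∀ x v, (c : k) • g.2.2.1 (rho0'der k hρ₀ x v) = rho0'der k hρ₀ (γ x) (g.2.2.1 v) := by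
  obtain ⟨hA, hA', hcomm⟩ := mem_stab_iff.1 hg
  have hspan : ∀ x : U, ∃ s : k, s • e = x := fun x =>
    (finrank_eq_one_iff_of_nonzero' e he).1 hU x
  obtain ⟨f, hf⟩ := Module.Projective.exists_dual_eq_one k he
  obtain ⟨b, hb⟩ := hspan (g.1.1 e)
  have hb0 : b ≠ 0 := by
    rintro rfl
    exact he (eq_zero_of_apply_eq_zero g.1 (by rw [← hb, zero_smul]))
  -- Commuting with the projection `a'` means preserving its image `U` and its kernel `𝔤₀`.
  have h1 : ∀ u, g.2.1.1 (u.1, 0) = ((g.2.1.1 u).1, 0) := fun u => LinearMap.congr_fun hA' u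
  have h2 : ∀ y, (g.2.1.1 (0, y)).1 = 0 := fun y => by
    have := h1 (0, y)
    rw [Prod.mk_zero_zero, map_zero] at this
    exact (congrArg Prod.fst this).symm
  obtain ⟨c, hc⟩ := hspan (g.2.1.1 (e, 0)).1
  have hgc : g.2.1.1 (e, 0) = (c • e, 0) := by rw [hc]; exact h1 (e, 0)
  have hc0 : c ≠ 0 := by
    rintro rfl
    rw [zero_smul] at hgc
    exact he (congrArg Prod.fst (eq_zero_of_apply_eq_zero g.2.1 hgc))
  let γ₀ : Module.End k (LieAlg k G₀) :=
    LinearMap.snd k U (LieAlg k G₀) ∘ₗ g.2.1.1 ∘ₗ LinearMap.inr k U (LieAlg k G₀)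
  have hγ₀ : ∀ y, g.2.1.1 (0, y) = (0, γ₀ y) := fun y => Prod.ext (h2 y) rfl
  have hγinj : Function.Injective γ₀ := by
    rw [injective_iff_map_eq_zero]
    intro y hy
    have := hγ₀ y
    rw [hy] at this
    exact congrArg Prod.snd (eq_zero_of_apply_eq_zero g.2.1 this)
  let γ : LieAlg k G₀ ≃ₗ[k] LieAlg k G₀ := LinearEquiv.ofInjectiveEndo γ₀ hγinj
  have hγ : ∀ y, g.2.1.1 (0, y) = (0, γ y) := hγ₀
  have hg' : ∀ u, g.2.1.1 u = (c • u.1, γ u.2) := by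
    rintro ⟨x, y⟩
    obtain ⟨s, rfl⟩ := hspan x
    have h3 : ((s • e, y) : U × LieAlg k G₀) = s • (e, 0) + (0, y) := by simp
    rw [h3, map_add, map_smul, hgc, hγ]
    simp [smul_comm c s]
  -- Tensoring with the nonzero vector `g e` is injective, so the factor `U` can be dropped from the
  -- relation with `a`.
  have hF : ∀ z w : (U × LieAlg k G₀) ⊗[k] (U₀ × LieAlg k G₀),
      g.1.1 e ⊗ₜ[k] z = g.1.1 e ⊗ₜ[k] w → z = w := by
    intro z w h
    have h4 := congrArg (TensorProduct.lid k _ ∘ LinearMap.rTensor _ f) h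
    simp only [Function.comp_apply, LinearMap.rTensor_tmul, ← hb, map_smul, hf,
      TensorProduct.lid_tmul] at h4
    exact smul_right_injective _ (by simpa using hb0) h4
  have key : ∀ (x : LieAlg k G₀) (v : U₀ × LieAlg k G₀),
      ((0, γ v.2) : U × LieAlg k G₀) ⊗ₜ[k] g.2.2.1 (0, x) +
        ((c • e, 0) : U × LieAlg k G₀) ⊗ₜ[k] g.2.2.1 (rho0'der k hρ₀ x v) =
      ((0, (g.2.2.1 v).2) : U × LieAlg k G₀) ⊗ₜ[k] ((0, γ x) : U₀ × LieAlg k G₀) +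
        ((e, 0) : U × LieAlg k G₀) ⊗ₜ[k] rho0'der k hρ₀ (γ x) (g.2.2.1 v) := by
    intro x v
    have h5 := LinearMap.congr_fun hA (e ⊗ₜ (((0, x) : U × LieAlg k G₀) ⊗ₜ v))
    rw [Module.End.mul_apply, Module.End.mul_apply, endoA_tmul, tensorAct_tmul, endoA_tmul,
      TensorProduct.tmul_add, map_add, tensorAct_tmul, tensorAct_tmul, ← TensorProduct.tmul_add,
      hγ, hγ, hgc] at h5
    exact hF _ _ h5
  -- Taking the coefficient of `e` in `U'` removes the swap term.
  have hE1 : ∀ x v, c • g.2.2.1 (rho0'der k hρ₀ x v) =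
      rho0'der k hρ₀ (γ x) (g.2.2.1 v) := by
    intro x v
    have h6 := congrArg (TensorProduct.lid k _ ∘ LinearMap.rTensor _
      (f ∘ₗ LinearMap.fst k U (LieAlg k G₀))) (key x v)
    simpa [hf] using h6
  -- Projecting both factors to `𝔤₀` removes the term with `e`. Evaluating the remaining identity of
  -- tensors at a fixed `y ≠ 0` shows that `g₀'` is proportional to `γ` on `𝔤₀`.
  have hE2 : ∀ x (v : U₀ × LieAlg k G₀),
      γ v.2 ⊗ₜ[k] (g.2.2.1 (0, x)).2 = (g.2.2.1 v).2 ⊗ₜ[k] γ x := by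
    intro x v
    have h6 := congrArg (TensorProduct.map (LinearMap.snd k U (LieAlg k G₀))
      (LinearMap.snd k U₀ (LieAlg k G₀))) (key x v)
    simpa using h6
  refine ⟨mem_scalars_iff.2 ⟨Units.mk0 b hb0, fun x => ?_⟩, Units.mk0 c hc0, ?_⟩
  · obtain ⟨s, rfl⟩ := hspan x
    rw [map_smul, ← hb]
    exact smul_comm s b e
  have hsnd : ∀ v, (g.2.2.1 v).2 = (g.2.2.1 (0, v.2)).2 := fun v => by rw [apply_inr_eq hcomm v]
  suffices ∃ l : kˣ, ∀ x, (g.2.2.1 (0, x)).2 = (l : k) • γ x by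
    obtain ⟨l, hl⟩ := this
    exact ⟨l, γ, hg', fun v => by rw [hsnd, hl], hE1⟩
  rcases subsingleton_or_nontrivial (LieAlg k G₀) with hL | hL
  -- If `𝔤₀ = 0`, any `l` serves.
  · exact ⟨1, fun x => Subsingleton.elim _ _⟩
  obtain ⟨y, hy⟩ := exists_ne (0 : LieAlg k G₀)
  have hγy : γ y ≠ 0 := fun h => hy (by simpa using h)
  obtain ⟨f', hf'⟩ := Module.Projective.exists_dual_eq_one k hγy
  have hl : ∀ x, (g.2.2.1 (0, x)).2 = f' (g.2.2.1 (0, y)).2 • γ x := by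
    intro x
    have h7 := congrArg (TensorProduct.lid k _ ∘ LinearMap.rTensor _ f') (hE2 x (0, y))
    simpa [hf'] using h7
  refine ⟨Units.mk0 (f' (g.2.2.1 (0, y)).2) fun h0 => hy ?_, hl⟩
  have h8 := hl y
  rw [h0, zero_smul] at h8
  have h9 := apply_inr_eq hcomm (0, y)
  rw [h8] at h9
  exact congrArg Prod.snd (eq_zero_of_apply_eq_zero g.2.2 h9)

end Stabilizer

/-! ### Decomposition of `G⁰` and its center -/

section Structure

variable {k : Type*} [Field k] {G₀ : Type*} [Group G₀]
  [AffineAlgGroup k G₀] {U : Type*} [AddCommGroup U] [Module k U]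
  {U₀ : Type*} [AddCommGroup U₀] [Module k U₀] [FiniteDimensional k U₀]
  {ρ₀ : Representation k G₀ U₀} {hρ₀ : IsRegularRep k ρ₀} {e : U}

variable (k U ρ₀) in
/-- The group `𝔾ₘ × 𝔾ₘ × T'`. -/
def scalarsProdT' : Subgroup (Ambient k G₀ U U₀) :=
  (scalars k U).prod ((scalars k (U × LieAlg k G₀)).prod (T' k ρ₀))

theorem embed_mem_stab (h : G₀) : embed k U ρ₀ h ∈ stab k U hρ₀ e :=
  mem_stab_of_intertwines (c := 1) (l := 1) (γ := Ad k h)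
    (fun u => by rw [one_smul]; rfl) (fun v => by rw [one_smul]; rfl)
    (fun b hb => rho0'_commute_endAlg h hb)
    (fun x v => by
      rw [one_smul]
      exact (derived_Ad_apply (hρ₀.prod k (isRegularRep_Ad k)) h x v).symm)

variable [IsAlgClosed k]

/-- Here `γ` is the scalar `c`, and `t` is a scalar `μ = l c` on `𝔤₀`, which gives `l = c⁻¹ μ`; the
intertwining condition says that `t` commutes with `𝔤₀`. -/
theorem scalarsProdT'_le_stab : scalarsProdT' k U ρ₀ ≤ stab k U hρ₀ e := by
  rintro ⟨g, g', t⟩ ⟨-, hg', ht⟩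
  obtain ⟨c, hc⟩ := mem_scalars_iff.1 hg'
  obtain ⟨⟨ht, hcomm⟩, μ, hμ⟩ := mem_T'_iff.1 ht
  refine mem_stab_of_intertwines (c := c) (l := (c : k)⁻¹ * μ) (γ := (c : k) • LinearMap.id)
    (fun u => hc u) (fun v => ?_) hcomm (fun x v => ?_)
  · have h1 := apply_inr_eq hcomm v
    dsimp only at h1 hμ ⊢
    rw [hμ] at h1
    rw [← congrArg Prod.snd h1]
    simp [smul_smul, mul_comm]
  · dsimp only
    rw [LinearMap.smul_apply, LinearMap.id_apply, map_smul, LinearMap.smul_apply]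
    congr 1
    exact commute_derived_of_commute (hρ₀.prod k (isRegularRep_Ad k)) ht x v

/-- The first two components are scalars, so only the third needs a condition. -/
theorem commute_of_mem_scalarsProdT' {z : Ambient k G₀ U U₀} (hz : z ∈ scalarsProdT' k U ρ₀)
    {w : Ambient k G₀ U U₀}
    (hw : ∀ s ∈ endAlg k (rho0' k ρ₀), (∀ b ∈ endAlg k (rho0' k ρ₀), Commute s b) →
      Commute s w.2.2.1) : z * w = w * z := by
  obtain ⟨hz1, hz2, hz3⟩ := hz
  obtain ⟨c, hc⟩ := mem_scalars_iff.1 hz1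
  obtain ⟨c', hc'⟩ := mem_scalars_iff.1 hz2
  obtain ⟨⟨h1, h2⟩, -⟩ := mem_T'_iff.1 hz3
  refine Prod.ext (Units.ext (LinearMap.ext fun v => ?_))
    (Prod.ext (Units.ext (LinearMap.ext fun v => ?_)) (Units.ext (hw _ h1 h2)))
  · change z.1.1 (w.1.1 v) = w.1.1 (z.1.1 v)
    rw [hc, hc, map_smul]
  · change z.2.1.1 (w.2.1.1 v) = w.2.1.1 (z.2.1.1 v)
    rw [hc', hc', map_smul]

variable [CharZero k]

/-- The summand `𝔤₀` carries the adjoint representation, which is faithful because the center is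
trivial. -/
theorem rho0'der_injective (hG₀ : IsSemisimple k G₀) :
    Function.Injective (rho0'der k hρ₀) := by
  have := hasTrivialRadical hG₀
  rw [injective_iff_map_eq_zero]
  intro x hx
  have h1 : x ∈ (LieAlgebra.ad k (LieAlg k G₀)).ker := by
    rw [LieHom.mem_ker]
    refine LinearMap.ext fun y => ?_
    have h2 := LinearMap.congr_fun hx (0, y)
    rw [rho0'der_apply] at h2
    exact congrArg Prod.snd h2
  rw [LieAlgebra.ad_ker_eq_bot_of_hasTrivialRadical] at h1
  exact (LieSubmodule.mem_bot x).1 h1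

/-- A linear automorphism of `𝔤₀` that is intertwined with the identity by an automorphism of a
faithful representation is an automorphism of Lie algebras. -/
def lieAutOfIntertwines (hG₀ : IsSemisimple k G₀) (γ : LieAlg k G₀ ≃ₗ[k] LieAlg k G₀)
    (t : LinearMap.GeneralLinearGroup k (U₀ × LieAlg k G₀))
    (h : ∀ x v, t.1 (rho0'der k hρ₀ x v) = rho0'der k hρ₀ (γ x) (t.1 v)) :
    LieAlg k G₀ ≃ₗ⁅k⁆ LieAlg k G₀ :=
  { γ with
    map_lie' := by
      intro x y
      apply rho0'der_injective (hρ₀ := hρ₀) hG₀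
      refine LinearMap.ext fun w => ?_
      obtain ⟨v, rfl⟩ : ∃ v, t.1 v = w := ⟨(t⁻¹).1 w, by
        change (t * t⁻¹).1 w = w
        rw [mul_inv_cancel]; rfl⟩
      change rho0'der k hρ₀ (γ ⁅x, y⁆) (t.1 v) = rho0'der k hρ₀ ⁅γ x, γ y⁆ (t.1 v)
      rw [← h, LieHom.map_lie, LieHom.map_lie]
      simp only [Ring.lie_def, LinearMap.sub_apply, Module.End.mul_apply, map_sub, h] }

/-- The automorphism of `𝔤₀` induced by an element of the centralizer of `End_{G₀}(U₀')` is
inner. -/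
theorem isInnerAut_of_intertwines (hG₀ : IsSemisimple k G₀)
    (hasymm : IsAsymmetrical (rho0'der k hρ₀)) (α : LieAlg k G₀ ≃ₗ⁅k⁆ LieAlg k G₀)
    (t : LinearMap.GeneralLinearGroup k (U₀ × LieAlg k G₀))
    (hcomm : ∀ b ∈ endAlg k (rho0' k ρ₀), Commute t.1 b)
    (h : ∀ x v, t.1 (rho0'der k hρ₀ x v) = rho0'der k hρ₀ (α x) (t.1 v)) : IsInnerAut α := by
  by_contra hα
  -- Being the image of a projection in `End_{G₀}(U₀')`, `W` is preserved by `t`, and the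
  -- restriction of `t` is an equivalence of `W` with its twist by `α`.
  obtain ⟨W, hW, hno⟩ := hasymm α hα
  obtain ⟨p, hp, hpW, hpw⟩ := exists_endAlg_projection hρ₀ hG₀ W fun g w hw =>
    map_mem_of_derived_mem hG₀.connected (hρ₀.prod k (isRegularRep_Ad k)) W hW g hw
  have htW : ∀ w ∈ W, t.1 w ∈ W := fun w hw => by
    have h1 := LinearMap.congr_fun (hcomm p hp) w
    rw [Module.End.mul_apply, Module.End.mul_apply, hpw w hw] at h1
    rw [h1]; exact hpW _
  refine hno ⟨LinearEquiv.ofInjectiveEndo (t.1.restrict htW) ?_, fun x w => ?_⟩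
  · rw [injective_iff_map_eq_zero]
    intro w hw
    exact Subtype.ext (eq_zero_of_apply_eq_zero t (congrArg Subtype.val hw))
  · exact Subtype.ext (h x w)

/-- This is the core of the argument: after the scalar `c` is divided out, the automorphism of `𝔤₀`
is `Ad h`, and dividing by `h` leaves only central elements. -/
theorem exists_eq_mul_embed (hG₀ : IsSemisimple k G₀) (hasymm : IsAsymmetrical (rho0'der k hρ₀))
    (hU : Module.finrank k U = 1) (he : e ≠ 0) {g : Ambient k G₀ U U₀}
    (hg : g ∈ stab k U hρ₀ e) :
    ∃ z ∈ scalarsProdT' k U ρ₀, ∃ h : G₀, g = z * embed k U ρ₀ h := by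
  obtain ⟨hg1, c, l, γ, hg', hg₀, hder⟩ := exists_components_of_mem_stab hU he hg
  have hcomm := (mem_stab_iff.1 hg).2.2
  -- Only `c⁻¹ γ`, not `γ`, is compatible with the bracket.
  have hder' : ∀ x v, g.2.2.1 (rho0'der k hρ₀ x v) =
      rho0'der k hρ₀ ((γ.trans (LinearEquiv.smulOfUnit c⁻¹)) x) (g.2.2.1 v) := by
    intro x v
    change _ = rho0'der k hρ₀ ((c⁻¹ : kˣ) • γ x) (g.2.2.1 v)
    rw [Units.smul_def, map_smul, LinearMap.smul_apply, ← hder, smul_smul, Units.inv_mul, one_smul]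
  let α := lieAutOfIntertwines hG₀ _ g.2.2 hder'
  obtain ⟨h, hh⟩ := exists_Ad_eq_of_isInnerAut hG₀
    (isInnerAut_of_intertwines hG₀ hasymm α g.2.2 hcomm hder')
  have hγ : ∀ x, γ x = (c : k) • Ad k h x := fun x => by
    rw [hh]
    change γ x = (c : k) • (c⁻¹ : kˣ) • γ x
    rw [Units.smul_def, smul_smul, Units.mul_inv, one_smul]
  have hdh : ∀ x v, g.2.2.1 (rho0'der k hρ₀ x v) =
      rho0'der k hρ₀ (Ad k h x) (g.2.2.1 v) := fun x v => by
    rw [hh]; exact hder' x v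
  -- Both `g₀'` and `ρ₀'(h)` twist `𝔤₀` by `Ad h` and commute with `End_{G₀}(U₀')`. Their quotient
  -- `τ` commutes with `𝔤₀`, hence with the connected group `G₀`, and still with all of
  -- `End_{G₀}(U₀')`.
  let τ : LinearMap.GeneralLinearGroup k (U₀ × LieAlg k G₀) :=
    g.2.2 * ((rho0' k ρ₀).toHomUnits h)⁻¹
  have hτ : ∀ v, τ.1 (rho0' k ρ₀ h v) = g.2.2.1 v := fun v => by
    change (τ * (rho0' k ρ₀).toHomUnits h).1 v = _
    rw [inv_mul_cancel_right]
  have hsurj : ∀ w, ∃ v, rho0' k ρ₀ h v = w := fun w =>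
    ⟨rho0' k ρ₀ h⁻¹ w, (rho0' k ρ₀).self_inv_apply h w⟩
  have hτder : ∀ x w, τ.1 (rho0'der k hρ₀ x w) = rho0'der k hρ₀ x (τ.1 w) := by
    intro x w
    obtain ⟨v, rfl⟩ := hsurj w
    obtain ⟨y, rfl⟩ : ∃ y, Ad k h y = x := ⟨Ad k h⁻¹ x, (Ad k).self_inv_apply h x⟩
    have h1 := derived_Ad_apply (hρ₀.prod k (isRegularRep_Ad k)) h y v
    change rho0'der k hρ₀ (Ad k h y) (rho0' k ρ₀ h v) = rho0' k ρ₀ h (rho0'der k hρ₀ y v) at h1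
    rw [h1, hτ, hτ, hdh]
  have hτend : τ.1 ∈ endAlg k (rho0' k ρ₀) := (mem_endAlg_iff _).2 fun g v =>
    commute_of_commute_derived hG₀.connected (hρ₀.prod k (isRegularRep_Ad k)) τ.1 hτder g v
  have hτcomm : ∀ s ∈ endAlg k (rho0' k ρ₀), Commute τ.1 s := fun s hs => by
    refine LinearMap.ext fun w => ?_
    obtain ⟨v, rfl⟩ := hsurj w
    rw [Module.End.mul_apply, Module.End.mul_apply, hτ, (mem_endAlg_iff _).1 hs, hτ]
    exact LinearMap.congr_fun (hcomm s hs) v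
  refine ⟨(g.1, Units.map (algebraMap k (Module.End k (U × LieAlg k G₀))).toMonoidHom c, τ),
    ⟨hg1, ⟨c, rfl⟩, mem_T'_iff.2 ⟨⟨hτend, hτcomm⟩, l * c, fun x => ?_⟩⟩, h, ?_⟩
  -- On `𝔤₀`, `τ` sends `Ad h y` to `l γ y = l c Ad h y`; this is the scalar `l * c`.
  · obtain ⟨y, rfl⟩ : ∃ y, Ad k h y = x := ⟨Ad k h⁻¹ x, (Ad k).self_inv_apply h x⟩
    have h1 : ((0, Ad k h y) : U₀ × LieAlg k G₀) = rho0' k ρ₀ h (0, y) := by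
      rw [rho0'_apply, map_zero]
    rw [h1, hτ, apply_inr_eq hcomm (0, y), hg₀, hγ, ← h1]
    simp [smul_smul]
  · refine Prod.ext ?_ (Prod.ext ?_ ?_)
    · refine Units.ext (LinearMap.ext fun x => ?_)
      rfl
    · refine Units.ext (LinearMap.ext fun u => ?_)
      rw [hg', hγ]
      rfl
    · exact (inv_mul_cancel_right g.2.2 ((rho0' k ρ₀).toHomUnits h)).symm

/-- A central element is `z h` with `z` in the torus; as `z` commutes with `G₀`, so does `h` by
faithfulness. Then `Ad h` is trivial and `h` itself lies in `1 × 1 × T'`. Conversely, the `T'`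
component of a torus element belongs to `End_{G₀}(U₀')`, with which `G⁰` commutes. -/
theorem T0_eq (hG₀ : IsSemisimple k G₀) (hfaithful : Function.Injective (rho0' k ρ₀))
    (hasymm : IsAsymmetrical (rho0'der k hρ₀)) (hU : Module.finrank k U = 1) (he : e ≠ 0) :
    T0 k U hρ₀ e = scalarsProdT' k U ρ₀ := by
  apply le_antisymm
  · rintro _ ⟨⟨g, hg⟩, hcen, rfl⟩
    obtain ⟨z, hz, h, rfl⟩ := exists_eq_mul_embed hG₀ hasymm hU he hg
    refine mul_mem hz ?_
    have hcomm : ∀ h', h * h' = h' * h := by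
      intro h'
      have h1 := congrArg (fun x => (Subtype.val x).2.2.1)
        (Subgroup.mem_center_iff.1 hcen ⟨_, embed_mem_stab h'⟩)
      have h2 : rho0' k ρ₀ h' * (z.2.2.1 * rho0' k ρ₀ h) =
        (z.2.2.1 * rho0' k ρ₀ h) * rho0' k ρ₀ h' := h1
      obtain ⟨⟨hz1, -⟩, -⟩ := mem_T'_iff.1 hz.2.2
      have h3 : rho0' k ρ₀ h' * z.2.2.1 = z.2.2.1 * rho0' k ρ₀ h' :=
        LinearMap.ext fun v => ((mem_endAlg_iff _).1 hz1 h' v).symm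
      rw [← mul_assoc, h3, mul_assoc, mul_assoc] at h2
      have h4 := (Units.mul_right_inj z.2.2).1 h2
      rw [← map_mul, ← map_mul] at h4
      exact (hfaithful h4).symm
    have hend : rho0' k ρ₀ h ∈ endAlg k (rho0' k ρ₀) := (mem_endAlg_iff _).2 fun g v => by
      rw [← Module.End.mul_apply, ← Module.End.mul_apply, ← map_mul, ← map_mul, hcomm]
    -- Conjugating `dρ₀'(x)` by `ρ₀'(h)` gives `dρ₀'(Ad h x)`, but `ρ₀'(h)` is an equivariant
    -- endomorphism and so commutes with `dρ₀'(x)`.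
    have hAd : ∀ x, Ad k h x = x := by
      intro x
      apply rho0'der_injective (hρ₀ := hρ₀) hG₀
      refine LinearMap.ext fun w => ?_
      obtain ⟨v, rfl⟩ : ∃ v, rho0' k ρ₀ h v = w :=
        ⟨rho0' k ρ₀ h⁻¹ w, (rho0' k ρ₀).self_inv_apply h w⟩
      exact (derived_Ad_apply (hρ₀.prod k (isRegularRep_Ad k)) h x v).trans
        (commute_derived_of_commute (hρ₀.prod k (isRegularRep_Ad k)) hend x v)
    refine ⟨mem_scalars_iff.2 ⟨1, fun v => ?_⟩, mem_scalars_iff.2 ⟨1, fun v => ?_⟩,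
      mem_T'_iff.2 ⟨⟨hend, fun s hs => rho0'_commute_endAlg h hs⟩, 1, fun x => ?_⟩⟩
    · rw [Units.val_one, one_smul]; rfl
    · rw [Units.val_one, one_smul]
      exact Prod.ext rfl (hAd v.2)
    · rw [Units.val_one, one_smul]
      exact Prod.ext (map_zero (ρ₀ h)) (hAd x)
  · intro z hz
    refine ⟨⟨z, scalarsProdT'_le_stab hz⟩, ?_, rfl⟩
    rw [SetLike.mem_coe, Subgroup.mem_center_iff]
    rintro ⟨g, hg⟩
    refine Subtype.ext (commute_of_mem_scalarsProdT' hz fun s hs _ => ?_).symm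
    exact ((mem_stab_iff.1 hg).2.2 s hs).symm

theorem T0_mul_range_embed (hG₀ : IsSemisimple k G₀) (hfaithful : Function.Injective (rho0' k ρ₀))
    (hasymm : IsAsymmetrical (rho0'der k hρ₀)) (hU : Module.finrank k U = 1) (he : e ≠ 0) :
    (T0 k U hρ₀ e : Set (Ambient k G₀ U U₀)) * (embed k U ρ₀).range = stab k U hρ₀ e := by
  rw [T0_eq hG₀ hfaithful hasymm hU he]
  ext g
  constructor
  · rintro ⟨z, hz, _, ⟨h, rfl⟩, rfl⟩
    exact mul_mem (scalarsProdT'_le_stab hz) (embed_mem_stab h)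
  · intro hg
    obtain ⟨z, hz, h, rfl⟩ := exists_eq_mul_embed hG₀ hasymm hU he hg
    exact ⟨z, hz, _, ⟨h, rfl⟩, rfl⟩

end Structure

end

end AlgGrp

theorem mainTheorem12 {k : Type*} [Field k] [IsAlgClosed k] [CharZero k]
    {G₀ : Type*} [Group G₀] [AlgGrp.AffineAlgGroup k G₀] (hG₀ : AlgGrp.IsSemisimple k G₀)
    {U₀ : Type*} [AddCommGroup U₀] [Module k U₀] [FiniteDimensional k U₀]
    (ρ₀ : Representation k G₀ U₀) (hρ₀ : AlgGrp.IsRegularRep k ρ₀)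
    (hfaithful : Function.Injective (AlgGrp.rho0' k ρ₀))
    (hasymm : AlgGrp.IsAsymmetrical (AlgGrp.rho0'der k hρ₀))
    {U : Type*} [AddCommGroup U] [Module k U] (hU : Module.finrank k U = 1)
    (e : U) (he : e ≠ 0) :
    -- `T⁰ G₀ = G⁰`
    ((AlgGrp.T0 k U hρ₀ e : Set (AlgGrp.Ambient k G₀ U U₀)) * (AlgGrp.embed k U ρ₀).range =
      AlgGrp.stab k U hρ₀ e) ∧
    -- `T⁰ = 𝔾ₘ × 𝔾ₘ × T'`
    (AlgGrp.T0 k U hρ₀ e =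
      (AlgGrp.scalars k U).prod
        ((AlgGrp.scalars k (U × AlgGrp.LieAlg k G₀)).prod (AlgGrp.T' k ρ₀))) ∧
    -- `T⁰` is connected
    AlgGrp.IsZariskiConnected (AlgGrp.ambientCoord k G₀ U U₀)
      (AlgGrp.T0 k U hρ₀ e : Set (AlgGrp.Ambient k G₀ U U₀)) ∧
    -- `T'` is a torus
    (∃ r : ℕ, AlgGrp.IsTorusOfRank (AlgGrp.glCoord k (U₀ × AlgGrp.LieAlg k G₀))
      (AlgGrp.T' k ρ₀) r) ∧
    -- `T⁰` is a torus, and its rank is as stated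
    (∃ r : ℕ, AlgGrp.IsTorusOfRank (AlgGrp.ambientCoord k G₀ U U₀) (AlgGrp.T0 k U hρ₀ e) r ∧
      (Nontrivial G₀ →
        (r : ℤ) = 3 + AlgGrp.numIsotypic k (AlgGrp.rho0' k ρ₀) -
          AlgGrp.numSimpleFactors k (AlgGrp.LieAlg k G₀))) := by
  have hT := AlgGrp.T0_eq hG₀ hfaithful hasymm hU he
  have : Nontrivial U := ⟨e, 0, he⟩
  obtain ⟨r, hr, hrank⟩ := AlgGrp.isTorusOfRank_T' hρ₀ hG₀
  -- The scalars on `U` and on `U'` each contribute rank one, as both spaces are nonzero; with the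
  -- `1` in the rank of `T'` they make up the constant `3`.
  have htorus : AlgGrp.IsTorusOfRank (AlgGrp.ambientCoord k G₀ U U₀) (AlgGrp.T0 k U hρ₀ e)
      (1 + (1 + r)) := by
    rw [hT]
    exact AlgGrp.isTorusOfRank_scalars.prod (AlgGrp.isTorusOfRank_scalars.prod hr)
  refine ⟨AlgGrp.T0_mul_range_embed hG₀ hfaithful hasymm hU he, hT, htorus.isZariskiConnected,
    ⟨r, hr⟩, 1 + (1 + r), htorus, fun h => ?_⟩
  have := hrank h
  push_cast
  linarith
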